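/- Let $d\ge 2$ and let $D\subset\mathbb{R}^d$ be a bounded domain (nonempty, open, connected) with $C^\infty$ boundary, i.e. near every boundary point $D$ is, after a rigid motion, the part above the graph of a $C^\infty$ function. Let $\sigma$ be the $(d-1)$-dimensional surface measure on $\partial D$. Let $\kappa$ be a symmetric matrix-valued function on $D$ with components in $L^\infty(D)$ such that, for some $c>0$, $c^{-1}|\xi|^2\le \xi\cdot\kappa(x)\xi\le c|\xi|^2$ for all $\xi\in\mathbb{R}^d$ and a.e. $x\in D$. Let $$\mathcal{E}(v,w)=\int_D \kappa\nabla v\cdot\nabla w\,dx,\qquad v,w\in\mathcal{D}(\mathcal{E})=H^1(D),$$ where gradients are distributional and functions are real-valued. Let $\mathcal{D}_e(\mathcal{E})$ be its extended Dirichlet space, i.e. the set of functions $v:D\to\mathbb{R}$ (modulo equality a.e.) for which there is a sequence $(v_k)$ in $H^1(D)$ with $v_k\to v$ a.e. on $D$ and $\mathcal{E}(v_m-v_n,v_m-v_n)\to0$ as $m,n\to\infty$. Then $\mathcal{D}_e(\mathcal{E})=H^1(D)$; in particular every $v\in\mathcal{D}_e(\mathcal{E})$ has a boundary trace $v|_{\partial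 D}=\gamma v\in L^2(\partial D,\sigma)$, where $\gamma$ is the standard trace operator on $H^1(D)$ (the continuous extension of $w\mapsto w|_{\partial D}$, $w\in C^\infty(\overline D)$). Moreover, let $\widehat{\mathcal{E}}$ be the trace Dirichlet form on $L^2(\partial D,\sigma)$, $$\widehat{\mathcal{E}}(v,w)=\mathcal{E}(\mathcal{H}v,\mathcal{H}w),\qquad \mathcal{D}(\widehat{\mathcal{E}})=\mathcal{D}_e(\mathcal{E})|_{\partial D}\cap L^2(\partial D,\sigma),$$ where $\mathcal{H}\phi$ is the solution $u\in H^1(D)$ of $\nabla\cdot(\kappa\nabla u)=0$ in $D$, $u|_{\partial D}=\phi$. Then $$\mathcal{D}(\widehat{\mathcal{E}})=H^{1/2}(\partial D)=\Big\{\phi\in L^2(\partial D,\sigma):\int_{\partial D}\int_{\partial D}\frac{|\phi(x)-\phi(y)|^2}{|x-y|^{d}}\,d\sigma(x)\,d\sigma(y)<\infty\Big\}.$$ -/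

import Mathlib

open MeasureTheory Filter Topology
open scoped ContDiff

noncomputable section

namespace TraceForm

/-- Euclidean space `ℝ^d`. -/
abbrev Eu (d : ℕ) : Type := EuclideanSpace ℝ (Fin d)

/-- A bounded domain (nonempty, open, connected) in `ℝ^d` with smooth boundary: near every boundary
point, after a rigid motion onto `ℝ^(d-1) × ℝ`, the set is the part above the graph of a `C^∞`
function. -/
structure IsSmoothBoundedDomain {d : ℕ} (D : Set (Eu d)) : Prop where
  isOpen : IsOpen D
  isConnected : IsConnected D
  isBounded : Bornology.IsBounded D
  smooth_boundary : ∀ x ∈ frontier D, ∃ r : ℝ, 0 < r ∧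
    ∃ (T : Eu d ≃ᵃⁱ[ℝ] WithLp 2 (Eu (d - 1) × ℝ)) (g : Eu (d - 1) → ℝ),
      ContDiff ℝ ∞ g ∧ ∀ y ∈ Metric.ball x r, (y ∈ D ↔ g (T y).fst < (T y).snd)

/-- A symmetric, bounded, uniformly elliptic conductivity with components in `L^∞(D)`. -/
structure IsConductivity {d : ℕ} (D : Set (Eu d)) (κ : Eu d → Matrix (Fin d) (Fin d) ℝ) :
    Prop where
  memLp_top : ∀ i j, MemLp (fun x => κ x i j) ⊤ (volume.restrict D)
  symm : ∀ᵐ x ∂(volume.restrict D), (κ x).IsSymm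
  elliptic : ∃ c : ℝ, 0 < c ∧ ∀ᵐ x ∂(volume.restrict D), ∀ ξ : Eu d,
    c⁻¹ * ‖ξ‖ ^ 2 ≤ ∑ i, ∑ j, ξ i * κ x i j * ξ j ∧
      ∑ i, ∑ j, ξ i * κ x i j * ξ j ≤ c * ‖ξ‖ ^ 2

/-- The test functions `C_c^∞(D)`. -/
structure IsTestFunction {d : ℕ} (D : Set (Eu d)) (φ : Eu d → ℝ) : Prop where
  smooth : ContDiff ℝ ∞ φ
  compact : HasCompactSupport φ
  supp : tsupport φ ⊆ D

/-- `G ∈ L²(D; ℝ^d)` is the distributional gradient of `u` in `D`. -/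
structure IsWeakGradient {d : ℕ} (D : Set (Eu d)) (u : Eu d → ℝ) (G : Eu d → Eu d) : Prop where
  memLp : MemLp G 2 (volume.restrict D)
  integral_eq : ∀ φ : Eu d → ℝ, IsTestFunction D φ → ∀ e : Eu d,
    ∫ x in D, u x * fderiv ℝ φ x e = - ∫ x in D, inner ℝ (G x) e * φ x

/-- The Sobolev space `H¹(D)`, as a set of functions (only their values a.e. on `D` matter). -/
def H1 {d : ℕ} (D : Set (Eu d)) : Set (Eu d → ℝ) :=
  {u | MemLp u 2 (volume.restrict D) ∧ ∃ G, IsWeakGradient D u G}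

open Classical in
/-- The distributional gradient in `D`, well defined a.e. on `D` for `u ∈ H¹(D)`. -/
def weakGrad {d : ℕ} (D : Set (Eu d)) (u : Eu d → ℝ) : Eu d → Eu d :=
  if h : ∃ G, IsWeakGradient D u G then h.choose else 0

/-- The form `ℰ(v, w) = ∫_D κ ∇v · ∇w dx`. -/
def energy {d : ℕ} (D : Set (Eu d)) (κ : Eu d → Matrix (Fin d) (Fin d) ℝ)
    (v w : Eu d → ℝ) : ℝ :=
  ∫ x in D, ∑ i, ∑ j, κ x i j * weakGrad D v x j * weakGrad D w x i

/-- The extended Dirichlet space `𝒟ₑ(ℰ)` of `(ℰ, H¹(D))`: the (a.e. finite) functions that are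
a.e. limits on `D` of `ℰ`-Cauchy sequences in `H¹(D)`. -/
def extendedDomain {d : ℕ} (D : Set (Eu d)) (κ : Eu d → Matrix (Fin d) (Fin d) ℝ) :
    Set (Eu d → ℝ) :=
  {u | ∃ v : ℕ → Eu d → ℝ, (∀ k, v k ∈ H1 D) ∧
    (∀ ε : ℝ, 0 < ε → ∃ N : ℕ, ∀ m ≥ N, ∀ n ≥ N, energy D κ (v m - v n) (v m - v n) < ε) ∧
    ∀ᵐ x ∂(volume.restrict D), Tendsto (fun k => v k x) atTop (𝓝 (u x))}

/-- The surface measure `σ` on `∂D`: the `(d-1)`-dimensional Hausdorff measure, normalized so as to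
agree with Lebesgue measure on `ℝ^(d-1)`. -/
def surfaceMeasure {d : ℕ} (D : Set (Eu d)) : Measure (Eu d) :=
  (Measure.euclideanHausdorffMeasure (d - 1)).restrict (frontier D)

/-- `L²(∂D)`. -/
abbrev L2Boundary {d : ℕ} (D : Set (Eu d)) : Type := Lp ℝ 2 (surfaceMeasure D)

/-- `φ = γ u` for the standard trace operator `γ` on `H¹(D)`, the continuous extension of
`w ↦ w|_{∂D}` from `C^∞(closure D)`. -/
def HasTrace {d : ℕ} (D : Set (Eu d)) (u : Eu d → ℝ) (φ : L2Boundary D) : Prop :=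
  u ∈ H1 D ∧ ∃ w : ℕ → Eu d → ℝ, (∀ k, ContDiff ℝ ∞ (w k)) ∧
    Tendsto (fun k => eLpNorm (w k - u) 2 (volume.restrict D)) atTop (𝓝 0) ∧
    Tendsto (fun k => eLpNorm (weakGrad D (w k - u)) 2 (volume.restrict D)) atTop (𝓝 0) ∧
    Tendsto (fun k => eLpNorm (fun x => w k x - φ x) 2 (surfaceMeasure D)) atTop (𝓝 0)

/-- `u` is the `κ`-harmonic function in `H¹(D)` with trace `φ`. -/
def IsHarmonicExtension {d : ℕ} (D : Set (Eu d)) (κ : Eu d → Matrix (Fin d) (Fin d) ℝ)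
    (φ : L2Boundary D) (u : Eu d → ℝ) : Prop :=
  HasTrace D u φ ∧ ∀ v, IsTestFunction D v → energy D κ u v = 0

open Classical in
/-- The harmonic extension operator `ℋ`, with value `0` where no extension exists. -/
def harmonicExtension {d : ℕ} (D : Set (Eu d)) (κ : Eu d → Matrix (Fin d) (Fin d) ℝ)
    (φ : L2Boundary D) : Eu d → ℝ :=
  if h : ∃ u, IsHarmonicExtension D κ φ u then h.choose else 0

/-- A bilinear form on a function space, given together with its domain. -/
structure FormWithDomain (X : Type) where
  domain : Set X
  form : X → X → ℝ

/-- The trace Dirichlet form on `L²(∂D)`: `ℰ̂(v, w) = ℰ(ℋ v, ℋ w)` with domain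
`𝒟ₑ(ℰ)|_{∂D} ∩ L²(∂D)`. -/
def traceDirichletForm {d : ℕ} (D : Set (Eu d)) (κ : Eu d → Matrix (Fin d) (Fin d) ℝ) :
    FormWithDomain (L2Boundary D) where
  domain := {φ | ∃ u ∈ extendedDomain D κ, HasTrace D u φ}
  form v w := energy D κ (harmonicExtension D κ v) (harmonicExtension D κ w)

/-- The Sobolev–Slobodeckij space `H^{1/2}(∂D)`: the `φ ∈ L²(∂D)` with
`∫∫ |φ(x) - φ(y)|² / |x - y|^d dσ(x) dσ(y) < ∞`. -/
def HHalfBoundary {d : ℕ} (D : Set (Eu d)) : Set (L2Boundary D) :=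
  {φ | ∫⁻ x, ∫⁻ y, ENNReal.ofReal ((φ x - φ y) ^ 2 / dist x y ^ d)
    ∂(surfaceMeasure D) ∂(surfaceMeasure D) < ⊤}

end TraceForm

end

/-!
For `𝒟ₑ(ℰ) = H¹(D)`, let `v k → u` a.e. with `v` an `ℰ`-Cauchy sequence. By ellipticity the
gradients converge in `L²`, so translating `v m - u` by `h` costs at most `δ m * ‖h‖` in `L²` with
`δ m → 0`. Near any point of the closure `D` can be translated into a ball inside `D`, where a.e.
convergence together with these translation bounds forces `L²` convergence. Compactness of the
closure gives `v k → u` in `L²(D)`, hence `u ∈ H¹(D)`.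

For `H^{1/2}(∂D) ⊆ 𝒟(ℰ̂)`, extend `φ` by its averages over `∂D` with the weights
`(|x - y|² + ε²)^{-d}`, which are smooth in `x`. Since every ball of radius `r ≤ 1` centred on `∂D`
has surface measure at least `c * r ^ (d - 1)`, the gradients of these extensions are dominated,
uniformly in `ε`, by an `L²` function whose norm is controlled by the Gagliardo seminorm. Letting
`ε → 0` gives an `H¹` function with trace `φ`.

Conversely, in coordinates in which `D` lies above the graph of `g`, join two boundary points over
`a` and `b` by rising to height `‖a - b‖`, moving across, and descending. The vertical pieces are
controlled by Hardy's inequality and the horizontal one by polar coordinates in `b - a`, so the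
local Gagliardo seminorm of a smooth `w` is bounded by the Dirichlet integral. Compactness of
`∂D × ∂D` reduces the remaining pairs to those at a positive distance, which need only the `L²`
norm on `∂D`, and Fatou's lemma passes from smooth functions to the trace of any `H¹` function.
-/

noncomputable section

namespace TraceForm

variable {d : ℕ} {D : Set (Eu d)}

section LpTwo

variable {α E : Type*} [MeasurableSpace α] {μ : Measure α} [NormedAddCommGroup E]

lemma sq_lintegral_mul_le {f g : α → ENNReal} (hf : AEMeasurable f μ) (hg : AEMeasurable g μ) :
    (∫⁻ x, f x * g x ∂μ) ^ 2 ≤ (∫⁻ x, f x ^ 2 ∂μ) * ∫⁻ x, g x ^ 2 ∂μ := by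
  have holder := ENNReal.lintegral_mul_le_Lp_mul_Lq μ Real.HolderConjugate.two_two hf hg
  simp only [Pi.mul_apply, ENNReal.rpow_two] at holder
  calc (∫⁻ x, f x * g x ∂μ) ^ 2
      ≤ ((∫⁻ x, f x ^ 2 ∂μ) ^ (1 / 2 : ℝ) * (∫⁻ x, g x ^ 2 ∂μ) ^ (1 / 2 : ℝ)) ^ 2 := by gcongr
    _ = (∫⁻ x, f x ^ 2 ∂μ) * ∫⁻ x, g x ^ 2 ∂μ := by
      rw [mul_pow, ← ENNReal.rpow_natCast, ← ENNReal.rpow_natCast, ← ENNReal.rpow_mul,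
        ← ENNReal.rpow_mul]
      norm_num

lemma sq_lintegral_le {f : α → ENNReal} (hf : AEMeasurable f μ) :
    (∫⁻ x, f x ∂μ) ^ 2 ≤ μ Set.univ * ∫⁻ x, f x ^ 2 ∂μ := by
  simpa using sq_lintegral_mul_le (μ := μ) (f := fun _ => 1) (g := f) aemeasurable_const hf

lemma eLpNorm_two_sq (f : α → E) : eLpNorm f 2 μ ^ 2 = ∫⁻ x, ‖f x‖ₑ ^ 2 ∂μ := by
  have h := eLpNorm_nnreal_pow_eq_lintegral (μ := μ) (f := f) (p := 2) two_ne_zero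
  rw [← ENNReal.rpow_natCast]
  simpa using h

lemma tendsto_eLpNorm_two_iff {ι : Type*} {l : Filter ι} {f : ι → α → E} :
    Tendsto (fun k => eLpNorm (f k) 2 μ) l (𝓝 0) ↔
      Tendsto (fun k => ∫⁻ x, ‖f k x‖ₑ ^ 2 ∂μ) l (𝓝 0) := by
  simp only [← eLpNorm_two_sq]
  constructor
  · intro h
    simpa [Function.comp_def] using ((ENNReal.continuous_pow 2).tendsto 0).comp h
  · intro h
    have hsqrt := ((ENNReal.continuous_rpow_const (y := (1 / 2 : ℝ))).tendsto 0).comp h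
    refine (hsqrt.congr fun k => ?_).trans (by simp)
    rw [Function.comp_apply, ← ENNReal.rpow_natCast, ← ENNReal.rpow_mul]
    norm_num

lemma tendsto_integral_mul_of_tendsto_eLpNorm_two {ι : Type*} {l : Filter ι} {f : ι → α → ℝ}
    {f₀ h : α → ℝ} (hf : ∀ k, MemLp (f k) 2 μ) (hf₀ : MemLp f₀ 2 μ) (hh : MemLp h 2 μ)
    (hlim : Tendsto (fun k => eLpNorm (f k - f₀) 2 μ) l (𝓝 0)) :
    Tendsto (fun k => ∫ x, f k x * h x ∂μ) l (𝓝 (∫ x, f₀ x * h x ∂μ)) := by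
  refine tendsto_integral_of_L1' (fun x => f₀ x * h x) (hf₀.integrable_mul hh).1
    (Eventually.of_forall fun k => (hf k).integrable_mul hh) ?_
  have hlim' : Tendsto (fun k => eLpNorm (f k - f₀) 2 μ * eLpNorm h 2 μ) l (𝓝 0) := by
    simpa using ENNReal.Tendsto.mul_const hlim (Or.inr hh.eLpNorm_ne_top)
  refine tendsto_of_tendsto_of_tendsto_of_le_of_le tendsto_const_nhds hlim'
    (fun _ => zero_le) fun k => ?_
  have holder := eLpNorm_smul_le_mul_eLpNorm (p := 2) (q := 2) (r := 1) (μ := μ) (f := h)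
    (φ := f k - f₀) hh.1 ((hf k).sub hf₀).1
  refine le_trans (le_of_eq ?_) holder
  congr 1
  ext x
  simp [sub_mul]

lemma memLp_restrict_of_continuous {X : Type*} [PseudoMetricSpace X] [ProperSpace X]
    [MeasurableSpace X] [BorelSpace X] {ν : Measure X} [IsFiniteMeasureOnCompacts ν]
    {p : ENNReal} {A : Set X} (hA : Bornology.IsBounded A) {f : X → E} (hf : Continuous f) :
    MemLp f p (ν.restrict A) := by
  obtain ⟨C, hC⟩ := hA.isCompact_closure.exists_bound_of_continuousOn hf.continuousOn
  have : IsFiniteMeasure (ν.restrict A) := ⟨by simpa using hA.measure_lt_top⟩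
  refine MemLp.of_bound hf.aestronglyMeasurable C ?_
  refine ae_restrict_of_ae_restrict_of_subset subset_closure ?_
  exact (ae_restrict_iff' isClosed_closure.measurableSet).2 (Eventually.of_forall hC)

end LpTwo

section WeakGradient

lemma IsTestFunction.memLp {φ : Eu d → ℝ} (h : IsTestFunction D φ) :
    MemLp φ 2 (volume.restrict D) :=
  h.smooth.continuous.memLp_of_hasCompactSupport h.compact

lemma IsTestFunction.memLp_fderiv {φ : Eu d → ℝ} (h : IsTestFunction D φ) (e : Eu d) :
    MemLp (fun x => fderiv ℝ φ x e) 2 (volume.restrict D) :=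
  ((h.smooth.continuous_fderiv (by simp)).clm_apply continuous_const).memLp_of_hasCompactSupport
    (h.compact.fderiv_apply (𝕜 := ℝ) e)

lemma IsTestFunction.eq_zero_of_notMem {φ : Eu d → ℝ} (h : IsTestFunction D φ) {x : Eu d}
    (hx : x ∉ D) : φ x = 0 :=
  image_eq_zero_of_notMem_tsupport fun hx' => hx (h.supp hx')

lemma IsTestFunction.fderiv_eq_zero_of_notMem {φ : Eu d → ℝ} (h : IsTestFunction D φ) {x : Eu d}
    (hx : x ∉ D) : fderiv ℝ φ x = 0 :=
  image_eq_zero_of_notMem_tsupport fun hx' => hx (h.supp (tsupport_fderiv_subset ℝ hx'))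

lemma IsTestFunction.setIntegral_mul_eq {φ : Eu d → ℝ} (hφ : IsTestFunction D φ) (f : Eu d → ℝ) :
    ∫ x in D, f x * φ x = ∫ x, f x * φ x :=
  setIntegral_eq_integral_of_forall_compl_eq_zero fun x hx => by simp [hφ.eq_zero_of_notMem hx]

lemma IsTestFunction.setIntegral_mul_fderiv_eq {φ : Eu d → ℝ} (hφ : IsTestFunction D φ)
    (f : Eu d → ℝ) (e : Eu d) : ∫ x in D, f x * fderiv ℝ φ x e = ∫ x, f x * fderiv ℝ φ x e :=
  setIntegral_eq_integral_of_forall_compl_eq_zero fun x hx => by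
    simp [hφ.fderiv_eq_zero_of_notMem hx]

lemma IsWeakGradient.integral_mul_fderiv {u : Eu d → ℝ} {G : Eu d → Eu d}
    (h : IsWeakGradient D u G) {φ : Eu d → ℝ} (hφ : IsTestFunction D φ) (e : Eu d) :
    ∫ x, u x * fderiv ℝ φ x e = - ∫ x, inner ℝ (G x) e * φ x := by
  rw [← hφ.setIntegral_mul_fderiv_eq, ← hφ.setIntegral_mul_eq, h.integral_eq φ hφ e]

lemma IsWeakGradient.congr {u v : Eu d → ℝ} {G H : Eu d → Eu d} (h : IsWeakGradient D u G)
    (huv : u =ᵐ[volume.restrict D] v) (hGH : G =ᵐ[volume.restrict D] H) :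
    IsWeakGradient D v H := by
  refine ⟨h.memLp.ae_eq hGH, fun φ hφ e => ?_⟩
  have hleft : ∫ x in D, v x * fderiv ℝ φ x e = ∫ x in D, u x * fderiv ℝ φ x e :=
    integral_congr_ae (huv.mono fun x hx => by simp only [hx])
  have hright : ∫ x in D, inner ℝ (H x) e * φ x = ∫ x in D, inner ℝ (G x) e * φ x :=
    integral_congr_ae (hGH.mono fun x hx => by simp only [hx])
  rw [hleft, hright, h.integral_eq φ hφ e]

lemma IsWeakGradient.integrable_inner_mul {u : Eu d → ℝ} {G : Eu d → Eu d}
    (h : IsWeakGradient D u G) {φ : Eu d → ℝ} (hφ : IsTestFunction D φ) (e : Eu d) :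
    Integrable (fun x => inner ℝ (G x) e * φ x) (volume.restrict D) :=
  (h.memLp.inner_const e).integrable_mul hφ.memLp

lemma isWeakGradient_weakGrad {u : Eu d → ℝ} (h : ∃ G, IsWeakGradient D u G) :
    IsWeakGradient D u (weakGrad D u) := by
  rw [weakGrad, dif_pos h]
  exact h.choose_spec

lemma IsWeakGradient.ae_eq (hD : IsOpen D) {u : Eu d → ℝ} {G G' : Eu d → Eu d}
    (h : IsWeakGradient D u G) (h' : IsWeakGradient D u G') :
    G =ᵐ[volume.restrict D] G' := by
  have hloc : LocallyIntegrable (G - G') (volume.restrict D) :=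
    (h.memLp.sub h'.memLp).locallyIntegrable (by norm_num)
  suffices orthogonal : ∀ φ : Eu d → ℝ, ContDiff ℝ ∞ φ → HasCompactSupport φ → tsupport φ ⊆ D →
      ∫ x, φ x • (G - G') x = 0 by
    have hzero := hD.ae_eq_zero_of_integral_contDiff_smul_eq_zero
      (locallyIntegrableOn_of_locallyIntegrable_restrict hloc) orthogonal
    filter_upwards [(ae_restrict_iff' hD.measurableSet).2 hzero] with x hx
    simpa [sub_eq_zero] using hx
  intro φ hφ hc hs
  have htest : IsTestFunction D φ := ⟨hφ, hc, hs⟩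
  rw [← setIntegral_eq_integral_of_forall_compl_eq_zero (s := D) fun x hx => by
    simp [htest.eq_zero_of_notMem hx]]
  have hintegrable : Integrable (fun x => φ x • (G - G') x) (volume.restrict D) :=
    hloc.integrable_smul_left_of_hasCompactSupport hφ.continuous hc
  refine ext_inner_left ℝ fun e => ?_
  rw [← integral_inner hintegrable, inner_zero_right]
  have hsplit : ∀ x, inner ℝ e (φ x • (G - G') x)
      = inner ℝ (G x) e * φ x - inner ℝ (G' x) e * φ x := by
    intro x
    rw [inner_smul_right, Pi.sub_apply, inner_sub_right, real_inner_comm, real_inner_comm e (G' x)]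
    ring
  simp_rw [hsplit]
  rw [integral_sub (h.integrable_inner_mul htest e) (h'.integrable_inner_mul htest e)]
  linarith [h.integral_eq φ htest e, h'.integral_eq φ htest e]

lemma IsWeakGradient.weakGrad_ae_eq (hD : IsOpen D) {u : Eu d → ℝ} {G : Eu d → Eu d}
    (h : IsWeakGradient D u G) : weakGrad D u =ᵐ[volume.restrict D] G :=
  (isWeakGradient_weakGrad ⟨G, h⟩).ae_eq hD h

lemma IsWeakGradient.sub {u v : Eu d → ℝ} {G G' : Eu d → Eu d}
    (hu : MemLp u 2 (volume.restrict D)) (hv : MemLp v 2 (volume.restrict D))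
    (h : IsWeakGradient D u G) (h' : IsWeakGradient D v G') :
    IsWeakGradient D (u - v) (G - G') := by
  refine ⟨h.memLp.sub h'.memLp, fun φ hφ e => ?_⟩
  have hintegrable {w : Eu d → ℝ} (hw : MemLp w 2 (volume.restrict D)) :
      Integrable (fun x => w x * fderiv ℝ φ x e) (volume.restrict D) :=
    hw.integrable_mul (hφ.memLp_fderiv e)
  simp only [Pi.sub_apply, sub_mul, inner_sub_left]
  rw [integral_sub (hintegrable hu) (hintegrable hv),
    integral_sub (h.integrable_inner_mul hφ e) (h'.integrable_inner_mul hφ e),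
    h.integral_eq φ hφ e, h'.integral_eq φ hφ e]
  ring

lemma weakGrad_zero_ae_eq (hD : IsOpen D) :
    weakGrad D (0 : Eu d → ℝ) =ᵐ[volume.restrict D] 0 :=
  IsWeakGradient.weakGrad_ae_eq hD ⟨MemLp.zero, fun φ _ e => by simp⟩

lemma sub_mem_H1 {u v : Eu d → ℝ} (hu : u ∈ H1 D) (hv : v ∈ H1 D) : u - v ∈ H1 D :=
  ⟨hu.1.sub hv.1, _, (isWeakGradient_weakGrad hu.2).sub hu.1 hv.1 (isWeakGradient_weakGrad hv.2)⟩

lemma weakGrad_sub_ae_eq (hD : IsOpen D) {u v : Eu d → ℝ} (hu : u ∈ H1 D) (hv : v ∈ H1 D) :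
    weakGrad D (u - v) =ᵐ[volume.restrict D] weakGrad D u - weakGrad D v :=
  ((isWeakGradient_weakGrad hu.2).sub hu.1 hv.1 (isWeakGradient_weakGrad hv.2)).weakGrad_ae_eq hD

lemma continuous_gradient {w : Eu d → ℝ} (hw : ContDiff ℝ 1 w) : Continuous (gradient w) :=
  (InnerProductSpace.toDual ℝ (Eu d)).symm.continuous.comp (hw.continuous_fderiv (by simp))

lemma isWeakGradient_gradient (hD : Bornology.IsBounded D) {w : Eu d → ℝ} (hw : ContDiff ℝ 1 w) :
    IsWeakGradient D w (gradient w) := by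
  refine ⟨memLp_restrict_of_continuous hD (continuous_gradient hw), fun φ hφ e => ?_⟩
  rw [hφ.setIntegral_mul_fderiv_eq, hφ.setIntegral_mul_eq]
  have hφ1 : ContDiff ℝ 1 φ := hφ.smooth.of_le (by simp)
  have hcd : HasCompactSupport fun x => fderiv ℝ φ x e := hφ.compact.fderiv_apply (𝕜 := ℝ) e
  have hφc : Continuous fun x => fderiv ℝ φ x e :=
    (hφ1.continuous_fderiv (by simp)).clm_apply continuous_const
  have hwc : Continuous fun x => fderiv ℝ w x e :=
    (hw.continuous_fderiv (by simp)).clm_apply continuous_const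
  rw [integral_mul_fderiv_eq_neg_fderiv_mul_of_integrable
    ((hwc.mul hφ.smooth.continuous).integrable_of_hasCompactSupport hφ.compact.mul_left)
    ((hw.continuous.mul hφc).integrable_of_hasCompactSupport hcd.mul_left)
    ((hw.continuous.mul hφ.smooth.continuous).integrable_of_hasCompactSupport
      hφ.compact.mul_left)
    (fun x _ => (hw.differentiable (by simp)).differentiableAt)
    (fun x _ => (hφ1.differentiable (by simp)).differentiableAt)]
  simp [gradient]

lemma mem_H1_of_contDiff (hD : Bornology.IsBounded D) {w : Eu d → ℝ} (hw : ContDiff ℝ 1 w) :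
    w ∈ H1 D :=
  ⟨memLp_restrict_of_continuous hD hw.continuous, _, isWeakGradient_gradient hD hw⟩

lemma isWeakGradient_of_tendsto {ι : Type*} {l : Filter ι} [l.NeBot] {u : Eu d → ℝ}
    {G : Eu d → Eu d} {v : ι → Eu d → ℝ} {H : ι → Eu d → Eu d}
    (hv : ∀ k, MemLp (v k) 2 (volume.restrict D)) (hH : ∀ k, IsWeakGradient D (v k) (H k))
    (hu : MemLp u 2 (volume.restrict D)) (hG : MemLp G 2 (volume.restrict D))
    (hvu : Tendsto (fun k => eLpNorm (v k - u) 2 (volume.restrict D)) l (𝓝 0))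
    (hHG : Tendsto (fun k => eLpNorm (H k - G) 2 (volume.restrict D)) l (𝓝 0)) :
    IsWeakGradient D u G := by
  refine ⟨hG, fun φ hφ e => ?_⟩
  have hinner : Tendsto (fun k => eLpNorm ((fun x => inner ℝ (H k x) e) - fun x => inner ℝ (G x) e)
      2 (volume.restrict D)) l (𝓝 0) := by
    have hlim : Tendsto (fun k => ENNReal.ofReal ‖e‖ * eLpNorm (H k - G) 2 (volume.restrict D))
        l (𝓝 0) := by
      simpa only [mul_zero] using
        ENNReal.Tendsto.const_mul (a := ENNReal.ofReal ‖e‖) hHG (Or.inr ENNReal.ofReal_ne_top)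
    refine tendsto_of_tendsto_of_tendsto_of_le_of_le tendsto_const_nhds hlim
      (fun _ => zero_le) fun k => ?_
    refine eLpNorm_le_mul_eLpNorm_of_ae_le_mul (Eventually.of_forall fun x => ?_) 2
    simp only [Pi.sub_apply, ← inner_sub_left]
    rw [mul_comm]
    exact norm_inner_le_norm _ _
  have hleft := tendsto_integral_mul_of_tendsto_eLpNorm_two hv hu (hφ.memLp_fderiv e) hvu
  have hright := tendsto_integral_mul_of_tendsto_eLpNorm_two
    (fun k => (hH k).memLp.inner_const e) (hG.inner_const e) hφ.memLp hinner
  simp_rw [fun k => (hH k).integral_eq φ hφ e] at hleft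
  exact tendsto_nhds_unique hleft hright.neg

end WeakGradient

section Elliptic

/-- A measurable, uniformly elliptic coefficient field, not necessarily symmetric. Only its
quadratic form is bounded from above: this is what makes the integrand of the energy integrable. -/
structure IsElliptic (D : Set (Eu d)) (κ : Eu d → Matrix (Fin d) (Fin d) ℝ) : Prop where
  aestronglyMeasurable : ∀ i j, AEStronglyMeasurable (fun x => κ x i j) (volume.restrict D)
  bounds : ∃ c : ℝ, 0 < c ∧ ∀ᵐ x ∂(volume.restrict D), ∀ ξ : Eu d,
    c⁻¹ * ‖ξ‖ ^ 2 ≤ ∑ i, ∑ j, ξ i * κ x i j * ξ j ∧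
      ∑ i, ∑ j, ξ i * κ x i j * ξ j ≤ c * ‖ξ‖ ^ 2

variable {κ : Eu d → Matrix (Fin d) (Fin d) ℝ}

lemma IsConductivity.isElliptic (hκ : IsConductivity D κ) : IsElliptic D κ :=
  ⟨fun i j => (hκ.memLp_top i j).1, hκ.elliptic⟩

lemma IsElliptic.integrable (hκ : IsElliptic D κ) {G : Eu d → Eu d}
    (hG : MemLp G 2 (volume.restrict D)) :
    Integrable (fun x => ∑ i, ∑ j, G x i * κ x i j * G x j) (volume.restrict D) := by
  obtain ⟨c, hc, hell⟩ := hκ.bounds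
  have hcoord : ∀ i, AEStronglyMeasurable (fun x => G x i) (volume.restrict D) :=
    fun i => (EuclideanSpace.proj (𝕜 := ℝ) i).continuous.comp_aestronglyMeasurable hG.1
  refine ((hG.integrable_norm_pow two_ne_zero).const_mul c).mono' ?_ ?_
  · exact Finset.aestronglyMeasurable_fun_sum _ fun i _ =>
      Finset.aestronglyMeasurable_fun_sum _ fun j _ =>
        ((hcoord i).mul (hκ.aestronglyMeasurable i j)).mul (hcoord j)
  · filter_upwards [hell] with x hx
    rw [Real.norm_of_nonneg (le_trans (by positivity) (hx _).1)]
    exact (hx _).2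

lemma energy_self_eq (v : Eu d → ℝ) : energy D κ v v =
    ∫ x in D, ∑ i, ∑ j, weakGrad D v x i * κ x i j * weakGrad D v x j := by
  simp only [energy, mul_comm (_ * weakGrad D v _ _) (weakGrad D v _ _), mul_assoc]

lemma IsElliptic.exists_lintegral_weakGrad_sq_le (hκ : IsElliptic D κ) :
    ∃ c : ℝ, 0 < c ∧ ∀ v ∈ H1 D,
      ∫⁻ x in D, ‖weakGrad D v x‖ₑ ^ 2 ≤ ENNReal.ofReal (c * energy D κ v v) := by
  obtain ⟨c, hc, hell⟩ := hκ.bounds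
  refine ⟨c, hc, fun v hv => ?_⟩
  have hG : MemLp (weakGrad D v) 2 (volume.restrict D) := (isWeakGradient_weakGrad hv.2).memLp
  have hsq : Integrable (fun x => ‖weakGrad D v x‖ ^ 2) (volume.restrict D) :=
    hG.integrable_norm_pow two_ne_zero
  have hle : ∫ x in D, ‖weakGrad D v x‖ ^ 2 ≤ c * energy D κ v v := by
    rw [energy_self_eq, ← integral_const_mul]
    refine integral_mono_ae hsq ((hκ.integrable hG).const_mul c) ?_
    filter_upwards [hell] with x hx
    exact (inv_mul_le_iff₀ hc).1 (hx _).1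
  calc ∫⁻ x in D, ‖weakGrad D v x‖ₑ ^ 2
      = ENNReal.ofReal (∫ x in D, ‖weakGrad D v x‖ ^ 2) := by
        rw [ofReal_integral_eq_lintegral_ofReal hsq (Eventually.of_forall fun x => by positivity)]
        exact lintegral_congr fun x => by rw [← ofReal_norm, ENNReal.ofReal_pow (norm_nonneg _)]
    _ ≤ ENNReal.ofReal (c * energy D κ v v) := ENNReal.ofReal_le_ofReal hle

end Elliptic

section TranslationIntegrals

variable {V E : Type*} [NormedAddCommGroup V] [NormedSpace ℝ V] [MeasurableSpace V] [BorelSpace V]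
  {μ : Measure V} [NormedAddCommGroup E]

lemma lintegral_lintegral_comp_add_smul [SecondCountableTopology V] [SFinite μ]
    [μ.IsAddRightInvariant] {f : V → ENNReal} (hf : Measurable f) (h : V) :
    ∫⁻ x, (∫⁻ s in Set.Ioc (0 : ℝ) 1, f (x + s • h)) ∂μ = ∫⁻ x, f x ∂μ := by
  have hm : Measurable fun p : V × ℝ => f (p.1 + p.2 • h) := hf.comp (by fun_prop)
  rw [lintegral_lintegral_swap hm.aemeasurable]
  simp [lintegral_add_right_eq_self]

lemma integrable_comp_add_smul [SecondCountableTopology V] [SFinite μ]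
    [μ.IsAddRightInvariant] {G : V → E}
    (hGm : StronglyMeasurable G) (hGi : Integrable G μ) (h : V) :
    Integrable (fun p : V × ℝ => G (p.1 + p.2 • h))
      (μ.prod (volume.restrict (Set.Ioc (0 : ℝ) 1))) := by
  have hm : StronglyMeasurable fun p : V × ℝ => G (p.1 + p.2 • h) :=
    hGm.comp_measurable (by fun_prop)
  refine ⟨hm.aestronglyMeasurable, ?_⟩
  rw [HasFiniteIntegral, lintegral_prod _ hm.enorm.aemeasurable,
    lintegral_lintegral_comp_add_smul (f := fun x => ‖G x‖ₑ) hGm.enorm]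
  exact hGi.2

lemma continuous_integral_mul_comp_sub_smul {v g : V → ℝ} (hv : Integrable v μ)
    (hg : Continuous g) {C : ℝ} (hC : ∀ x, ‖g x‖ ≤ C) (h : V) :
    Continuous fun s : ℝ => ∫ x, v x * g (x - s • h) ∂μ := by
  refine continuous_of_dominated (bound := fun x => ‖v x‖ * C) (fun s => ?_)
    (fun s => Eventually.of_forall fun x => ?_) (hv.norm.mul_const _)
    (Eventually.of_forall fun x => by fun_prop)
  · exact hv.1.mul (by fun_prop : Continuous fun x => g (x - s • h)).aestronglyMeasurable
  · rw [norm_mul]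
    gcongr
    exact hC _

lemma hasDerivAt_integral_mul_comp_sub_smul {v ψ : V → ℝ} (hv : Integrable v μ)
    (hψ : ContDiff ℝ 1 ψ) (hc : HasCompactSupport ψ) (h : V) (s : ℝ) :
    HasDerivAt (fun s : ℝ => ∫ x, v x * ψ (x - s • h) ∂μ)
      (∫ x, v x * -(fderiv ℝ ψ (x - s • h) h) ∂μ) s := by
  obtain ⟨C, hC⟩ := hψ.continuous.bounded_above_of_compact_support hc
  have hψ' : Continuous (fderiv ℝ ψ) := hψ.continuous_fderiv (by simp)
  obtain ⟨C', hC'⟩ := hψ'.bounded_above_of_compact_support (hc.fderiv (𝕜 := ℝ))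
  have hcont (s : ℝ) : Continuous fun x => ψ (x - s • h) := by fun_prop
  refine (hasDerivAt_integral_of_dominated_loc_of_deriv_le
    (F := fun (s : ℝ) x => v x * ψ (x - s • h))
    (F' := fun (s : ℝ) x => v x * -(fderiv ℝ ψ (x - s • h) h))
    (bound := fun x => ‖v x‖ * (C' * ‖h‖))
    univ_mem (Eventually.of_forall fun s => hv.1.mul (hcont s).aestronglyMeasurable)
    (hv.mul_bdd (hcont s).aestronglyMeasurable (Eventually.of_forall fun x => hC _))
    (hv.1.mul (by fun_prop : Continuous fun x => -(fderiv ℝ ψ (x - s • h) h)).aestronglyMeasurable)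
    (Eventually.of_forall fun x t _ => ?_) (hv.norm.mul_const _)
    (Eventually.of_forall fun x t _ => ?_)).2
  · rw [norm_mul, norm_neg]
    gcongr
    exact (ContinuousLinearMap.le_opNorm _ _).trans (by gcongr; exact hC' _)
  · have hline : HasDerivAt (fun t : ℝ => x - t • h) (-h) t := by
      simpa using ((hasDerivAt_id t).smul_const h).const_sub x
    have hψx := ((hψ.differentiable (by simp)).differentiableAt (x := x - t • h)).hasFDerivAt
    simpa using (hψx.comp_hasDerivAt t hline).const_mul (v x)

lemma integral_mul_comp_sub_sub_integral_mul {v ψ : V → ℝ} (hv : Integrable v μ)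
    (hψ : ContDiff ℝ 1 ψ) (hc : HasCompactSupport ψ) (h : V) :
    (∫ x, v x * ψ (x - h) ∂μ) - ∫ x, v x * ψ x ∂μ =
      ∫ s in Set.Ioc (0 : ℝ) 1, ∫ x, v x * -(fderiv ℝ ψ (x - s • h) h) ∂μ := by
  have hψ' : Continuous fun x => -(fderiv ℝ ψ x h) :=
    ((hψ.continuous_fderiv (by simp)).clm_apply continuous_const).neg
  obtain ⟨C, hC⟩ := hψ'.bounded_above_of_compact_support (hc.fderiv_apply (𝕜 := ℝ) h).neg
  have ftc := intervalIntegral.integral_eq_sub_of_hasDerivAt (a := (0 : ℝ)) (b := 1)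
    (fun s _ => hasDerivAt_integral_mul_comp_sub_smul hv hψ hc h s)
    ((continuous_integral_mul_comp_sub_smul hv hψ' hC h).intervalIntegrable _ _)
  rw [intervalIntegral.integral_of_le zero_le_one] at ftc
  simpa using ftc.symm

end TranslationIntegrals

section WeakTranslation

/-- The increments of `f` along the segments contained in `D` are controlled in quadratic mean:
`‖f (· + h) - f‖²_{L²(A)} ≤ C |h|²` whenever `A + [0, 1] h ⊆ D`. This is the part of `f ∈ H¹(D)`
that passes to almost everywhere limits. -/
def HasTranslationBound (D : Set (Eu d)) (f : Eu d → ℝ) (C : ENNReal) : Prop :=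
  ∀ (A : Set (Eu d)) (h : Eu d), IsOpen A →
    (∀ x ∈ A, ∀ s ∈ Set.Icc (0 : ℝ) 1, x + s • h ∈ D) →
    ∫⁻ x in A, ‖f (x + h) - f x‖ₑ ^ 2 ≤ ‖h‖ₑ ^ 2 * C

lemma IsTestFunction.comp_sub {A : Set (Eu d)} {ψ : Eu d → ℝ} (hψ : IsTestFunction A ψ)
    {a : Eu d} (ha : ∀ x ∈ A, x + a ∈ D) : IsTestFunction D fun x => ψ (x - a) := by
  refine ⟨hψ.smooth.comp (contDiff_id.sub contDiff_const),
    hψ.compact.comp_homeomorph (Homeomorph.subRight a), ?_⟩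
  change tsupport (ψ ∘ Homeomorph.subRight a) ⊆ D
  rw [tsupport_comp_eq_preimage ψ (Homeomorph.subRight a)]
  exact fun x hx => by simpa using ha _ (hψ.supp hx)

lemma IsWeakGradient.integral_mul_fderiv_comp_sub {v : Eu d → ℝ} {G : Eu d → Eu d}
    (hG : IsWeakGradient D v G) {A : Set (Eu d)} {ψ : Eu d → ℝ} (hψ : IsTestFunction A ψ)
    {a : Eu d} (ha : ∀ x ∈ A, x + a ∈ D) (e : Eu d) :
    ∫ x, v x * -(fderiv ℝ ψ (x - a) e) = ∫ x, ψ x * inner ℝ (G (x + a)) e := by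
  have hfderiv (x : Eu d) : fderiv ℝ (fun x => ψ (x - a)) x = fderiv ℝ ψ (x - a) := by
    simpa [sub_eq_add_neg] using fderiv_comp_add_right (f := ψ) (x := x) (-a)
  have hweak := hG.integral_mul_fderiv (hψ.comp_sub ha) e
  simp only [hfderiv] at hweak
  simp only [mul_neg, integral_neg, hweak, neg_neg]
  rw [← integral_add_right_eq_self _ a]
  simp [mul_comm]

lemma IsWeakGradient.integral_mul_translate_sub {v : Eu d → ℝ} {G : Eu d → Eu d}
    (hG : IsWeakGradient D v G) (hvi : Integrable v) (hGm : StronglyMeasurable G)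
    (hGi : Integrable G) {A : Set (Eu d)} {h : Eu d}
    (hAh : ∀ x ∈ A, ∀ s ∈ Set.Icc (0 : ℝ) 1, x + s • h ∈ D) {ψ : Eu d → ℝ}
    (hψ : IsTestFunction A ψ) :
    (∫ x, v x * ψ (x - h)) - ∫ x, v x * ψ x =
      ∫ x, ψ x * ∫ s in Set.Ioc (0 : ℝ) 1, inner ℝ (G (x + s • h)) h := by
  obtain ⟨C, hC⟩ := hψ.smooth.continuous.bounded_above_of_compact_support hψ.compact
  have hprod := ((integrable_comp_add_smul hGm hGi h).inner_const h).bdd_mul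
    (hψ.smooth.continuous.comp continuous_fst).aestronglyMeasurable
    (Eventually.of_forall fun p => hC p.1)
  rw [integral_mul_comp_sub_sub_integral_mul hvi (hψ.smooth.of_le (by simp)) hψ.compact,
    setIntegral_congr_fun measurableSet_Ioc fun s hs =>
      hG.integral_mul_fderiv_comp_sub hψ (fun x hx => hAh x hx s ⟨hs.1.le, hs.2⟩) h]
  simp_rw [← integral_const_mul]
  exact (integral_integral_swap hprod).symm

lemma IsWeakGradient.ae_translate_sub_eq {v : Eu d → ℝ} {G : Eu d → Eu d}
    (hG : IsWeakGradient D v G) (hvi : Integrable v) (hGm : StronglyMeasurable G)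
    (hGi : Integrable G) {A : Set (Eu d)} (hA : IsOpen A) {h : Eu d}
    (hAh : ∀ x ∈ A, ∀ s ∈ Set.Icc (0 : ℝ) 1, x + s • h ∈ D) :
    ∀ᵐ x ∂(volume.restrict A),
      v (x + h) - v x = ∫ s in Set.Ioc (0 : ℝ) 1, inner ℝ (G (x + s • h)) h := by
  have hincr : Integrable fun x => v (x + h) - v x := (hvi.comp_add_right h).sub hvi
  have hprod : Integrable (fun p : Eu d × ℝ => inner ℝ (G (p.1 + p.2 • h)) h)
      (volume.prod (volume.restrict (Set.Ioc (0 : ℝ) 1))) :=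
    (integrable_comp_add_smul hGm hGi h).inner_const h
  have hline : Integrable fun x => ∫ s in Set.Ioc (0 : ℝ) 1, inner ℝ (G (x + s • h)) h :=
    hprod.integral_prod_left
  suffices weak : ∀ ψ : Eu d → ℝ, ContDiff ℝ ∞ ψ → HasCompactSupport ψ → tsupport ψ ⊆ A →
      ∫ x, ψ x • (v (x + h) - v x - ∫ s in Set.Ioc (0 : ℝ) 1, inner ℝ (G (x + s • h)) h) = 0 by
    filter_upwards [(ae_restrict_iff' hA.measurableSet).2
      (hA.ae_eq_zero_of_integral_contDiff_smul_eq_zero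
        ((hincr.sub hline).locallyIntegrable.locallyIntegrableOn A) weak)] with x hx
    exact sub_eq_zero.1 hx
  intro ψ hψ hc hs
  obtain ⟨C, hC⟩ := hψ.continuous.bounded_above_of_compact_support hc
  have hintegrable {f : Eu d → ℝ} (hf : Integrable f) : Integrable fun x => ψ x * f x :=
    hf.bdd_mul hψ.continuous.aestronglyMeasurable (Eventually.of_forall hC)
  have hshift : ∫ x, v x * ψ (x - h) = ∫ x, ψ x * v (x + h) := by
    rw [← integral_add_right_eq_self _ h]
    simp [mul_comm]
  have hweak := hG.integral_mul_translate_sub hvi hGm hGi hAh ⟨hψ, hc, hs⟩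
  simp only [smul_eq_mul, mul_sub (ψ _) _ (∫ _ in _, _)]
  rw [integral_sub (hintegrable hincr) (hintegrable hline), ← hweak, hshift]
  simp only [mul_sub]
  rw [integral_sub (hintegrable (hvi.comp_add_right h)) (hintegrable hvi)]
  simp [mul_comm]

lemma enorm_integral_inner_sq_le {α F : Type*} [MeasurableSpace α] {μ : Measure α}
    [NormedAddCommGroup F] [InnerProductSpace ℝ F] {f : α → F} (hf : AEStronglyMeasurable f μ)
    (h : F) : ‖∫ s, inner ℝ (f s) h ∂μ‖ₑ ^ 2 ≤
      ‖h‖ₑ ^ 2 * (μ Set.univ * ∫⁻ s, ‖f s‖ₑ ^ 2 ∂μ) := by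
  have hle : ‖∫ s, inner ℝ (f s) h ∂μ‖ₑ ≤ ‖h‖ₑ * ∫⁻ s, ‖f s‖ₑ ∂μ := by
    refine (enorm_integral_le_lintegral_enorm _).trans ?_
    rw [← lintegral_const_mul' _ _ enorm_ne_top]
    refine lintegral_mono fun s => ?_
    rw [mul_comm, ← ofReal_norm, ← ofReal_norm, ← ofReal_norm, ← ENNReal.ofReal_mul (norm_nonneg _)]
    exact ENNReal.ofReal_le_ofReal (norm_inner_le_norm _ _)
  calc ‖∫ s, inner ℝ (f s) h ∂μ‖ₑ ^ 2 ≤ (‖h‖ₑ * ∫⁻ s, ‖f s‖ₑ ∂μ) ^ 2 := by gcongr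
    _ ≤ ‖h‖ₑ ^ 2 * (μ Set.univ * ∫⁻ s, ‖f s‖ₑ ^ 2 ∂μ) := by
      rw [mul_pow]
      gcongr
      exact sq_lintegral_le hf.enorm

lemma IsWeakGradient.lintegral_translate_sub_sq_le_of_integrable {v : Eu d → ℝ} {G : Eu d → Eu d}
    (hG : IsWeakGradient D v G) (hvi : Integrable v) (hGm : StronglyMeasurable G)
    (hGi : Integrable G) {A : Set (Eu d)} (hA : IsOpen A) {h : Eu d}
    (hAh : ∀ x ∈ A, ∀ s ∈ Set.Icc (0 : ℝ) 1, x + s • h ∈ D) :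
    ∫⁻ x in A, ‖v (x + h) - v x‖ₑ ^ 2 ≤ ‖h‖ₑ ^ 2 * ∫⁻ x, ‖G x‖ₑ ^ 2 := by
  have hmeas : StronglyMeasurable fun p : Eu d × ℝ => G (p.1 + p.2 • h) :=
    hGm.comp_measurable (by fun_prop)
  calc ∫⁻ x in A, ‖v (x + h) - v x‖ₑ ^ 2
      ≤ ∫⁻ x in A, ‖h‖ₑ ^ 2 * ∫⁻ s in Set.Ioc (0 : ℝ) 1, ‖G (x + s • h)‖ₑ ^ 2 := by
        refine lintegral_mono_ae ?_
        filter_upwards [hG.ae_translate_sub_eq hvi hGm hGi hA hAh] with x hx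
        rw [hx]
        refine (enorm_integral_inner_sq_le ?_ h).trans (by simp)
        exact (hmeas.comp_measurable measurable_prodMk_left).aestronglyMeasurable
    _ ≤ ∫⁻ x, ‖h‖ₑ ^ 2 * ∫⁻ s in Set.Ioc (0 : ℝ) 1, ‖G (x + s • h)‖ₑ ^ 2 :=
        lintegral_mono' Measure.restrict_le_self le_rfl
    _ = ‖h‖ₑ ^ 2 * ∫⁻ x, ‖G x‖ₑ ^ 2 := by
        rw [lintegral_const_mul' _ _ (by finiteness),
          lintegral_lintegral_comp_add_smul (f := fun x => ‖G x‖ₑ ^ 2) (hGm.enorm.pow_const 2)]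

lemma lintegral_le_of_ae_tendsto {α : Type*} [MeasurableSpace α] {μ : Measure α}
    {F : ℕ → α → ENNReal} {f : α → ENNReal} {C : ENNReal} (hF : ∀ n, AEMeasurable (F n) μ)
    (hlim : ∀ᵐ x ∂μ, Tendsto (fun n => F n x) atTop (𝓝 (f x)))
    (hC : ∀ᶠ n in atTop, ∫⁻ x, F n x ∂μ ≤ C) : ∫⁻ x, f x ∂μ ≤ C := by
  calc ∫⁻ x, f x ∂μ = ∫⁻ x, liminf (fun n => F n x) atTop ∂μ :=
        lintegral_congr_ae (hlim.mono fun x hx => hx.liminf_eq.symm)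
    _ ≤ liminf (fun n => ∫⁻ x, F n x ∂μ) atTop := lintegral_liminf_le' hF
    _ ≤ C := (liminf_le_liminf hC).trans (by simp)

lemma ae_restrict_comp_add {A : Set (Eu d)} (hA : MeasurableSet A) (hD : MeasurableSet D)
    {h : Eu d} (hAh : ∀ x ∈ A, x + h ∈ D) {P : Eu d → Prop}
    (hP : ∀ᵐ x ∂(volume.restrict D), P x) : ∀ᵐ x ∂(volume.restrict A), P (x + h) := by
  rw [ae_restrict_iff' hD] at hP
  rw [ae_restrict_iff' hA]
  filter_upwards [(measurePreserving_add_right volume h).quasiMeasurePreserving.ae hP]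
    with x hx hxA using hx (hAh x hxA)

-- `v` and `G` are replaced by measurable representatives extended by zero outside `D`.
lemma IsWeakGradient.hasTranslationBound (hD : IsOpen D) (hDf : volume D ≠ ⊤)
    {v : Eu d → ℝ} {G : Eu d → Eu d} (hv : MemLp v 2 (volume.restrict D))
    (hG : IsWeakGradient D v G) : HasTranslationBound D v (∫⁻ x in D, ‖G x‖ₑ ^ 2) := by
  intro A h hA hAh
  have : IsFiniteMeasure (volume.restrict D) := ⟨by simpa using hDf.lt_top⟩
  have hAD : A ⊆ D := fun x hx => by simpa using hAh x hx 0 (by simp)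
  set v' : Eu d → ℝ := D.indicator (hv.1.mk v)
  set G' : Eu d → Eu d := D.indicator (hG.memLp.1.mk G)
  have hvv' : v =ᵐ[volume.restrict D] v' :=
    hv.1.ae_eq_mk.trans (indicator_ae_eq_restrict hD.measurableSet).symm
  have hGG' : G =ᵐ[volume.restrict D] G' :=
    hG.memLp.1.ae_eq_mk.trans (indicator_ae_eq_restrict hD.measurableSet).symm
  have hv'i : Integrable v' := (integrable_indicator_iff hD.measurableSet).2
    ((hv.integrable one_le_two).congr hv.1.ae_eq_mk)
  have hG'i : Integrable G' := (integrable_indicator_iff hD.measurableSet).2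
    ((hG.memLp.integrable one_le_two).congr hG.memLp.1.ae_eq_mk)
  calc ∫⁻ x in A, ‖v (x + h) - v x‖ₑ ^ 2 = ∫⁻ x in A, ‖v' (x + h) - v' x‖ₑ ^ 2 := by
        refine lintegral_congr_ae ?_
        filter_upwards [ae_restrict_of_ae_restrict_of_subset hAD hvv',
          ae_restrict_comp_add hA.measurableSet hD.measurableSet
            (fun x hx => by simpa using hAh x hx 1 (by simp)) hvv'] with x hx hxh
        rw [hx, hxh]
    _ ≤ ‖h‖ₑ ^ 2 * ∫⁻ x, ‖G' x‖ₑ ^ 2 :=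
        (hG.congr hvv' hGG').lintegral_translate_sub_sq_le_of_integrable hv'i
          (hG.memLp.1.stronglyMeasurable_mk.indicator hD.measurableSet) hG'i hA hAh
    _ = ‖h‖ₑ ^ 2 * ∫⁻ x in D, ‖G' x‖ₑ ^ 2 := by
        rw [← setLIntegral_eq_of_support_subset fun x hx => ?_]
        by_contra hxD
        simp [G', hxD] at hx
    _ = ‖h‖ₑ ^ 2 * ∫⁻ x in D, ‖G x‖ₑ ^ 2 := by
        congr 1
        exact lintegral_congr_ae (hGG'.symm.mono fun x hx => by simp only [hx])

lemma HasTranslationBound.of_ae_tendsto (hD : MeasurableSet D) {F : ℕ → Eu d → ℝ} {f : Eu d → ℝ}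
    {C : ENNReal} (hF : ∀ n, AEStronglyMeasurable (F n) (volume.restrict D))
    (hlim : ∀ᵐ x ∂(volume.restrict D), Tendsto (fun n => F n x) atTop (𝓝 (f x)))
    (hC : ∀ᶠ n in atTop, HasTranslationBound D (F n) C) : HasTranslationBound D f C := by
  intro A h hA hAh
  have hAD : A ⊆ D := fun x hx => by simpa using hAh x hx 0 (by simp)
  have hAhD : ∀ x ∈ A, x + h ∈ D := fun x hx => by simpa using hAh x hx 1 (by simp)
  have hshift (n : ℕ) : AEStronglyMeasurable (fun x => F n (x + h)) (volume.restrict A) :=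
    ⟨fun x => (hF n).mk (F n) (x + h),
      (hF n).stronglyMeasurable_mk.comp_measurable (measurable_add_const h),
      ae_restrict_comp_add hA.measurableSet hD hAhD (hF n).ae_eq_mk⟩
  refine lintegral_le_of_ae_tendsto
    (fun n => ((hshift n).sub ((hF n).mono_set hAD)).enorm.pow_const 2) ?_
    (hC.mono fun n hn => hn A h hA hAh)
  filter_upwards [ae_restrict_of_ae_restrict_of_subset hAD hlim,
    ae_restrict_comp_add hA.measurableSet hD hAhD hlim] with x hx hxh
  exact ((ENNReal.continuous_pow 2).tendsto _).comp (hxh.sub hx).enorm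

end WeakTranslation

section AlmostEverywhereConvergence

variable {α E : Type*} [MeasurableSpace α] {μ : Measure α} [NormedAddCommGroup E]

lemma ennreal_add_sq_le (a b : ENNReal) : (a + b) ^ 2 ≤ 2 * (a ^ 2 + b ^ 2) := by
  have h := ENNReal.rpow_add_le_mul_rpow_add_rpow a b (p := 2) one_le_two
  norm_num at h
  exact h

lemma enorm_sq_le_enorm_sub_sq_add (a b : E) : ‖a‖ₑ ^ 2 ≤ 2 * (‖a - b‖ₑ ^ 2 + ‖b‖ₑ ^ 2) := by
  have h : ‖a‖ₑ ≤ ‖a - b‖ₑ + ‖b‖ₑ := by simpa using enorm_add_le (a - b) b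
  exact (pow_le_pow_left' h 2).trans (ennreal_add_sq_le _ _)

lemma lintegral_enorm_sq_le_lintegral_enorm_sub_sq_add (μ : Measure α) {f g : α → E}
    (hg : AEStronglyMeasurable g μ) :
    ∫⁻ x, ‖f x‖ₑ ^ 2 ∂μ ≤ 2 * (∫⁻ x, ‖f x - g x‖ₑ ^ 2 ∂μ + ∫⁻ x, ‖g x‖ₑ ^ 2 ∂μ) := by
  rw [← lintegral_add_right' _ (hg.enorm.pow_const 2), ← lintegral_const_mul' _ _ (by finiteness)]
  exact lintegral_mono fun x => enorm_sq_le_enorm_sub_sq_add _ _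

lemma tendsto_setLIntegral_sq_of_tendstoUniformlyOn [IsFiniteMeasure μ] {f : ℕ → α → E}
    {A : Set α} (hA : MeasurableSet A) (hf : TendstoUniformlyOn f 0 atTop A) :
    Tendsto (fun m => ∫⁻ x in A, ‖f m x‖ₑ ^ 2 ∂μ) atTop (𝓝 0) := by
  have hsq : Tendsto (fun r : ℝ => ENNReal.ofReal r ^ 2 * μ A) (𝓝[>] 0) (𝓝 0) := by
    have hcont : Continuous fun r : ℝ => ENNReal.ofReal r ^ 2 * μ A :=
      (ENNReal.continuous_mul_const (by finiteness)).comp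
        ((ENNReal.continuous_pow 2).comp ENNReal.continuous_ofReal)
    simpa using (hcont.tendsto 0).mono_left nhdsWithin_le_nhds
  refine ENNReal.tendsto_nhds_zero.2 fun ε hε => ?_
  obtain ⟨r, hr, hr0⟩ := ((hsq.eventually (ge_mem_nhds hε)).and self_mem_nhdsWithin).exists
  filter_upwards [Metric.tendstoUniformlyOn_iff.1 hf r hr0] with m hm
  refine le_trans ?_ hr
  rw [← setLIntegral_const]
  refine setLIntegral_mono' hA fun x hx => ?_
  gcongr
  rw [← ofReal_norm]
  exact ENNReal.ofReal_le_ofReal (by simpa using (hm x hx).le)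

lemma exists_tendsto_setLIntegral_sq_of_ae_tendsto [IsFiniteMeasure μ] [NeZero μ]
    {f : ℕ → α → E} (hf : ∀ m, StronglyMeasurable (f m))
    (hlim : ∀ᵐ x ∂μ, Tendsto (fun m => f m x) atTop (𝓝 0)) :
    ∃ A, MeasurableSet A ∧ μ A ≠ 0 ∧
      Tendsto (fun m => ∫⁻ x in A, ‖f m x‖ₑ ^ 2 ∂μ) atTop (𝓝 0) := by
  have hpos : 0 < μ.real Set.univ := measureReal_univ_pos
  obtain ⟨t, htm, htv, htu⟩ := tendstoUniformlyOn_of_ae_tendsto' hf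
    (stronglyMeasurable_zero (β := E)) hlim (half_pos hpos)
  refine ⟨tᶜ, htm.compl, fun hzero => ?_,
    tendsto_setLIntegral_sq_of_tendstoUniformlyOn htm.compl htu⟩
  have hfull : μ.real t = μ.real Set.univ := by
    rw [Measure.real, measure_congr (ae_eq_univ.2 hzero), Measure.real]
  have hhalf : μ.real t ≤ μ.real Set.univ / 2 := ENNReal.toReal_le_of_le_ofReal (by positivity) htv
  linarith

lemma measure_mul_lintegral_sq_le {f : α → E} (hf : StronglyMeasurable f)
    (A : Set α) :
    μ A * ∫⁻ x, ‖f x‖ₑ ^ 2 ∂μ ≤ 2 * ((∫⁻ y, ∫⁻ x, ‖f x - f y‖ₑ ^ 2 ∂μ ∂μ) +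
      μ Set.univ * ∫⁻ y in A, ‖f y‖ₑ ^ 2 ∂μ) := by
  have hm : Measurable fun y => ‖f y‖ₑ ^ 2 := hf.enorm.pow_const 2
  calc μ A * ∫⁻ x, ‖f x‖ₑ ^ 2 ∂μ
      = ∫⁻ y in A, ∫⁻ x, ‖f x‖ₑ ^ 2 ∂μ ∂μ := by rw [setLIntegral_const, mul_comm]
    _ ≤ ∫⁻ y in A, 2 * ((∫⁻ x, ‖f x - f y‖ₑ ^ 2 ∂μ) + μ Set.univ * ‖f y‖ₑ ^ 2) ∂μ := by
        refine lintegral_mono fun y => ?_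
        simpa [mul_comm] using lintegral_enorm_sq_le_lintegral_enorm_sub_sq_add μ (f := f)
          (g := fun _ => f y) aestronglyMeasurable_const
    _ = 2 * ((∫⁻ y in A, ∫⁻ x, ‖f x - f y‖ₑ ^ 2 ∂μ ∂μ) +
          μ Set.univ * ∫⁻ y in A, ‖f y‖ₑ ^ 2 ∂μ) := by
        rw [lintegral_const_mul' _ _ (by finiteness), lintegral_add_right _ (hm.const_mul _),
          lintegral_const_mul _ hm]
    _ ≤ _ := by
        gcongr
        exact Measure.restrict_le_self

-- Egorov's theorem gives the convergence on a set of positive measure, and the oscillation carries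
-- it to the whole space.
lemma tendsto_lintegral_sq_of_tendsto_oscillation [IsFiniteMeasure μ] {f : ℕ → α → E}
    (hf : ∀ m, StronglyMeasurable (f m))
    (hlim : ∀ᵐ x ∂μ, Tendsto (fun m => f m x) atTop (𝓝 0))
    (hosc : Tendsto (fun m => ∫⁻ y, ∫⁻ x, ‖f m x - f m y‖ₑ ^ 2 ∂μ ∂μ) atTop (𝓝 0)) :
    Tendsto (fun m => ∫⁻ x, ‖f m x‖ₑ ^ 2 ∂μ) atTop (𝓝 0) := by
  rcases eq_zero_or_neZero μ with rfl | _
  · simp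
  obtain ⟨A, -, hA, hAlim⟩ := exists_tendsto_setLIntegral_sq_of_ae_tendsto hf hlim
  have hbound : Tendsto (fun m => (μ A)⁻¹ * (2 * ((∫⁻ y, ∫⁻ x, ‖f m x - f m y‖ₑ ^ 2 ∂μ ∂μ) +
      μ Set.univ * ∫⁻ y in A, ‖f m y‖ₑ ^ 2 ∂μ))) atTop (𝓝 0) := by
    have hsum := hosc.add (ENNReal.Tendsto.const_mul hAlim
      (Or.inr (measure_ne_top μ Set.univ)))
    simpa using ENNReal.Tendsto.const_mul (ENNReal.Tendsto.const_mul hsum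
      (Or.inr ENNReal.ofNat_ne_top)) (Or.inr (ENNReal.inv_ne_top.2 hA))
  exact tendsto_nhds_bot_mono' hbound fun m =>
    (ENNReal.mul_le_iff_le_inv hA (measure_ne_top μ A)).1 (measure_mul_lintegral_sq_le (hf m) A)

end AlmostEverywhereConvergence

section LocalConvergence

lemma lintegral_ball_lintegral_ball_le {V E : Type*} [NormedAddCommGroup V] [MeasurableSpace V]
    [BorelSpace V] [SecondCountableTopology V] [NormedAddCommGroup E] {μ : Measure V} [SFinite μ]
    [μ.IsAddLeftInvariant] {f : V → E} (hf : StronglyMeasurable f) (x₀ : V) (s : ℝ) :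
    ∫⁻ y in Metric.ball x₀ s, ∫⁻ x in Metric.ball x₀ s, ‖f x - f y‖ₑ ^ 2 ∂μ ∂μ ≤
      ∫⁻ h in Metric.ball 0 (2 * s), ∫⁻ x in Metric.ball x₀ s, ‖f (x + h) - f x‖ₑ ^ 2 ∂μ ∂μ := by
  have hm : Measurable fun p : V × V => ‖f (p.1 + p.2) - f p.1‖ₑ ^ 2 :=
    (((hf.comp_measurable (measurable_fst.add measurable_snd)).sub
      (hf.comp_measurable measurable_fst)).enorm).pow_const 2
  refine le_trans ?_ (lintegral_lintegral_swap hm.aemeasurable).le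
  refine setLIntegral_mono' measurableSet_ball fun y hy => ?_
  rw [← lintegral_indicator measurableSet_ball, ← lintegral_indicator measurableSet_ball,
    ← lintegral_add_left_eq_self _ y]
  refine lintegral_mono fun h => ?_
  by_cases hh : y + h ∈ Metric.ball x₀ s
  · rw [Set.indicator_of_mem hh, Set.indicator_of_mem]
    have htriangle := dist_triangle_right (y + h) y x₀
    rw [dist_self_add_left] at htriangle
    rw [Metric.mem_ball] at hh hy
    rw [mem_ball_zero_iff]
    linarith
  · simp [Set.indicator_of_notMem hh]

lemma tendsto_setLIntegral_sq_mono {f : ℕ → Eu d → ℝ} {A B : Set (Eu d)} (hAB : A ⊆ B)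
    (hB : Tendsto (fun m => ∫⁻ x in B, ‖f m x‖ₑ ^ 2) atTop (𝓝 0)) :
    Tendsto (fun m => ∫⁻ x in A, ‖f m x‖ₑ ^ 2) atTop (𝓝 0) :=
  tendsto_nhds_bot_mono' hB fun _ => lintegral_mono_set hAB

variable {f : ℕ → Eu d → ℝ} {δ : ℕ → ENNReal}

lemma tendsto_setLIntegral_ball_sq (hf : ∀ m, StronglyMeasurable (f m))
    (hδ : Tendsto δ atTop (𝓝 0)) (hfδ : ∀ m, HasTranslationBound D (f m) (δ m))
    (hlim : ∀ᵐ x ∂(volume.restrict D), Tendsto (fun m => f m x) atTop (𝓝 0))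
    {x : Eu d} {s : ℝ} (hs : 0 < s) (hsub : Metric.ball x (3 * s) ⊆ D) :
    Tendsto (fun m => ∫⁻ y in Metric.ball x s, ‖f m y‖ₑ ^ 2) atTop (𝓝 0) := by
  have : IsFiniteMeasure (volume.restrict (Metric.ball x s)) := ⟨by simp [measure_ball_lt_top]⟩
  have hseg : ∀ h ∈ Metric.ball (0 : Eu d) (2 * s), ∀ y ∈ Metric.ball x s,
      ∀ θ ∈ Set.Icc (0 : ℝ) 1, y + θ • h ∈ D := by
    intro h hh y hy θ hθ
    have hnorm : ‖θ • h‖ ≤ ‖h‖ := by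
      rw [norm_smul, Real.norm_of_nonneg hθ.1]
      exact mul_le_of_le_one_left (norm_nonneg h) hθ.2
    have htriangle := dist_triangle (y + θ • h) y x
    rw [dist_self_add_left] at htriangle
    rw [Metric.mem_ball] at hy
    rw [mem_ball_zero_iff] at hh
    exact hsub (Metric.mem_ball.2 (by linarith))
  refine tendsto_lintegral_sq_of_tendsto_oscillation hf (ae_restrict_of_ae_restrict_of_subset
    ((Metric.ball_subset_ball (by linarith)).trans hsub) hlim) ?_
  have hbound : Tendsto (fun m => ENNReal.ofReal (2 * s) ^ 2 * δ m *
      volume (Metric.ball (0 : Eu d) (2 * s))) atTop (𝓝 0) := by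
    simpa using ENNReal.Tendsto.mul_const (ENNReal.Tendsto.const_mul hδ
      (Or.inr (by finiteness))) (Or.inr measure_ball_lt_top.ne)
  refine tendsto_nhds_bot_mono' hbound fun m =>
    (lintegral_ball_lintegral_ball_le (hf m) x s).trans ?_
  rw [← setLIntegral_const]
  refine setLIntegral_mono' measurableSet_ball fun h hh => ?_
  refine (hfδ m _ h Metric.isOpen_ball (hseg h hh)).trans ?_
  gcongr
  rw [← ofReal_norm]
  exact ENNReal.ofReal_le_ofReal (mem_ball_zero_iff.1 hh).le

lemma tendsto_setLIntegral_sq_of_comp_add (hf : ∀ m, StronglyMeasurable (f m))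
    (hδ : Tendsto δ atTop (𝓝 0)) (hfδ : ∀ m, HasTranslationBound D (f m) (δ m))
    {A B : Set (Eu d)} (hA : IsOpen A) (hB : MeasurableSet B) {h : Eu d}
    (hAh : ∀ x ∈ A, ∀ θ ∈ Set.Icc (0 : ℝ) 1, x + θ • h ∈ D) (hAB : ∀ x ∈ A, x + h ∈ B)
    (hlim : Tendsto (fun m => ∫⁻ x in B, ‖f m x‖ₑ ^ 2) atTop (𝓝 0)) :
    Tendsto (fun m => ∫⁻ x in A, ‖f m x‖ₑ ^ 2) atTop (𝓝 0) := by
  have hbound : Tendsto (fun m => 2 * (‖h‖ₑ ^ 2 * δ m + ∫⁻ x in B, ‖f m x‖ₑ ^ 2))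
      atTop (𝓝 0) := by
    have hδh := ENNReal.Tendsto.const_mul (a := ‖h‖ₑ ^ 2) hδ (Or.inr (by finiteness))
    simpa using ENNReal.Tendsto.const_mul (hδh.add hlim) (Or.inr ENNReal.ofNat_ne_top)
  refine tendsto_nhds_bot_mono' hbound fun m => ?_
  have hshift : AEStronglyMeasurable (fun x => f m (x + h)) (volume.restrict A) :=
    ((hf m).comp_measurable (measurable_add_const h)).aestronglyMeasurable
  refine (lintegral_enorm_sq_le_lintegral_enorm_sub_sq_add _ hshift).trans ?_
  refine mul_le_mul_right (add_le_add ?_ ?_) 2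
  · simpa only [← enorm_neg (f m (_ + h) - _), neg_sub] using hfδ m A h hA hAh
  · rw [← (measurePreserving_add_right volume h).setLIntegral_comp_preimage hB
      ((hf m).enorm.pow_const 2)]
    exact lintegral_mono_set hAB

end LocalConvergence

section Chart

/-- A bounded open set whose boundary is locally, after a rigid motion, the graph of a locally
Lipschitz function, the set lying above it. It need not be connected. -/
structure IsLipschitzBoundedDomain (D : Set (Eu d)) : Prop where
  isOpen : IsOpen D
  isBounded : Bornology.IsBounded D
  lipschitz_boundary : ∀ x ∈ frontier D, ∃ r : ℝ, 0 < r ∧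
    ∃ (T : Eu d ≃ᵃⁱ[ℝ] WithLp 2 (Eu (d - 1) × ℝ)) (g : Eu (d - 1) → ℝ),
      LocallyLipschitz g ∧ ∀ y ∈ Metric.ball x r, (y ∈ D ↔ g (T y).fst < (T y).snd)

lemma IsSmoothBoundedDomain.isLipschitzBoundedDomain (hD : IsSmoothBoundedDomain D) :
    IsLipschitzBoundedDomain D := by
  refine ⟨hD.isOpen, hD.isBounded, fun x hx => ?_⟩
  obtain ⟨r, hr, T, g, hg, hchart⟩ := hD.smooth_boundary x hx
  exact ⟨r, hr, T, g, (hg.of_le (by simp)).locallyLipschitz, hchart⟩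

/-- The unit vector that a rigid motion onto `ℝ^(d-1) × ℝ` sends to the vertical direction. -/
def up (T : Eu d ≃ᵃⁱ[ℝ] WithLp 2 (Eu (d - 1) × ℝ)) : Eu d :=
  T.linearIsometryEquiv.symm (WithLp.toLp 2 (0, 1))

variable (T : Eu d ≃ᵃⁱ[ℝ] WithLp 2 (Eu (d - 1) × ℝ))

lemma norm_up : ‖up T‖ = 1 := by
  rw [up, LinearIsometryEquiv.norm_map, WithLp.prod_norm_eq_of_L2]
  simp

lemma map_add_smul_up (y : Eu d) (t : ℝ) :
    T (y + t • up T) = T y + WithLp.toLp 2 (0, t) := by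
  rw [add_comm y, ← vadd_eq_add, T.map_vadd, map_smul, up, LinearIsometryEquiv.apply_symm_apply,
    vadd_eq_add, add_comm, ← WithLp.toLp_smul]
  simp

@[simp] lemma fst_map_add_smul_up (y : Eu d) (t : ℝ) : (T (y + t • up T)).fst = (T y).fst := by
  simp [map_add_smul_up]

@[simp] lemma snd_map_add_smul_up (y : Eu d) (t : ℝ) :
    (T (y + t • up T)).snd = (T y).snd + t := by
  simp [map_add_smul_up]

variable {T} {g : Eu (d - 1) → ℝ} {x : Eu d} {r : ℝ}

lemma mem_frontier_iff_graph (hD : IsOpen D) (hg : Continuous g)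
    (hchart : ∀ y ∈ Metric.ball x r, (y ∈ D ↔ g (T y).fst < (T y).snd)) {y : Eu d}
    (hy : y ∈ Metric.ball x r) : y ∈ frontier D ↔ (T y).snd = g (T y).fst := by
  have hcont : Continuous fun z => (T z).snd - g (T z).fst :=
    ((WithLp.prod_continuous_ofLp 2 _ _).snd.comp T.continuous).sub
      (hg.comp ((WithLp.prod_continuous_ofLp 2 _ _).fst.comp T.continuous))
  have hball : Metric.ball x r ∈ 𝓝 y := Metric.isOpen_ball.mem_nhds hy
  rw [hD.frontier_eq, Set.mem_sdiff, hchart y hy, not_lt]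
  refine ⟨fun ⟨hcl, hle⟩ => hle.antisymm ?_, fun heq => ⟨?_, heq.le⟩⟩
  · by_contra! hlt
    have hbelow : ∀ᶠ z in 𝓝 y, (T z).snd - g (T z).fst < 0 :=
      hcont.continuousAt.eventually_lt continuousAt_const (by linarith)
    obtain ⟨z, ⟨hz, hzball⟩, hzD⟩ := mem_closure_iff_nhds.1 hcl _ (inter_mem hbelow hball)
    have habove := (hchart z hzball).1 hzD
    simp only [Set.mem_ofPred_eq] at hz
    linarith
  · have hlim : Tendsto (fun t : ℝ => y + t • up T) (𝓝[>] 0) (𝓝 y) := by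
      have hline : Continuous fun t : ℝ => y + t • up T := by fun_prop
      simpa using (hline.tendsto 0).mono_left nhdsWithin_le_nhds
    refine mem_closure_of_tendsto hlim ?_
    filter_upwards [hlim.eventually hball, self_mem_nhdsWithin] with t htball ht
    rw [hchart _ htball, fst_map_add_smul_up, snd_map_add_smul_up, heq]
    exact lt_add_of_pos_right _ ht

lemma add_smul_up_mem_ball {y : Eu d} (hy : y ∈ Metric.ball x (r / 2)) {t : ℝ}
    (ht : t ∈ Set.Icc 0 (r / 2)) : y + t • up T ∈ Metric.ball x r := by
  have htriangle := dist_triangle (y + t • up T) y x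
  rw [dist_self_add_left, norm_smul, norm_up, Real.norm_of_nonneg ht.1] at htriangle
  rw [Metric.mem_ball] at hy ⊢
  linarith [ht.2]

end Chart

section InwardTranslation

lemma IsLipschitzBoundedDomain.exists_inward (hD : IsLipschitzBoundedDomain D) {x : Eu d}
    (hx : x ∈ frontier D) : ∃ s : ℝ, 0 < s ∧ ∃ h : Eu d, Metric.ball (x + h) (3 * s) ⊆ D ∧
      ∀ y ∈ Metric.ball x s ∩ D, ∀ θ ∈ Set.Icc (0 : ℝ) 1, y + θ • h ∈ D := by
  obtain ⟨r, hr, T, g, hg, hchart⟩ := hD.lipschitz_boundary x hx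
  have hgx := (mem_frontier_iff_graph hD.isOpen hg.continuous hchart
    (Metric.mem_ball_self hr)).1 hx
  have hxh : x + (r / 2) • up T ∈ D := by
    rw [hchart _ (add_smul_up_mem_ball (Metric.mem_ball_self (half_pos hr))
      ⟨(half_pos hr).le, le_rfl⟩), fst_map_add_smul_up, snd_map_add_smul_up]
    linarith
  obtain ⟨ρ, hρ, hρD⟩ := Metric.isOpen_iff.1 hD.isOpen _ hxh
  refine ⟨min (ρ / 3) (r / 2), by positivity, (r / 2) • up T,
    (Metric.ball_subset_ball ?_).trans hρD, ?_⟩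
  · linarith [min_le_left (ρ / 3) (r / 2)]
  · rintro y ⟨hy, hyD⟩ θ hθ
    have hy' : y ∈ Metric.ball x (r / 2) := Metric.ball_subset_ball (min_le_right _ _) hy
    have hθr : 0 ≤ θ * (r / 2) := mul_nonneg hθ.1 (half_pos hr).le
    rw [smul_smul, hchart _ (add_smul_up_mem_ball hy'
      ⟨hθr, mul_le_of_le_one_left (half_pos hr).le hθ.2⟩), fst_map_add_smul_up,
      snd_map_add_smul_up]
    linarith [(hchart y (Metric.ball_subset_ball (by linarith) hy')).1 hyD]

lemma IsLipschitzBoundedDomain.tendsto_setLIntegral_sq (hD : IsLipschitzBoundedDomain D)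
    {f : ℕ → Eu d → ℝ} {δ : ℕ → ENNReal} (hf : ∀ m, StronglyMeasurable (f m))
    (hδ : Tendsto δ atTop (𝓝 0)) (hfδ : ∀ m, HasTranslationBound D (f m) (δ m))
    (hlim : ∀ᵐ x ∂(volume.restrict D), Tendsto (fun m => f m x) atTop (𝓝 0)) :
    Tendsto (fun m => ∫⁻ x in D, ‖f m x‖ₑ ^ 2) atTop (𝓝 0) := by
  have hlocal := hD.isBounded.isCompact_closure.induction_on
    (p := fun S => Tendsto (fun m => ∫⁻ x in S ∩ D, ‖f m x‖ₑ ^ 2) atTop (𝓝 0)) (by simp)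
    (fun S S' hS => tendsto_setLIntegral_sq_mono (Set.inter_subset_inter_left _ hS))
    (fun S S' h h' => ?_) (fun x hx => ?_)
  · rwa [Set.inter_eq_right.2 subset_closure] at hlocal
  · simp only [Set.union_inter_distrib_right]
    exact tendsto_nhds_bot_mono' (by simpa using h.add h') fun m => lintegral_union_le _ _ _
  by_cases hxD : x ∈ D
  · obtain ⟨ρ, hρ, hρD⟩ := Metric.isOpen_iff.1 hD.isOpen _ hxD
    refine ⟨_, mem_nhdsWithin_of_mem_nhds (Metric.ball_mem_nhds x (show 0 < ρ / 3 by positivity)),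
      tendsto_setLIntegral_sq_mono Set.inter_subset_left ?_⟩
    exact tendsto_setLIntegral_ball_sq hf hδ hfδ hlim (by positivity)
      (by rwa [mul_div_cancel₀ _ three_ne_zero])
  · obtain ⟨s, hs, h, hsub, hseg⟩ := hD.exists_inward (x := x)
      (by rw [hD.isOpen.frontier_eq]; exact ⟨hx, hxD⟩)
    refine ⟨_, mem_nhdsWithin_of_mem_nhds (Metric.ball_mem_nhds x hs), ?_⟩
    exact tendsto_setLIntegral_sq_of_comp_add hf hδ hfδ (Metric.isOpen_ball.inter hD.isOpen)
      (measurableSet_ball (x := x + h) (ε := s)) hseg (fun y hy => by simpa using hy.1)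
      (tendsto_setLIntegral_ball_sq hf hδ hfδ hlim hs hsub)

end InwardTranslation

section ExtendedDomain

lemma energy_self_zero (hD : IsOpen D) (κ : Eu d → Matrix (Fin d) (Fin d) ℝ) :
    energy D κ 0 0 = 0 := by
  rw [energy, integral_eq_zero_of_ae]
  filter_upwards [weakGrad_zero_ae_eq hD] with x hx
  simp [hx]

lemma H1_subset_extendedDomain (hD : IsOpen D) (κ : Eu d → Matrix (Fin d) (Fin d) ℝ) :
    H1 D ⊆ extendedDomain D κ := by
  intro u hu
  refine ⟨fun _ => u, fun _ => hu, fun ε hε => ⟨0, fun m _ n _ => ?_⟩,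
    Eventually.of_forall fun x => tendsto_const_nhds⟩
  rwa [sub_self, energy_self_zero hD]

lemma exists_tendsto_eLpNorm_of_cauchy {α E : Type*} [MeasurableSpace α] {μ : Measure α}
    [NormedAddCommGroup E] [CompleteSpace E] {p : ENNReal} [Fact (1 ≤ p)] {f : ℕ → α → E}
    (hf : ∀ k, MemLp (f k) p μ)
    (hc : ∀ ε : ENNReal, 0 < ε → ∃ N, ∀ m ≥ N, ∀ n ≥ N, eLpNorm (f m - f n) p μ < ε) :
    ∃ g, MemLp g p μ ∧ Tendsto (fun k => eLpNorm (f k - g) p μ) atTop (𝓝 0) := by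
  have hcs : CauchySeq fun k => (hf k).toLp (f k) := by
    rw [EMetric.cauchySeq_iff]
    simpa only [Lp.edist_toLp_toLp] using hc
  obtain ⟨g, hg⟩ := cauchySeq_tendsto_of_complete hcs
  refine ⟨g, Lp.memLp g, (tendsto_iff_edist_tendsto_0.1 hg).congr fun k => ?_⟩
  rw [Lp.edist_def]
  exact eLpNorm_congr_ae ((hf k).coeFn_toLp.sub (ae_eq_refl _))

variable {v : ℕ → Eu d → ℝ} {u : Eu d → ℝ}

/-- The sequence is Cauchy in the Dirichlet seminorm `w ↦ ‖∇w‖_{L²(D)}`. -/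
def IsGradientCauchy (D : Set (Eu d)) (v : ℕ → Eu d → ℝ) : Prop :=
  ∀ ε : ENNReal, 0 < ε → ∃ N, ∀ m ≥ N, ∀ n ≥ N,
    ∫⁻ x in D, ‖weakGrad D (v m - v n) x‖ₑ ^ 2 ≤ ε

lemma IsGradientCauchy.exists_tendsto_weakGrad (hcau : IsGradientCauchy D v) (hD : IsOpen D)
    (hv : ∀ k, v k ∈ H1 D) :
    ∃ G, MemLp G 2 (volume.restrict D) ∧
      Tendsto (fun k => eLpNorm (weakGrad D (v k) - G) 2 (volume.restrict D)) atTop (𝓝 0) := by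
  refine exists_tendsto_eLpNorm_of_cauchy
    (fun k => (isWeakGradient_weakGrad (hv k).2).memLp) fun ε hε => ?_
  obtain ⟨η, hη, hηε⟩ := ENNReal.lt_iff_exists_nnreal_btwn.1 hε
  obtain ⟨N, hN⟩ := hcau ((η : ENNReal) ^ 2) (by positivity)
  refine ⟨N, fun m hm n hn => lt_of_le_of_lt ?_ hηε⟩
  have hsq := hN m hm n hn
  rw [← eLpNorm_two_sq, eLpNorm_congr_ae (weakGrad_sub_ae_eq hD (hv m) (hv n))] at hsq
  exact (ENNReal.pow_le_pow_left_iff two_ne_zero).1 hsq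

-- The difference quotients of `v m - u` are limits of those of `v m - v n`, hence controlled by the
-- tail oscillation of the gradients even before `u` is known to be in `L²`.
lemma IsGradientCauchy.exists_hasTranslationBound (hcau : IsGradientCauchy D v) (hD : IsOpen D)
    (hDf : volume D ≠ ⊤) (hv : ∀ k, v k ∈ H1 D)
    (hlim : ∀ᵐ x ∂(volume.restrict D), Tendsto (fun k => v k x) atTop (𝓝 (u x))) :
    ∃ δ : ℕ → ENNReal, Tendsto δ atTop (𝓝 0) ∧ ∀ (m : ℕ) (f : Eu d → ℝ),
      f =ᵐ[volume.restrict D] v m - u → HasTranslationBound D f (δ m) := by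
  refine ⟨fun m => ⨆ n ≥ m, ∫⁻ x in D, ‖weakGrad D (v m - v n) x‖ₑ ^ 2, ?_, fun m f hf => ?_⟩
  · rw [ENNReal.tendsto_nhds_zero]
    intro ε hε
    obtain ⟨N, hN⟩ := hcau ε hε
    filter_upwards [eventually_ge_atTop N] with m hm
    exact iSup₂_le fun n hn => hN m hm n (hm.trans hn)
  · refine HasTranslationBound.of_ae_tendsto (F := fun n => v m - v n) hD.measurableSet
      (fun n => (hv m).1.1.sub (hv n).1.1) ?_ ?_
    · filter_upwards [hlim, hf] with x hx hfx
      rw [hfx]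
      exact hx.const_sub _
    · filter_upwards [eventually_ge_atTop m] with n hn A h hA hseg
      have hsub := sub_mem_H1 (hv m) (hv n)
      refine ((isWeakGradient_weakGrad hsub.2).hasTranslationBound hD hDf hsub.1 A h hA
        hseg).trans ?_
      gcongr
      exact le_iSup₂ (f := fun n _ => ∫⁻ x in D, ‖weakGrad D (v m - v n) x‖ₑ ^ 2) n hn

lemma IsLipschitzBoundedDomain.tendsto_eLpNorm_sub (hD : IsLipschitzBoundedDomain D)
    (hv : ∀ k, v k ∈ H1 D) (hcau : IsGradientCauchy D v)
    (hlim : ∀ᵐ x ∂(volume.restrict D), Tendsto (fun k => v k x) atTop (𝓝 (u x))) :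
    Tendsto (fun k => eLpNorm (v k - u) 2 (volume.restrict D)) atTop (𝓝 0) := by
  have hdiff : ∀ m, AEStronglyMeasurable (v m - u) (volume.restrict D) := fun m =>
    (hv m).1.1.sub (aestronglyMeasurable_of_tendsto_ae atTop (fun k => (hv k).1.1) hlim)
  have hmk : ∀ m, (hdiff m).mk (v m - u) =ᵐ[volume.restrict D] v m - u :=
    fun m => (hdiff m).ae_eq_mk.symm
  obtain ⟨δ, hδ, hbound⟩ :=
    hcau.exists_hasTranslationBound hD.isOpen hD.isBounded.measure_lt_top.ne hv hlim
  rw [tendsto_eLpNorm_two_iff]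
  refine (hD.tendsto_setLIntegral_sq (fun m => (hdiff m).stronglyMeasurable_mk) hδ
    (fun m => hbound m _ (hmk m)) ?_).congr fun m => lintegral_congr_ae ?_
  · filter_upwards [hlim, ae_all_iff.2 hmk] with x hx hmkx
    simp only [hmkx, Pi.sub_apply]
    simpa using hx.sub_const (u x)
  · filter_upwards [hmk m] with x hx
    rw [hx]

lemma IsLipschitzBoundedDomain.tendsto_H1_of_ae_tendsto (hD : IsLipschitzBoundedDomain D)
    (hv : ∀ k, v k ∈ H1 D) (hcau : IsGradientCauchy D v)
    (hlim : ∀ᵐ x ∂(volume.restrict D), Tendsto (fun k => v k x) atTop (𝓝 (u x))) :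
    u ∈ H1 D ∧ Tendsto (fun k => eLpNorm (v k - u) 2 (volume.restrict D)) atTop (𝓝 0) ∧
      Tendsto (fun k => eLpNorm (weakGrad D (v k - u)) 2 (volume.restrict D)) atTop (𝓝 0) := by
  have hconv := hD.tendsto_eLpNorm_sub hv hcau hlim
  have humeas := aestronglyMeasurable_of_tendsto_ae atTop (fun k => (hv k).1.1) hlim
  have hu : MemLp u 2 (volume.restrict D) := by
    obtain ⟨m, hm⟩ := (hconv.eventually (gt_mem_nhds ENNReal.zero_lt_top)).exists
    have hdiff : MemLp (v m - u) 2 (volume.restrict D) := ⟨(hv m).1.1.sub humeas, hm⟩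
    simpa using (hv m).1.sub hdiff
  obtain ⟨G, hG, hGlim⟩ := hcau.exists_tendsto_weakGrad hD.isOpen hv
  have hGu : IsWeakGradient D u G := isWeakGradient_of_tendsto (fun k => (hv k).1)
    (fun k => isWeakGradient_weakGrad (hv k).2) hu hG hconv hGlim
  have huH : u ∈ H1 D := ⟨hu, G, hGu⟩
  refine ⟨huH, hconv, hGlim.congr fun k => eLpNorm_congr_ae ?_⟩
  filter_upwards [weakGrad_sub_ae_eq hD.isOpen (hv k) huH, hGu.weakGrad_ae_eq hD.isOpen]
    with x hsub hux
  simp [hsub, hux]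

variable {κ : Eu d → Matrix (Fin d) (Fin d) ℝ}

lemma IsElliptic.isGradientCauchy (hκ : IsElliptic D κ) (hv : ∀ k, v k ∈ H1 D)
    (hcau : ∀ ε : ℝ, 0 < ε → ∃ N : ℕ, ∀ m ≥ N, ∀ n ≥ N,
      energy D κ (v m - v n) (v m - v n) < ε) :
    IsGradientCauchy D v := by
  intro ε hε
  obtain ⟨c, hc, hce⟩ := hκ.exists_lintegral_weakGrad_sq_le
  obtain ⟨η, hη, hηε⟩ := ENNReal.lt_iff_exists_nnreal_btwn.1 hε
  have hη0 : (0 : ℝ) < η := by exact_mod_cast hη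
  obtain ⟨N, hN⟩ := hcau (η / c) (by positivity)
  refine ⟨N, fun m hm n hn => ((hce _ (sub_mem_H1 (hv m) (hv n))).trans ?_).trans hηε.le⟩
  rw [ENNReal.ofReal_le_iff_le_toReal ENNReal.coe_ne_top, ENNReal.coe_toReal]
  exact (le_div_iff₀' hc).1 (hN m hm n hn).le

lemma IsLipschitzBoundedDomain.extendedDomain_eq_H1 (hD : IsLipschitzBoundedDomain D)
    (hκ : IsElliptic D κ) : extendedDomain D κ = H1 D := by
  refine Set.Subset.antisymm ?_ (H1_subset_extendedDomain hD.isOpen κ)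
  rintro u ⟨v, hv, hcau, hlim⟩
  exact (hD.tendsto_H1_of_ae_tendsto hv (hκ.isGradientCauchy hv hcau) hlim).1

end ExtendedDomain

section GraphPoint

lemma euclideanHausdorffMeasure_image_le {X Y : Type*} [MetricSpace X] [MeasurableSpace X]
    [BorelSpace X] [MetricSpace Y] [MeasurableSpace Y] [BorelSpace Y] {K : NNReal} {f : X → Y}
    {s : Set X} (hf : LipschitzOnWith K f s) (n : ℕ) :
    Measure.euclideanHausdorffMeasure n (f '' s) ≤
      (K : ENNReal) ^ n * Measure.euclideanHausdorffMeasure n s := by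
  have himage := hf.hausdorffMeasure_image_le (d := n) (Nat.cast_nonneg n)
  rw [ENNReal.rpow_natCast] at himage
  simp only [Measure.euclideanHausdorffMeasure_def, Measure.smul_apply, ENNReal.smul_def,
    smul_eq_mul]
  rw [mul_left_comm]
  gcongr

lemma dist_le_dist_fst_add_dist_snd {E F : Type*} [SeminormedAddCommGroup E]
    [SeminormedAddCommGroup F] (p q : WithLp 2 (E × F)) :
    dist p q ≤ dist p.fst q.fst + dist p.snd q.snd := by
  rw [WithLp.prod_dist_eq_of_L2]
  exact Real.sqrt_le_iff.2 ⟨by positivity, by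
    nlinarith [mul_nonneg (dist_nonneg (x := p.fst) (y := q.fst))
      (dist_nonneg (x := p.snd) (y := q.snd))]⟩

lemma dist_fst_le {E F : Type*} [SeminormedAddCommGroup E] [SeminormedAddCommGroup F]
    (p q : WithLp 2 (E × F)) : dist p.fst q.fst ≤ dist p q := by
  rw [WithLp.prod_dist_eq_of_L2]
  exact Real.le_sqrt_of_sq_le (by nlinarith [sq_nonneg (dist p.snd q.snd)])

/-- The point of `ℝ^d` at height `t` above the point over `a` of the graph of `g`, in the
coordinates given by `T`. -/
def graphPoint (T : Eu d ≃ᵃⁱ[ℝ] WithLp 2 (Eu (d - 1) × ℝ)) (g : Eu (d - 1) → ℝ)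
    (a : Eu (d - 1)) (t : ℝ) : Eu d :=
  T.symm (WithLp.toLp 2 (a, g a + t))

variable {T : Eu d ≃ᵃⁱ[ℝ] WithLp 2 (Eu (d - 1) × ℝ)} {g : Eu (d - 1) → ℝ}

@[simp] lemma fst_map_graphPoint (a : Eu (d - 1)) (t : ℝ) :
    (T (graphPoint T g a t)).fst = a := by simp [graphPoint]

@[simp] lemma snd_map_graphPoint (a : Eu (d - 1)) (t : ℝ) :
    (T (graphPoint T g a t)).snd = g a + t := by simp [graphPoint]

lemma graphPoint_fst_map {y : Eu d} (hy : (T y).snd = g (T y).fst) :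
    graphPoint T g (T y).fst 0 = y := by
  rw [graphPoint, add_zero, ← hy]
  exact T.symm_apply_apply y

lemma dist_graphPoint_le (a b : Eu (d - 1)) (s t : ℝ) :
    dist (graphPoint T g a s) (graphPoint T g b t) ≤ dist a b + dist (g a + s) (g b + t) := by
  rw [graphPoint, graphPoint, T.symm.dist_map]
  exact dist_le_dist_fst_add_dist_snd _ _

lemma dist_le_dist_graphPoint (a b : Eu (d - 1)) (s t : ℝ) :
    dist a b ≤ dist (graphPoint T g a s) (graphPoint T g b t) := by
  rw [graphPoint, graphPoint, T.symm.dist_map]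
  exact dist_fst_le (WithLp.toLp 2 (a, g a + s)) (WithLp.toLp 2 (b, g b + t))

lemma continuous_graphPoint (hg : Continuous g) :
    Continuous fun p : Eu (d - 1) × ℝ => graphPoint T g p.1 p.2 :=
  T.symm.continuous.comp ((WithLp.prod_continuous_toLp 2 _ _).comp (by fun_prop))

lemma continuous_graphPoint_left (hg : Continuous g) (t : ℝ) :
    Continuous fun a => graphPoint T g a t :=
  (continuous_graphPoint hg).comp (continuous_id.prodMk continuous_const)

lemma lipschitzOnWith_graphPoint {L : NNReal} {B : Set (Eu (d - 1))} (hL : LipschitzOnWith L g B)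
    (t : ℝ) : LipschitzOnWith (1 + L) (fun a => graphPoint T g a t) B := by
  refine LipschitzOnWith.of_dist_le_mul fun a ha b hb => (dist_graphPoint_le a b t t).trans ?_
  rw [dist_add_right]
  push_cast
  linarith [hL.dist_le_mul a ha b hb]

lemma fst_map_mem_ball {x y : Eu d} {ρ : ℝ} (hy : y ∈ Metric.ball x ρ) :
    (T y).fst ∈ Metric.ball (T x).fst ρ := by
  rw [Metric.mem_ball] at hy ⊢
  exact (dist_fst_le _ _).trans_lt (by rwa [T.dist_map])

lemma graphPoint_mem_ball {x : Eu d} (hx : (T x).snd = g (T x).fst) {R : ℝ} {L : NNReal}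
    (hL : LipschitzOnWith L g (Metric.ball (T x).fst R)) {a : Eu (d - 1)}
    (ha : a ∈ Metric.ball (T x).fst R) {t : ℝ} (ht : t ∈ Set.Ico 0 (2 * R)) :
    graphPoint T g a t ∈ Metric.ball x ((L + 3) * R) := by
  have hR : 0 < R := by linarith [ht.1, ht.2]
  have hgraph := dist_graphPoint_le (T := T) (g := g) a (T x).fst t 0
  rw [graphPoint_fst_map hx] at hgraph
  have hvert : dist (g a + t) (g (T x).fst + 0) ≤ dist (g a) (g (T x).fst) + t := by
    simpa [Real.norm_of_nonneg ht.1] using dist_add_add_le (g a) t (g (T x).fst) 0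
  have hlip : dist (g a) (g (T x).fst) ≤ L * R :=
    (hL.dist_le_mul a ha _ (Metric.mem_ball_self hR)).trans (by gcongr; exact ha.le)
  rw [Metric.mem_ball] at ha ⊢
  linarith [ht.2]

end GraphPoint

section GraphBox

/-- A box of size `R` around the boundary point `x` in which the domain is, in the coordinates `T`,
the part above the graph of `g`, which has Lipschitz constant `L` over the base of the box. -/
structure IsGraphBox (D : Set (Eu d)) (x : Eu d) (R : ℝ)
    (T : Eu d ≃ᵃⁱ[ℝ] WithLp 2 (Eu (d - 1) × ℝ)) (g : Eu (d - 1) → ℝ) (L : NNReal) : Prop where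
  pos : 0 < R
  continuous : Continuous g
  lipschitz : LipschitzOnWith L g (Metric.ball (T x).fst R)
  mem_domain : ∀ a ∈ Metric.ball (T x).fst R, ∀ t ∈ Set.Ioo 0 (2 * R), graphPoint T g a t ∈ D
  mem_frontier : ∀ a ∈ Metric.ball (T x).fst R, graphPoint T g a 0 ∈ frontier D
  graphPoint_eq : ∀ y ∈ Metric.ball x R ∩ frontier D, graphPoint T g (T y).fst 0 = y

lemma IsLipschitzBoundedDomain.exists_isGraphBox (hD : IsLipschitzBoundedDomain D) {x : Eu d}
    (hx : x ∈ frontier D) : ∃ R T g L, IsGraphBox D x R T g L := by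
  obtain ⟨r, hr, T, g, hg, hchart⟩ := hD.lipschitz_boundary x hx
  have hfrontier {y : Eu d} (hy : y ∈ Metric.ball x r) :=
    mem_frontier_iff_graph hD.isOpen hg.continuous hchart hy
  have hgx := (hfrontier (Metric.mem_ball_self hr)).1 hx
  obtain ⟨L, S, hS, hLS⟩ := hg (T x).fst
  obtain ⟨ρ, hρ, hρS⟩ := Metric.mem_nhds_iff.1 hS
  set R := min ρ (r / (L + 4))
  have hR : 0 < R := by positivity
  have hRr : (L + 4) * R ≤ r := (le_div_iff₀' (by positivity)).1 (min_le_right _ _)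
  have hLR : LipschitzOnWith L g (Metric.ball (T x).fst R) :=
    hLS.mono ((Metric.ball_subset_ball (min_le_left _ _)).trans hρS)
  have hin : ∀ a ∈ Metric.ball (T x).fst R, ∀ t ∈ Set.Ico 0 (2 * R),
      graphPoint T g a t ∈ Metric.ball x r := fun a ha t ht =>
    Metric.ball_subset_ball (by linarith) (graphPoint_mem_ball hgx hLR ha ht)
  refine ⟨R, T, g, L, hR, hg.continuous, hLR, fun a ha t ht => ?_, fun a ha => ?_, fun y hy => ?_⟩
  · simpa [hchart _ (hin a ha t ⟨ht.1.le, ht.2⟩)] using ht.1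
  · simp [hfrontier (hin a ha 0 ⟨le_rfl, by positivity⟩)]
  · have hyr : y ∈ Metric.ball x r :=
      Metric.ball_subset_ball (by nlinarith [L.coe_nonneg]) hy.1
    exact graphPoint_fst_map ((hfrontier hyr).1 hy.2)

variable {x : Eu d} {R : ℝ} {T : Eu d ≃ᵃⁱ[ℝ] WithLp 2 (Eu (d - 1) × ℝ)} {g : Eu (d - 1) → ℝ}
  {L : NNReal}

lemma IsGraphBox.surfaceMeasure_restrict_le (h : IsGraphBox D x R T g L) :
    (surfaceMeasure D).restrict (Metric.ball x R) ≤ (((1 + L : NNReal) : ENNReal) ^ (d - 1)) •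
      (volume.restrict (Metric.ball (T x).fst R)).map fun a => graphPoint T g a 0 := by
  have hmeas : Measurable fun a => graphPoint T g a 0 :=
    (continuous_graphPoint_left h.continuous 0).measurable
  refine Measure.le_iff.2 fun s hs => ?_
  rw [Measure.restrict_apply hs, surfaceMeasure,
    Measure.restrict_apply (hs.inter Metric.isOpen_ball.measurableSet), Measure.smul_apply,
    smul_eq_mul, Measure.map_apply hmeas hs, Measure.restrict_apply (hmeas hs),
    ← EuclideanSpace.euclideanHausdorffMeasure_eq_volume]
  refine le_trans (measure_mono ?_) (euclideanHausdorffMeasure_image_le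
    ((lipschitzOnWith_graphPoint (T := T) h.lipschitz 0).mono Set.inter_subset_right) (d - 1))
  rintro y ⟨⟨hys, hyball⟩, hyfrontier⟩
  have hy := h.graphPoint_eq y ⟨hyball, hyfrontier⟩
  exact ⟨(T y).fst, ⟨by simpa [hy] using hys, fst_map_mem_ball hyball⟩, hy⟩

lemma IsGraphBox.surfaceMeasure_ball_lt_top (h : IsGraphBox D x R T g L) :
    surfaceMeasure D (Metric.ball x R) < ⊤ := by
  have hle := h.surfaceMeasure_restrict_le Set.univ
  rw [Measure.restrict_apply_univ, Measure.smul_apply, smul_eq_mul,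
    Measure.map_apply (continuous_graphPoint_left h.continuous 0).measurable
      MeasurableSet.univ, Set.preimage_univ, Measure.restrict_apply_univ] at hle
  exact hle.trans_lt (ENNReal.mul_lt_top (by finiteness) measure_ball_lt_top)

lemma IsGraphBox.volume_ball_le_surfaceMeasure_ball (h : IsGraphBox D x R T g L) {p : Eu d}
    (hp : p ∈ Metric.ball x (R / 2) ∩ frontier D) {ρ : ℝ} (hρ : 0 < ρ) (hρR : ρ ≤ R / 2) :
    volume (Metric.ball (T p).fst (ρ / (1 + L))) ≤ surfaceMeasure D (Metric.ball p ρ) := by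
  have hsmall : Metric.ball (T p).fst (ρ / (1 + L)) ⊆ Metric.ball (T x).fst R :=
    Metric.ball_subset_ball' (by
      have hshrink : ρ / (1 + L) ≤ ρ := div_le_self hρ.le (by simp)
      linarith [Metric.mem_ball.1 (fst_map_mem_ball (T := T) hp.1)])
  have hgp : graphPoint T g (T p).fst 0 = p :=
    h.graphPoint_eq p ⟨Metric.ball_subset_ball (by linarith [h.pos]) hp.1, hp.2⟩
  have hsub : Metric.ball (T p).fst (ρ / (1 + L)) ⊆
      (fun y => (T y).fst) '' (Metric.ball p ρ ∩ frontier D) := by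
    intro b hb
    refine ⟨graphPoint T g b 0, ⟨?_, h.mem_frontier b (hsmall hb)⟩, by simp⟩
    have hlip := (lipschitzOnWith_graphPoint (T := T) h.lipschitz 0).dist_le_mul b (hsmall hb)
      (T p).fst (hsmall (Metric.mem_ball_self (by positivity)))
    rw [hgp] at hlip
    rw [Metric.mem_ball, lt_div_iff₀' (by positivity)] at hb
    exact hlip.trans_lt (by exact_mod_cast hb)
  have hlip : LipschitzOnWith 1 (fun y => (T y).fst) (Metric.ball p ρ ∩ frontier D) :=
    LipschitzOnWith.of_dist_le_mul fun y _ z _ => by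
      rw [NNReal.coe_one, one_mul, ← T.dist_map y z]
      exact dist_fst_le _ _
  rw [surfaceMeasure, Measure.restrict_apply Metric.isOpen_ball.measurableSet,
    ← EuclideanSpace.euclideanHausdorffMeasure_eq_volume]
  exact (measure_mono hsub).trans
    ((euclideanHausdorffMeasure_image_le hlip (d - 1)).trans_eq (by simp))

end GraphBox

section LowerRegular

/-- Lower Ahlfors regularity of dimension `n` at the points of `S`, for balls of radius at most
`M`. -/
def IsLowerRegularOn {X : Type*} [PseudoMetricSpace X] [MeasurableSpace X] (σ : Measure X) (n : ℕ)
    (M : ℝ) (S : Set X) : Prop :=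
  ∃ c : ℝ, 0 < c ∧ ∀ p ∈ S, ∀ ρ : ℝ, 0 < ρ → ρ ≤ M →
    ENNReal.ofReal (c * ρ ^ n) ≤ σ (Metric.ball p ρ)

variable {X : Type*} [PseudoMetricSpace X] [MeasurableSpace X] {σ : Measure X} {n : ℕ} {M : ℝ}
  {S S' : Set X}

lemma IsLowerRegularOn.mono (h : IsLowerRegularOn σ n M S') (hS : S ⊆ S') :
    IsLowerRegularOn σ n M S := by
  obtain ⟨c, hc, hball⟩ := h
  exact ⟨c, hc, fun p hp => hball p (hS hp)⟩

lemma IsLowerRegularOn.union (h : IsLowerRegularOn σ n M S) (h' : IsLowerRegularOn σ n M S') :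
    IsLowerRegularOn σ n M (S ∪ S') := by
  obtain ⟨c, hc, hball⟩ := h
  obtain ⟨c', hc', hball'⟩ := h'
  refine ⟨min c c', lt_min hc hc', ?_⟩
  rintro p (hp | hp) ρ hρ hρM
  · refine le_trans (ENNReal.ofReal_le_ofReal ?_) (hball p hp ρ hρ hρM)
    gcongr
    exact min_le_left _ _
  · refine le_trans (ENNReal.ofReal_le_ofReal ?_) (hball' p hp ρ hρ hρM)
    gcongr
    exact min_le_right _ _

lemma IsLowerRegularOn.of_radius_pos {r : ℝ} (h : IsLowerRegularOn σ n r S) (hr : 0 < r) :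
    IsLowerRegularOn σ n M S := by
  obtain ⟨c, hc, hball⟩ := h
  have hmax : 0 < max r M := lt_max_of_lt_left hr
  refine ⟨c * (r / max r M) ^ n, by positivity, fun p hp ρ hρ hρM => ?_⟩
  have hscale : r / max r M * ρ ≤ min r ρ := by
    refine le_min ?_ (mul_le_of_le_one_left hρ.le ((div_le_one hmax).2 (le_max_left _ _)))
    rw [div_mul_eq_mul_div, div_le_iff₀ hmax]
    gcongr
    exact hρM.trans (le_max_right _ _)
  rw [mul_assoc, ← mul_pow]
  calc ENNReal.ofReal (c * (r / max r M * ρ) ^ n)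
      ≤ ENNReal.ofReal (c * min r ρ ^ n) := by gcongr
    _ ≤ σ (Metric.ball p (min r ρ)) := hball p hp _ (lt_min hr hρ) (min_le_left _ _)
    _ ≤ σ (Metric.ball p ρ) := measure_mono (Metric.ball_subset_ball (min_le_right _ _))

lemma isLowerRegularOn_of_isCompact {K : Set X} (hK : IsCompact K)
    (hloc : ∀ x ∈ K, ∃ s > 0, ∃ r > 0, IsLowerRegularOn σ n r (Metric.ball x s ∩ K)) :
    IsLowerRegularOn σ n M K := by
  have hind := hK.induction_on (p := fun S => IsLowerRegularOn σ n M (S ∩ K))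
    ⟨1, one_pos, by simp⟩ (fun S S' hS h => h.mono (Set.inter_subset_inter_left _ hS))
    (fun S S' h h' => by rw [Set.union_inter_distrib_right]; exact h.union h') (fun x hx => ?_)
  · rwa [Set.inter_self] at hind
  · obtain ⟨s, hs, r, hr, hreg⟩ := hloc x hx
    exact ⟨_, mem_nhdsWithin_of_mem_nhds (Metric.ball_mem_nhds x hs), hreg.of_radius_pos hr⟩

end LowerRegular

section SurfaceMeasure

lemma IsGraphBox.isLowerRegularOn {x : Eu d} {R : ℝ}
    {T : Eu d ≃ᵃⁱ[ℝ] WithLp 2 (Eu (d - 1) × ℝ)} {g : Eu (d - 1) → ℝ} {L : NNReal}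
    (h : IsGraphBox D x R T g L) : IsLowerRegularOn (surfaceMeasure D) (d - 1) (R / 2)
      (Metric.ball x (R / 2) ∩ frontier D) := by
  have hunit : 0 < (volume (Metric.ball (0 : Eu (d - 1)) 1)).toReal :=
    ENNReal.toReal_pos (Metric.measure_ball_pos _ _ one_pos).ne' measure_ball_lt_top.ne
  refine ⟨(1 / (1 + L : ℝ)) ^ (d - 1) * (volume (Metric.ball (0 : Eu (d - 1)) 1)).toReal,
    by positivity, fun p hp ρ hρ hρR => ?_⟩
  refine le_of_eq_of_le ?_ (h.volume_ball_le_surfaceMeasure_ball hp hρ hρR)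
  rw [Measure.addHaar_ball_of_pos _ (T p).fst (by positivity), finrank_euclideanSpace_fin,
    mul_right_comm, ENNReal.ofReal_mul (by positivity),
    ENNReal.ofReal_toReal measure_ball_lt_top.ne, ← mul_pow, one_div_mul_eq_div]

lemma IsLipschitzBoundedDomain.isCompact_frontier (hD : IsLipschitzBoundedDomain D) :
    IsCompact (frontier D) :=
  hD.isBounded.isCompact_closure.of_isClosed_subset isClosed_frontier frontier_subset_closure

lemma surfaceMeasure_compl_frontier : surfaceMeasure D (frontier D)ᶜ = 0 := by
  rw [surfaceMeasure, Measure.restrict_apply isClosed_frontier.measurableSet.compl]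
  simp

lemma ae_mem_frontier : ∀ᵐ x ∂(surfaceMeasure D), x ∈ frontier D :=
  ae_restrict_mem isClosed_frontier.measurableSet

lemma IsLipschitzBoundedDomain.isFiniteMeasure (hD : IsLipschitzBoundedDomain D) :
    IsFiniteMeasure (surfaceMeasure D) := by
  have hfrontier : surfaceMeasure D (frontier D) < ⊤ :=
    hD.isCompact_frontier.measure_lt_top_of_nhdsWithin fun x hx => by
      obtain ⟨R, T, g, L, hbox⟩ := hD.exists_isGraphBox hx
      exact ⟨Metric.ball x R, mem_nhdsWithin_of_mem_nhds (Metric.ball_mem_nhds _ hbox.pos),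
        hbox.surfaceMeasure_ball_lt_top⟩
  refine ⟨?_⟩
  rwa [← measure_add_measure_compl isClosed_frontier.measurableSet,
    surfaceMeasure_compl_frontier, add_zero]

lemma IsLipschitzBoundedDomain.isLowerRegularOn_frontier (hD : IsLipschitzBoundedDomain D)
    (M : ℝ) : IsLowerRegularOn (surfaceMeasure D) (d - 1) M (frontier D) := by
  refine isLowerRegularOn_of_isCompact hD.isCompact_frontier fun x hx => ?_
  obtain ⟨R, T, g, L, hbox⟩ := hD.exists_isGraphBox hx
  exact ⟨R / 2, half_pos hbox.pos, R / 2, half_pos hbox.pos, hbox.isLowerRegularOn⟩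

end SurfaceMeasure

section Kernel

/-- The regularized power kernel `(|x - y|² + ε²)^(-d)`. -/
def kernel (ε : ℝ) (x y : Eu d) : ℝ := ((‖x - y‖ ^ 2 + ε ^ 2) ^ d)⁻¹

/-- The gradient of `kernel` in its first variable. -/
def kernelGrad (ε : ℝ) (x y : Eu d) : Eu d :=
  (-(2 * d * ((‖x - y‖ ^ 2 + ε ^ 2) ^ (d + 1))⁻¹)) • (x - y)

variable {ε δ : ℝ} {x y : Eu d}

lemma kernel_nonneg : 0 ≤ kernel ε x y := by
  unfold kernel
  positivity

lemma kernel_pos (h : 0 < ‖x - y‖ ^ 2 + ε ^ 2) : 0 < kernel ε x y := by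
  unfold kernel
  positivity

lemma kernel_le (hδ : 0 < δ) (h : δ ^ 2 ≤ ‖x - y‖ ^ 2 + ε ^ 2) :
    kernel ε x y ≤ ((δ ^ 2) ^ d)⁻¹ := by
  unfold kernel
  gcongr

lemma norm_kernelGrad_le (hδ : 0 < δ) (h : δ ^ 2 ≤ ‖x - y‖ ^ 2 + ε ^ 2) :
    ‖kernelGrad ε x y‖ ≤ 2 * d / δ * kernel ε x y := by
  set q := ‖x - y‖ ^ 2 + ε ^ 2 with hq
  have hq_pos : 0 < q := lt_of_lt_of_le (by positivity) h
  have norm_mul_le : ‖x - y‖ * δ ≤ q := by nlinarith [sq_nonneg (‖x - y‖ - δ), sq_nonneg ε]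
  have inv_mul_norm_le : q⁻¹ * ‖x - y‖ ≤ 1 / δ := by
    rwa [le_div_iff₀ hδ, mul_assoc, inv_mul_le_iff₀ hq_pos, mul_one]
  calc ‖kernelGrad ε x y‖ = 2 * d * (q ^ d)⁻¹ * (q⁻¹ * ‖x - y‖) := by
        rw [kernelGrad, norm_smul, norm_neg, Real.norm_of_nonneg (by positivity), ← hq,
          pow_succ, mul_inv]
        ring
    _ ≤ 2 * d * (q ^ d)⁻¹ * (1 / δ) := by gcongr
    _ = 2 * d / δ * kernel ε x y := by rw [kernel, ← hq]; ring

lemma hasDerivAt_add_pow_inv (d : ℕ) {s a : ℝ} (h : 0 < s + a) :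
    HasDerivAt (fun t : ℝ => ((t + a) ^ d)⁻¹) (-(d * ((s + a) ^ (d + 1))⁻¹)) s := by
  refine ((((hasDerivAt_id s).add_const a).pow d).inv
    (by simpa using (pow_pos h d).ne')).congr_deriv ?_
  change -(d * (s + a) ^ (d - 1) * 1) / ((s + a) ^ d) ^ 2 = _
  rcases d with _ | n
  · simp
  · simp only [Nat.add_sub_cancel]
    field_simp
    ring

lemma hasGradientAt_kernel (h : 0 < ‖x - y‖ ^ 2 + ε ^ 2) :
    HasGradientAt (fun x => kernel ε x y) (kernelGrad ε x y) x := by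
  have hasFDerivAt_norm_sq :
      HasFDerivAt (fun x : Eu d => ‖x - y‖ ^ 2) (2 • (innerSL ℝ (x - y))) x := by
    simpa using ((hasFDerivAt_id x).sub_const y).norm_sq
  rw [hasGradientAt_iff_hasFDerivAt]
  refine ((hasDerivAt_add_pow_inv d h).comp_hasFDerivAt x hasFDerivAt_norm_sq).congr_fderiv ?_
  ext z
  simp [kernelGrad]
  ring

lemma contDiff_kernel (hε : 0 < ε) (y : Eu d) : ContDiff ℝ ∞ fun x => kernel ε x y := by
  unfold kernel
  exact ContDiff.inv
    ((((contDiff_id.sub contDiff_const).norm_sq ℝ).add contDiff_const).pow d)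
    fun x => by positivity

lemma measurable_kernel_right : Measurable fun y => kernel ε x y := by
  unfold kernel
  fun_prop

lemma measurable_kernelGrad_right : Measurable fun y => kernelGrad ε x y := by
  unfold kernelGrad
  fun_prop

end Kernel

section KernelAverage

/-- The integral of `φ` against `kernel`. -/
def kernelInt (σ : Measure (Eu d)) (φ : Eu d → ℝ) (ε : ℝ) (x : Eu d) : ℝ :=
  ∫ y, φ y * kernel ε x y ∂σ

/-- The integral of `φ` against `kernelGrad`. -/
def kernelIntGrad (σ : Measure (Eu d)) (φ : Eu d → ℝ) (ε : ℝ) (x : Eu d) : Eu d :=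
  ∫ y, φ y • kernelGrad ε x y ∂σ

/-- The average of `φ` with weight proportional to `kernel ε x`. As a function of `x` this extends
a function `φ` on the boundary to the whole space, smoothly as long as `ε > 0`. -/
def kernelAvg (σ : Measure (Eu d)) (φ : Eu d → ℝ) (ε : ℝ) (x : Eu d) : ℝ :=
  kernelInt σ φ ε x / kernelInt σ 1 ε x

/-- The gradient of `kernelAvg`, as given by the quotient rule. -/
def kernelAvgGrad (σ : Measure (Eu d)) (φ : Eu d → ℝ) (ε : ℝ) (x : Eu d) : Eu d :=
  (kernelInt σ 1 ε x)⁻¹ •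
    (kernelIntGrad σ φ ε x - kernelAvg σ φ ε x • kernelIntGrad σ 1 ε x)

variable {σ : Measure (Eu d)} {φ : Eu d → ℝ} {ε δ : ℝ} {x : Eu d}

lemma sq_le_norm_sub_sq_add_sq (ε : ℝ) (x y : Eu d) : ε ^ 2 ≤ ‖x - y‖ ^ 2 + ε ^ 2 :=
  le_add_of_nonneg_left (sq_nonneg _)

lemma integrable_mul_kernel (hφ : Integrable φ σ) (hδ : 0 < δ)
    (h : ∀ᵐ y ∂σ, δ ^ 2 ≤ ‖x - y‖ ^ 2 + ε ^ 2) :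
    Integrable (fun y => φ y * kernel ε x y) σ := by
  refine hφ.mul_bdd (c := ((δ ^ 2) ^ d)⁻¹) measurable_kernel_right.aestronglyMeasurable ?_
  filter_upwards [h] with y hy
  rw [Real.norm_of_nonneg kernel_nonneg]
  exact kernel_le hδ hy

lemma integrable_kernel [IsFiniteMeasure σ] (hδ : 0 < δ)
    (h : ∀ᵐ y ∂σ, δ ^ 2 ≤ ‖x - y‖ ^ 2 + ε ^ 2) : Integrable (kernel ε x) σ := by
  simpa using integrable_mul_kernel (integrable_const (1 : ℝ)) hδ h

lemma integrable_smul_kernelGrad (hφ : Integrable φ σ) (hδ : 0 < δ)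
    (h : ∀ᵐ y ∂σ, δ ^ 2 ≤ ‖x - y‖ ^ 2 + ε ^ 2) :
    Integrable (fun y => φ y • kernelGrad ε x y) σ := by
  refine hφ.smul_bdd (2 * d / δ * ((δ ^ 2) ^ d)⁻¹)
    measurable_kernelGrad_right.aestronglyMeasurable ?_
  filter_upwards [h] with y hy
  refine (norm_kernelGrad_le hδ hy).trans ?_
  gcongr
  exact kernel_le hδ hy

lemma integrable_kernelGrad [IsFiniteMeasure σ] (hδ : 0 < δ)
    (h : ∀ᵐ y ∂σ, δ ^ 2 ≤ ‖x - y‖ ^ 2 + ε ^ 2) : Integrable (kernelGrad ε x) σ := by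
  simpa using integrable_smul_kernelGrad (integrable_const (1 : ℝ)) hδ h

lemma hasGradientAt_kernelInt (hφ : Integrable φ σ) (hε : 0 < ε) (x : Eu d) :
    HasGradientAt (kernelInt σ φ ε) (kernelIntGrad σ φ ε x) x := by
  have hε_le (x : Eu d) : ∀ᵐ y ∂σ, ε ^ 2 ≤ ‖x - y‖ ^ 2 + ε ^ 2 :=
    Eventually.of_forall (sq_le_norm_sub_sq_add_sq ε x)
  let toDual := InnerProductSpace.toDual ℝ (Eu d)
  rw [hasGradientAt_iff_hasFDerivAt]
  have hasFDerivAt_integral := hasFDerivAt_integral_of_dominated_of_fderiv_le (𝕜 := ℝ) (μ := σ)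
    (x₀ := x) (F := fun x y => φ y * kernel ε x y)
    (F' := fun x y => toDual (φ y • kernelGrad ε x y))
    (bound := fun y => ‖φ y‖ * (2 * d / ε * ((ε ^ 2) ^ d)⁻¹)) univ_mem
    (Eventually.of_forall fun x => (integrable_mul_kernel hφ hε (hε_le x)).1)
    (integrable_mul_kernel hφ hε (hε_le x))
    (toDual.continuous.comp_aestronglyMeasurable
      (integrable_smul_kernelGrad hφ hε (hε_le x)).1)
    (Eventually.of_forall fun y x _ => ?_) (hφ.norm.mul_const _)
    (Eventually.of_forall fun y x _ => ?_)
  · refine hasFDerivAt_integral.congr_fderiv ?_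
    exact toDual.toContinuousLinearEquiv.toContinuousLinearMap.integral_comp_comm
      (integrable_smul_kernelGrad hφ hε (hε_le x))
  · rw [LinearIsometryEquiv.norm_map, norm_smul]
    gcongr
    refine (norm_kernelGrad_le hε (sq_le_norm_sub_sq_add_sq ε x y)).trans ?_
    gcongr
    exact kernel_le hε (sq_le_norm_sub_sq_add_sq ε x y)
  · rw [map_smul]
    exact (hasGradientAt_kernel (by positivity)).hasFDerivAt.const_mul (φ y)

lemma contDiff_kernelInt {K : Set (Eu d)} (hK : Bornology.IsBounded K) (hσ : ∀ᵐ y ∂σ, y ∈ K)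
    (hφ : Integrable φ σ) (hε : 0 < ε) : ContDiff ℝ ∞ (kernelInt σ φ ε) := by
  obtain ⟨M, hM_pos, hM⟩ := hK.exists_pos_norm_le
  rw [contDiff_iff_contDiffAt]
  intro x
  -- Near `x` the integral is the convolution of `φ` with a compactly supported smooth function.
  let χ : ContDiffBump (0 : Eu d) :=
    ⟨‖x‖ + 1 + M, ‖x‖ + 2 + M, by positivity, by linarith⟩
  have contDiff_cutoff : ContDiff ℝ ∞ fun z => χ z * kernel ε z 0 :=
    χ.contDiff.mul (contDiff_kernel hε 0)
  have hasCompactSupport_cutoff : HasCompactSupport fun z => χ z * kernel ε z 0 :=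
    χ.hasCompactSupport.mul_right
  have contDiff_conv := hasCompactSupport_cutoff.contDiff_convolution_right (n := ⊤)
    (ContinuousLinearMap.lsmul ℝ ℝ) hφ.locallyIntegrable contDiff_cutoff
  refine (contDiff_conv.contDiffAt (x := x)).congr_of_eventuallyEq ?_
  filter_upwards [Metric.ball_mem_nhds x one_pos] with z hz
  rw [kernelInt, convolution]
  refine integral_congr_ae ?_
  filter_upwards [hσ] with y hy
  have cutoff_eq_one : χ (z - y) = 1 := by
    refine χ.one_of_mem_closedBall ?_
    rw [mem_closedBall_zero_iff]
    rw [mem_ball_iff_norm] at hz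
    change ‖z - y‖ ≤ ‖x‖ + 1 + M
    calc ‖z - y‖ ≤ ‖z‖ + ‖y‖ := norm_sub_le _ _
      _ ≤ ‖x‖ + 1 + M := add_le_add (by linarith [norm_sub_norm_le z x]) (hM y hy)
  simp [cutoff_eq_one, kernel]

lemma kernelInt_one_pos [IsFiniteMeasure σ] [NeZero σ] (hδ : 0 < δ)
    (h : ∀ᵐ y ∂σ, δ ^ 2 ≤ ‖x - y‖ ^ 2 + ε ^ 2) : 0 < kernelInt σ 1 ε x := by
  have kernel_pos_ae : ∀ᵐ y ∂σ, 0 < kernel ε x y := by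
    filter_upwards [h] with y hy
    exact kernel_pos (lt_of_lt_of_le (by positivity) hy)
  have support_ae_eq : (Function.support (kernel ε x)) =ᵐ[σ] (Set.univ : Set (Eu d)) :=
    eventuallyEq_univ.2 (kernel_pos_ae.mono fun y hy => hy.ne')
  simp only [kernelInt, Pi.one_apply, one_mul]
  rw [integral_pos_iff_support_of_nonneg (fun y => kernel_nonneg) (integrable_kernel hδ h),
    measure_congr support_ae_eq]
  exact Measure.measure_univ_pos.2 (NeZero.ne σ)

lemma hasGradientAt_kernelAvg [IsFiniteMeasure σ] [NeZero σ] (hφ : Integrable φ σ) (hε : 0 < ε)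
    (x : Eu d) : HasGradientAt (kernelAvg σ φ ε) (kernelAvgGrad σ φ ε x) x := by
  have mass_pos : 0 < kernelInt σ 1 ε x :=
    kernelInt_one_pos hε (Eventually.of_forall (sq_le_norm_sub_sq_add_sq ε x))
  have hasFDerivAt_num := (hasGradientAt_kernelInt hφ hε x).hasFDerivAt
  have hasFDerivAt_mass :=
    (hasGradientAt_kernelInt (φ := 1) (integrable_const (μ := σ) 1) hε x).hasFDerivAt
  have hasFDerivAt_quotient := hasFDerivAt_num.mul
    ((hasDerivAt_inv mass_pos.ne').comp_hasFDerivAt x hasFDerivAt_mass)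
  rw [hasGradientAt_iff_hasFDerivAt]
  refine (hasFDerivAt_quotient.congr_fderiv ?_).congr_of_eventuallyEq
    (Eventually.of_forall fun z => ?_)
  · ext z
    simp [kernelAvgGrad, kernelAvg]
    field_simp
    ring
  · simp [kernelAvg, div_eq_mul_inv]

lemma contDiff_kernelAvg [IsFiniteMeasure σ] [NeZero σ] {K : Set (Eu d)}
    (hK : Bornology.IsBounded K) (hσ : ∀ᵐ y ∂σ, y ∈ K)
    (hφ : Integrable φ σ) (hε : 0 < ε) : ContDiff ℝ ∞ (kernelAvg σ φ ε) :=
  (contDiff_kernelInt hK hσ hφ hε).div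
    (contDiff_kernelInt hK hσ (φ := 1) (integrable_const 1) hε) fun x =>
    (kernelInt_one_pos hε (Eventually.of_forall (sq_le_norm_sub_sq_add_sq ε x))).ne'

end KernelAverage

section KernelEstimates

lemma enorm_integral_smul_sq_le {α E : Type*} [MeasurableSpace α] {μ : Measure α}
    [NormedAddCommGroup E] [NormedSpace ℝ E] {f : α → ℝ} {b : α → E} {k : α → ENNReal}
    {A : ENNReal} (hA : A ≠ ⊤) (hf : AEMeasurable f μ) (hk : AEMeasurable k μ)
    (hb : ∀ᵐ y ∂μ, ‖b y‖ₑ ≤ A * k y) :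
    ‖∫ y, f y • b y ∂μ‖ₑ ^ 2 ≤ A ^ 2 * ((∫⁻ y, k y ∂μ) * ∫⁻ y, ‖f y‖ₑ ^ 2 * k y ∂μ) := by
  have sqrt_mul_self (y : α) : k y ^ (1 / 2 : ℝ) * k y ^ (1 / 2 : ℝ) = k y := by
    rw [← ENNReal.rpow_add_of_nonneg _ _ (by norm_num) (by norm_num)]
    norm_num
  have enorm_le : ‖∫ y, f y • b y ∂μ‖ₑ ≤
      A * ∫⁻ y, k y ^ (1 / 2 : ℝ) * (‖f y‖ₑ * k y ^ (1 / 2 : ℝ)) ∂μ := by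
    refine (enorm_integral_le_lintegral_enorm _).trans ?_
    rw [← lintegral_const_mul' _ _ hA]
    refine lintegral_mono_ae ?_
    filter_upwards [hb] with y hy
    calc ‖f y • b y‖ₑ ≤ ‖f y‖ₑ * (A * k y) := by rw [enorm_smul]; gcongr
      _ = A * (‖f y‖ₑ * (k y ^ (1 / 2 : ℝ) * k y ^ (1 / 2 : ℝ))) := by
          rw [sqrt_mul_self, mul_left_comm]
      _ = A * (k y ^ (1 / 2 : ℝ) * (‖f y‖ₑ * k y ^ (1 / 2 : ℝ))) := by ring
  have aemeasurable_sqrt : AEMeasurable (fun y => k y ^ (1 / 2 : ℝ)) μ := hk.pow_const _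
  refine (pow_le_pow_left' enorm_le 2).trans ?_
  rw [mul_pow]
  refine mul_le_mul_right ((sq_lintegral_mul_le aemeasurable_sqrt
    (hf.enorm.mul aemeasurable_sqrt)).trans (le_of_eq ?_)) _
  simp only [Pi.mul_apply, mul_pow, pow_two (k _ ^ (1 / 2 : ℝ)), sqrt_mul_self]

variable {σ : Measure (Eu d)} {φ : Eu d → ℝ} {ε δ : ℝ} {x : Eu d}

lemma measurable_ofReal_kernel : Measurable fun y => ENNReal.ofReal (kernel ε x y) :=
  measurable_kernel_right.ennreal_ofReal

lemma lintegral_kernel [IsFiniteMeasure σ] (hδ : 0 < δ)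
    (h : ∀ᵐ y ∂σ, δ ^ 2 ≤ ‖x - y‖ ^ 2 + ε ^ 2) :
    ∫⁻ y, ENNReal.ofReal (kernel ε x y) ∂σ = ENNReal.ofReal (kernelInt σ 1 ε x) := by
  simp only [kernelInt, Pi.one_apply, one_mul]
  exact (ofReal_integral_eq_lintegral_ofReal (integrable_kernel hδ h)
    (Eventually.of_forall fun y => kernel_nonneg)).symm

lemma integral_sub_smul_kernel [IsFiniteMeasure σ] [NeZero σ] (hφ : Integrable φ σ) (hδ : 0 < δ)
    (h : ∀ᵐ y ∂σ, δ ^ 2 ≤ ‖x - y‖ ^ 2 + ε ^ 2) (c : ℝ) :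
    ∫ y, (c - φ y) • kernel ε x y ∂σ = kernelInt σ 1 ε x * (c - kernelAvg σ φ ε x) := by
  simp only [smul_eq_mul, sub_mul]
  rw [integral_sub ((integrable_kernel hδ h).const_mul c) (integrable_mul_kernel hφ hδ h),
    integral_const_mul, mul_sub, kernelAvg, mul_div_cancel₀ _ (kernelInt_one_pos hδ h).ne',
    kernelInt, kernelInt]
  simp [mul_comm]

lemma integral_sub_kernelAvg_smul_kernelGrad [IsFiniteMeasure σ] [NeZero σ]
    (hφ : Integrable φ σ) (hδ : 0 < δ) (h : ∀ᵐ y ∂σ, δ ^ 2 ≤ ‖x - y‖ ^ 2 + ε ^ 2) :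
    ∫ y, (φ y - kernelAvg σ φ ε x) • kernelGrad ε x y ∂σ =
      kernelInt σ 1 ε x • kernelAvgGrad σ φ ε x := by
  have integrable_avg_smul :
      Integrable (fun y => kernelAvg σ φ ε x • kernelGrad ε x y) σ :=
    (integrable_kernelGrad hδ h).fun_smul _
  simp only [sub_smul]
  rw [integral_sub (integrable_smul_kernelGrad hφ hδ h) integrable_avg_smul,
    integral_smul, kernelAvgGrad, smul_smul, mul_inv_cancel₀ (kernelInt_one_pos hδ h).ne',
    one_smul, kernelIntGrad, kernelIntGrad]
  simp

lemma kernelInt_mul_sub_kernelAvg_sq_le [IsFiniteMeasure σ] [NeZero σ] (hφ : Integrable φ σ)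
    (hδ : 0 < δ) (h : ∀ᵐ y ∂σ, δ ^ 2 ≤ ‖x - y‖ ^ 2 + ε ^ 2) (c : ℝ) :
    ENNReal.ofReal (kernelInt σ 1 ε x) * ‖c - kernelAvg σ φ ε x‖ₑ ^ 2 ≤
      ∫⁻ z, ‖c - φ z‖ₑ ^ 2 * ENNReal.ofReal (kernel ε x z) ∂σ := by
  have mass_pos := kernelInt_one_pos (σ := σ) hδ h
  have cauchy_schwarz := enorm_integral_smul_sq_le (μ := σ) (f := fun z => c - φ z) (A := 1)
    (b := kernel ε x) ENNReal.one_ne_top (aemeasurable_const.sub hφ.1.aemeasurable)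
    measurable_ofReal_kernel.aemeasurable
    (Eventually.of_forall fun z => by rw [one_mul, Real.enorm_of_nonneg kernel_nonneg])
  rw [integral_sub_smul_kernel hφ hδ h, lintegral_kernel hδ h, one_pow, one_mul, enorm_mul,
    mul_pow, Real.enorm_of_nonneg mass_pos.le, pow_two, mul_assoc] at cauchy_schwarz
  exact (ENNReal.mul_le_mul_iff_right (ENNReal.ofReal_pos.2 mass_pos).ne'
    ENNReal.ofReal_ne_top).1 cauchy_schwarz

-- Subtracting the average from `φ` does not change the gradient, so Cauchy–Schwarz gives a bound
-- by differences of `φ` only.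
lemma kernelInt_sq_mul_kernelAvgGrad_sq_le [IsFiniteMeasure σ] [NeZero σ] (hφ : Integrable φ σ)
    (hδ : 0 < δ) (h : ∀ᵐ y ∂σ, δ ^ 2 ≤ ‖x - y‖ ^ 2 + ε ^ 2) :
    ENNReal.ofReal (kernelInt σ 1 ε x) ^ 2 * ‖kernelAvgGrad σ φ ε x‖ₑ ^ 2 ≤
      ENNReal.ofReal (2 * d / δ) ^ 2 * ∫⁻ y, ∫⁻ z, ‖φ y - φ z‖ₑ ^ 2 *
        (ENNReal.ofReal (kernel ε x y) * ENNReal.ofReal (kernel ε x z)) ∂σ ∂σ := by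
  set m := kernelAvg σ φ ε x
  have cauchy_schwarz := enorm_integral_smul_sq_le (μ := σ) (f := fun y => φ y - m)
    (A := ENNReal.ofReal (2 * d / δ)) (b := kernelGrad ε x) ENNReal.ofReal_ne_top
    (hφ.1.aemeasurable.sub_const m) measurable_ofReal_kernel.aemeasurable
    (by
      filter_upwards [h] with y hy
      rw [← ofReal_norm, ← ENNReal.ofReal_mul (by positivity)]
      exact ENNReal.ofReal_le_ofReal (norm_kernelGrad_le hδ hy))
  rw [integral_sub_kernelAvg_smul_kernelGrad hφ hδ h, lintegral_kernel hδ h, enorm_smul, mul_pow,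
    Real.enorm_of_nonneg (kernelInt_one_pos hδ h).le] at cauchy_schwarz
  refine cauchy_schwarz.trans (mul_le_mul_right ?_ _)
  rw [← lintegral_const_mul' _ _ ENNReal.ofReal_ne_top]
  refine lintegral_mono fun y => ?_
  calc ENNReal.ofReal (kernelInt σ 1 ε x) * (‖φ y - m‖ₑ ^ 2 * ENNReal.ofReal (kernel ε x y))
      = (ENNReal.ofReal (kernelInt σ 1 ε x) * ‖φ y - m‖ₑ ^ 2) *
          ENNReal.ofReal (kernel ε x y) := by ring
    _ ≤ (∫⁻ z, ‖φ y - φ z‖ₑ ^ 2 * ENNReal.ofReal (kernel ε x z) ∂σ) *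
          ENNReal.ofReal (kernel ε x y) := by
        gcongr
        exact kernelInt_mul_sub_kernelAvg_sq_le hφ hδ h (φ y)
    _ = ∫⁻ z, ‖φ y - φ z‖ₑ ^ 2 *
          (ENNReal.ofReal (kernel ε x y) * ENNReal.ofReal (kernel ε x z)) ∂σ := by
        rw [← lintegral_mul_const' _ _ ENNReal.ofReal_ne_top]
        exact lintegral_congr fun z => by ring

lemma inv_pow_le_kernel {p y : Eu d} (hδ : 0 < δ) (hε : |ε| ≤ δ)
    (h : δ ^ 2 ≤ ‖x - y‖ ^ 2 + ε ^ 2) (hp : ‖x - p‖ ≤ δ) (hy : ‖p - y‖ ≤ δ) :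
    ((5 * δ ^ 2) ^ d)⁻¹ ≤ kernel ε x y := by
  have norm_le : ‖x - y‖ ≤ 2 * δ := by
    linarith [norm_sub_le_norm_sub_add_norm_sub x p y]
  have sq_le : ε ^ 2 ≤ δ ^ 2 := sq_le_sq.2 (by rwa [abs_of_pos hδ])
  have sum_pos : 0 < ‖x - y‖ ^ 2 + ε ^ 2 := lt_of_lt_of_le (by positivity) h
  unfold kernel
  gcongr
  nlinarith [norm_nonneg (x - y)]

lemma le_pow_mul_kernelInt [IsFiniteMeasure σ] (hd : 1 ≤ d) (hδ : 0 < δ) (hε : |ε| ≤ δ)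
    (h : ∀ᵐ y ∂σ, δ ^ 2 ≤ ‖x - y‖ ^ 2 + ε ^ 2)
    {p : Eu d} (hp : ‖x - p‖ ≤ δ) {c : ℝ}
    (hσ : ENNReal.ofReal (c * δ ^ (d - 1)) ≤ σ (Metric.ball p δ)) :
    ENNReal.ofReal (c / 5 ^ d) ≤
      ENNReal.ofReal (δ ^ (d + 1)) * ENNReal.ofReal (kernelInt σ 1 ε x) := by
  rw [← lintegral_kernel hδ h]
  calc ENNReal.ofReal (c / 5 ^ d)
      = ENNReal.ofReal (δ ^ (d + 1)) * (ENNReal.ofReal (((5 * δ ^ 2) ^ d)⁻¹) *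
          ENNReal.ofReal (c * δ ^ (d - 1))) := by
        rw [← ENNReal.ofReal_mul (by positivity), ← ENNReal.ofReal_mul (by positivity)]
        congr 1
        obtain ⟨n, rfl⟩ : ∃ n, d = n + 1 := ⟨d - 1, by omega⟩
        simp only [Nat.add_sub_cancel]
        field_simp
        ring
    _ ≤ ENNReal.ofReal (δ ^ (d + 1)) * (ENNReal.ofReal (((5 * δ ^ 2) ^ d)⁻¹) *
          σ (Metric.ball p δ)) := by gcongr
    _ ≤ ENNReal.ofReal (δ ^ (d + 1)) * ∫⁻ y, ENNReal.ofReal (kernel ε x y) ∂σ := by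
        gcongr
        rw [← setLIntegral_const]
        refine (lintegral_mono_ae ?_).trans (setLIntegral_le_lintegral _ _)
        filter_upwards [ae_restrict_mem Metric.isOpen_ball.measurableSet, ae_restrict_of_ae h]
          with y hy hyδ
        exact ENNReal.ofReal_le_ofReal
          (inv_pow_le_kernel hδ hε hyδ hp (mem_ball_iff_norm'.1 hy).le)

/-- The bound `max(|x - y|, |x - z|)^(-2d)` for the product `kernel ε x y * kernel ε x z`, up to
powers of the distance of `x` to the boundary, which does not depend on `ε`. -/
def majorant (x y z : Eu d) : ENNReal :=
  ENNReal.ofReal ((max ‖x - y‖ ‖x - z‖ ^ (2 * d))⁻¹)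

lemma measurable_majorant {α : Type*} [MeasurableSpace α] {f g h : α → Eu d} (hf : Measurable f)
    (hg : Measurable g) (hh : Measurable h) :
    Measurable fun q => majorant (f q) (g q) (h q) := by
  unfold majorant
  fun_prop

lemma pow_mul_kernel_mul_kernel_le_inv_norm_pow {y z : Eu d} (hδ : 0 < δ)
    (hy : δ ^ 2 ≤ ‖x - y‖ ^ 2 + ε ^ 2) (hz_pos : 0 < ‖x - z‖) :
    δ ^ (2 * d) * (kernel ε x y * kernel ε x z) ≤ (‖x - z‖ ^ (2 * d))⁻¹ := by
  have pow_mul_kernel_le : δ ^ (2 * d) * kernel ε x y ≤ 1 := by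
    rw [pow_mul, ← le_div_iff₀' (by positivity), one_div]
    exact kernel_le hδ hy
  have kernel_le_inv : kernel ε x z ≤ (‖x - z‖ ^ (2 * d))⁻¹ := by
    rw [pow_mul]
    exact kernel_le hz_pos (le_add_of_nonneg_right (sq_nonneg ε))
  calc δ ^ (2 * d) * (kernel ε x y * kernel ε x z)
      = (δ ^ (2 * d) * kernel ε x y) * kernel ε x z := by ring
    _ ≤ 1 * (‖x - z‖ ^ (2 * d))⁻¹ :=
        mul_le_mul pow_mul_kernel_le kernel_le_inv kernel_nonneg zero_le_one
    _ = (‖x - z‖ ^ (2 * d))⁻¹ := one_mul _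

lemma pow_mul_kernel_mul_kernel_le_majorant {y z : Eu d} (hδ : 0 < δ)
    (hy : δ ^ 2 ≤ ‖x - y‖ ^ 2 + ε ^ 2) (hz : δ ^ 2 ≤ ‖x - z‖ ^ 2 + ε ^ 2)
    (hy_pos : 0 < ‖x - y‖) (hz_pos : 0 < ‖x - z‖) :
    ENNReal.ofReal (δ ^ (2 * d)) *
      (ENNReal.ofReal (kernel ε x y) * ENNReal.ofReal (kernel ε x z)) ≤ majorant x y z := by
  rw [← ENNReal.ofReal_mul kernel_nonneg, ← ENNReal.ofReal_mul (by positivity)]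
  refine ENNReal.ofReal_le_ofReal ?_
  rcases le_total ‖x - y‖ ‖x - z‖ with hle | hle
  · rw [max_eq_right hle]
    exact pow_mul_kernel_mul_kernel_le_inv_norm_pow hδ hy hz_pos
  · rw [max_eq_left hle, mul_comm (kernel ε x y)]
    exact pow_mul_kernel_mul_kernel_le_inv_norm_pow hδ hz hy_pos

lemma kernelAvgGrad_sq_le [IsFiniteMeasure σ] [NeZero σ] (hd : 1 ≤ d) (hφ : Integrable φ σ)
    (hδ : 0 < δ) (hε : |ε| ≤ δ) (h : ∀ᵐ y ∂σ, δ ^ 2 ≤ ‖x - y‖ ^ 2 + ε ^ 2)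
    (hpos : ∀ᵐ y ∂σ, 0 < ‖x - y‖) {p : Eu d} (hp : ‖x - p‖ ≤ δ) {c : ℝ}
    (hσ : ENNReal.ofReal (c * δ ^ (d - 1)) ≤ σ (Metric.ball p δ)) :
    ENNReal.ofReal (c / 5 ^ d) ^ 2 * ‖kernelAvgGrad σ φ ε x‖ₑ ^ 2 ≤
      ENNReal.ofReal (2 * d) ^ 2 * ∫⁻ y, ∫⁻ z, ‖φ y - φ z‖ₑ ^ 2 * majorant x y z ∂σ ∂σ := by
  set J := ∫⁻ y, ∫⁻ z, ‖φ y - φ z‖ₑ ^ 2 *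
    (ENNReal.ofReal (kernel ε x y) * ENNReal.ofReal (kernel ε x z)) ∂σ ∂σ with hJ
  calc ENNReal.ofReal (c / 5 ^ d) ^ 2 * ‖kernelAvgGrad σ φ ε x‖ₑ ^ 2
      ≤ (ENNReal.ofReal (δ ^ (d + 1)) * ENNReal.ofReal (kernelInt σ 1 ε x)) ^ 2 *
          ‖kernelAvgGrad σ φ ε x‖ₑ ^ 2 := by
        gcongr
        exact le_pow_mul_kernelInt hd hδ hε h hp hσ
    _ = ENNReal.ofReal (δ ^ (d + 1)) ^ 2 * (ENNReal.ofReal (kernelInt σ 1 ε x) ^ 2 *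
          ‖kernelAvgGrad σ φ ε x‖ₑ ^ 2) := by ring
    _ ≤ ENNReal.ofReal (δ ^ (d + 1)) ^ 2 * (ENNReal.ofReal (2 * d / δ) ^ 2 * J) := by
        exact mul_le_mul_right (kernelInt_sq_mul_kernelAvgGrad_sq_le hφ hδ h) _
    _ = ENNReal.ofReal (2 * d) ^ 2 * (ENNReal.ofReal (δ ^ (2 * d)) * J) := by
        rw [← mul_assoc, ← mul_assoc, ← ENNReal.ofReal_pow (by positivity),
          ← ENNReal.ofReal_pow (by positivity), ← ENNReal.ofReal_pow (by positivity),
          ← ENNReal.ofReal_mul (by positivity), ← ENNReal.ofReal_mul (by positivity)]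
        congr 2
        field_simp
        ring
    _ ≤ _ := by
        gcongr
        rw [hJ, ← lintegral_const_mul' _ _ ENNReal.ofReal_ne_top]
        refine lintegral_mono_ae ?_
        filter_upwards [h, hpos] with y hy hy_pos
        rw [← lintegral_const_mul' _ _ ENNReal.ofReal_ne_top]
        refine lintegral_mono_ae ?_
        filter_upwards [h, hpos] with z hz hz_pos
        rw [mul_left_comm]
        gcongr
        exact pow_mul_kernel_mul_kernel_le_majorant hδ hy hz hy_pos hz_pos

end KernelEstimates

section Majorant

lemma inv_max_norm_pow_le (n : ℕ) {E : Type*} [NormedAddCommGroup E] [NormedSpace ℝ E] {y z : E}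
    {ρ : ℝ} (hρ : 0 < ρ) (hyz : 2 * ρ = dist y z) (x : E) :
    (max ‖x - y‖ ‖x - z‖ ^ n)⁻¹ ≤ 2 ^ n * (ρ ^ n)⁻¹ * ((1 + ‖ρ⁻¹ • (x - y)‖) ^ n)⁻¹ := by
  have two_mul_le : 2 * ρ ≤ ‖x - y‖ + ‖x - z‖ := by
    rw [hyz, ← dist_eq_norm, ← dist_eq_norm, dist_comm x y]
    exact dist_triangle y x z
  have half_add_le_max : (ρ + ‖x - y‖) / 2 ≤ max ‖x - y‖ ‖x - z‖ := by
    linarith [le_max_left ‖x - y‖ ‖x - z‖, le_max_right ‖x - y‖ ‖x - z‖]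
  have one_add_norm_smul : 1 + ‖ρ⁻¹ • (x - y)‖ = (ρ + ‖x - y‖) / ρ := by
    rw [norm_smul, norm_inv, Real.norm_of_nonneg hρ.le]
    field_simp
  calc (max ‖x - y‖ ‖x - z‖ ^ n)⁻¹ ≤ (((ρ + ‖x - y‖) / 2) ^ n)⁻¹ := by gcongr
    _ = 2 ^ n * (ρ ^ n)⁻¹ * ((1 + ‖ρ⁻¹ • (x - y)‖) ^ n)⁻¹ := by
        rw [one_add_norm_smul, div_pow, div_pow]
        field_simp

lemma integrable_inv_one_add_norm_pow {E : Type*} [NormedAddCommGroup E] [NormedSpace ℝ E]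
    [FiniteDimensional ℝ E] [MeasurableSpace E] [BorelSpace E] (μ : Measure E)
    [μ.IsAddHaarMeasure] {n : ℕ} (hn : Module.finrank ℝ E < n) :
    Integrable (fun x : E => ((1 + ‖x‖) ^ n)⁻¹) μ := by
  refine (integrable_one_add_norm (μ := μ) (r := n) (by exact_mod_cast hn)).congr
    (Eventually.of_forall fun x => ?_)
  simp only
  rw [Real.rpow_neg (by positivity), Real.rpow_natCast]

lemma lintegral_inv_one_add_norm_smul_sub_pow {E : Type*} [NormedAddCommGroup E]
    [NormedSpace ℝ E] [FiniteDimensional ℝ E] [MeasurableSpace E] [BorelSpace E] (μ : Measure E)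
    [μ.IsAddHaarMeasure] {n : ℕ} (hn : Module.finrank ℝ E < n) {ρ : ℝ} (hρ : 0 < ρ) (y : E) :
    ∫⁻ x, ENNReal.ofReal (((1 + ‖ρ⁻¹ • (x - y)‖) ^ n)⁻¹) ∂μ =
      ENNReal.ofReal (ρ ^ Module.finrank ℝ E * ∫ x, ((1 + ‖x‖) ^ n)⁻¹ ∂μ) := by
  have integrable_smul := (integrable_inv_one_add_norm_pow μ hn).comp_smul (inv_ne_zero hρ.ne')
  rw [lintegral_sub_right_eq_self (μ := μ)
      (fun x : E => ENNReal.ofReal (((1 + ‖ρ⁻¹ • x‖) ^ n)⁻¹)) y,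
    ← ofReal_integral_eq_lintegral_ofReal integrable_smul
      (Eventually.of_forall fun x => by positivity),
    Measure.integral_comp_smul μ (fun x : E => ((1 + ‖x‖) ^ n)⁻¹) ρ⁻¹,
    inv_pow, inv_inv, abs_of_pos (by positivity), smul_eq_mul]

lemma exists_lintegral_majorant_le (hd : 1 ≤ d) : ∃ C : ENNReal, C ≠ ⊤ ∧ ∀ y z : Eu d, y ≠ z →
    ∫⁻ x, majorant x y z ≤ C * ENNReal.ofReal ((dist y z ^ d)⁻¹) := by
  have finrank_lt : Module.finrank ℝ (Eu d) < 2 * d := by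
    rw [finrank_euclideanSpace_fin]
    omega
  set I := ∫ x : Eu d, ((1 + ‖x‖) ^ (2 * d))⁻¹
  refine ⟨ENNReal.ofReal (8 ^ d * I), ENNReal.ofReal_ne_top, fun y z hyz => ?_⟩
  obtain ⟨ρ, hρ⟩ : ∃ ρ, 2 * ρ = dist y z := ⟨dist y z / 2, by ring⟩
  have hρ_pos : 0 < ρ := by linarith [dist_pos.2 hyz]
  calc ∫⁻ x, majorant x y z
      ≤ ∫⁻ x, ENNReal.ofReal (2 ^ (2 * d) * (ρ ^ (2 * d))⁻¹) *
          ENNReal.ofReal (((1 + ‖ρ⁻¹ • (x - y)‖) ^ (2 * d))⁻¹) := by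
        refine lintegral_mono fun x => ?_
        rw [← ENNReal.ofReal_mul (by positivity)]
        exact ENNReal.ofReal_le_ofReal (inv_max_norm_pow_le (2 * d) hρ_pos hρ x)
    _ = ENNReal.ofReal (2 ^ (2 * d) * (ρ ^ (2 * d))⁻¹ * (ρ ^ d * I)) := by
        rw [lintegral_const_mul' _ _ ENNReal.ofReal_ne_top,
          lintegral_inv_one_add_norm_smul_sub_pow volume finrank_lt hρ_pos,
          finrank_euclideanSpace_fin, ENNReal.ofReal_mul (by positivity) (p := 2 ^ (2 * d) * _)]
    _ = ENNReal.ofReal (8 ^ d * I) * ENNReal.ofReal ((dist y z ^ d)⁻¹) := by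
        rw [← ENNReal.ofReal_mul' (by positivity), ← hρ, pow_mul, mul_pow,
          show (8 : ℝ) = 2 ^ 2 * 2 by norm_num, mul_pow, two_mul d, pow_add]
        field_simp

end Majorant

section GagliardoSeminorm

/-- The squared Gagliardo seminorm of order `1/2` with respect to a measure `σ` on `ℝ^d` of
dimension `d - 1`, such as a surface measure. -/
def gagliardo (σ : Measure (Eu d)) (φ : Eu d → ℝ) : ENNReal :=
  ∫⁻ x, ∫⁻ y, ‖φ x - φ y‖ₑ ^ 2 * ENNReal.ofReal ((dist x y ^ d)⁻¹) ∂σ ∂σ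

lemma ofReal_sq_div_eq (a b : ℝ) :
    ENNReal.ofReal (a ^ 2 / b) = ‖a‖ₑ ^ 2 * ENNReal.ofReal b⁻¹ := by
  rw [div_eq_mul_inv, ENNReal.ofReal_mul (sq_nonneg a), ← ofReal_norm,
    ← ENNReal.ofReal_pow (norm_nonneg _), Real.norm_eq_abs, sq_abs]

lemma mem_HHalfBoundary_iff {φ : L2Boundary D} :
    φ ∈ HHalfBoundary D ↔ gagliardo (surfaceMeasure D) φ < ⊤ := by
  simp only [HHalfBoundary, gagliardo, Set.mem_ofPred_eq, ofReal_sq_div_eq]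

end GagliardoSeminorm

section KernelConvergence

variable {σ : Measure (Eu d)} {φ : Eu d → ℝ} {x : Eu d} {r : ℝ} {e : ℕ → ℝ}

lemma ae_sq_le_norm_sub_sq_add_sq (hr : 0 < r) (h : ∀ᵐ y ∂σ, r ≤ ‖x - y‖) (ε : ℝ) :
    ∀ᵐ y ∂σ, r ^ 2 ≤ ‖x - y‖ ^ 2 + ε ^ 2 := by
  filter_upwards [h] with y hy
  exact le_add_of_le_of_nonneg (by gcongr) (sq_nonneg ε)

lemma tendsto_kernelInt (hφ : Integrable φ σ) (hr : 0 < r) (h : ∀ᵐ y ∂σ, r ≤ ‖x - y‖)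
    (he : Tendsto e atTop (𝓝 0)) :
    Tendsto (fun k => kernelInt σ φ (e k) x) atTop (𝓝 (kernelInt σ φ 0 x)) := by
  have hr_le := ae_sq_le_norm_sub_sq_add_sq hr h
  refine tendsto_integral_of_dominated_convergence (fun y => ‖φ y‖ * ((r ^ 2) ^ d)⁻¹)
    (fun k => (integrable_mul_kernel hφ hr (hr_le _)).1) (hφ.norm.mul_const _) (fun k => ?_) ?_
  · filter_upwards [hr_le (e k)] with y hy
    rw [norm_mul, Real.norm_of_nonneg kernel_nonneg]
    gcongr
    exact kernel_le hr hy
  · filter_upwards [h] with y hy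
    have norm_pos : 0 < ‖x - y‖ := hr.trans_le hy
    have continuousAt_kernel : ContinuousAt (fun ε : ℝ => φ y * kernel ε x y) 0 := by
      unfold kernel
      exact continuousAt_const.mul (ContinuousAt.inv₀ (by fun_prop) (by positivity))
    exact continuousAt_kernel.tendsto.comp he

lemma tendsto_kernelIntGrad (hφ : Integrable φ σ) (hr : 0 < r) (h : ∀ᵐ y ∂σ, r ≤ ‖x - y‖)
    (he : Tendsto e atTop (𝓝 0)) :
    Tendsto (fun k => kernelIntGrad σ φ (e k) x) atTop (𝓝 (kernelIntGrad σ φ 0 x)) := by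
  have hr_le := ae_sq_le_norm_sub_sq_add_sq hr h
  refine tendsto_integral_of_dominated_convergence
    (fun y => ‖φ y‖ * (2 * d / r * ((r ^ 2) ^ d)⁻¹))
    (fun k => (integrable_smul_kernelGrad hφ hr (hr_le _)).1) (hφ.norm.mul_const _)
    (fun k => ?_) ?_
  · filter_upwards [hr_le (e k)] with y hy
    rw [norm_smul]
    gcongr
    refine (norm_kernelGrad_le hr hy).trans ?_
    gcongr
    exact kernel_le hr hy
  · filter_upwards [h] with y hy
    have norm_pos : 0 < ‖x - y‖ := hr.trans_le hy
    have continuousAt_kernelGrad : ContinuousAt (fun ε : ℝ => φ y • kernelGrad ε x y) 0 := by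
      have continuousAt_inv :
          ContinuousAt (fun ε : ℝ => ((‖x - y‖ ^ 2 + ε ^ 2) ^ (d + 1))⁻¹) 0 :=
        ContinuousAt.inv₀ (by fun_prop) (by positivity)
      unfold kernelGrad
      fun_prop
    exact continuousAt_kernelGrad.tendsto.comp he

variable [IsFiniteMeasure σ] [NeZero σ]

lemma tendsto_kernelAvg (hφ : Integrable φ σ) (hr : 0 < r) (h : ∀ᵐ y ∂σ, r ≤ ‖x - y‖)
    (he : Tendsto e atTop (𝓝 0)) :
    Tendsto (fun k => kernelAvg σ φ (e k) x) atTop (𝓝 (kernelAvg σ φ 0 x)) :=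
  (tendsto_kernelInt hφ hr h he).div
    (tendsto_kernelInt (φ := 1) (integrable_const 1) hr h he)
    (kernelInt_one_pos hr (ae_sq_le_norm_sub_sq_add_sq hr h 0)).ne'

lemma tendsto_kernelAvgGrad (hφ : Integrable φ σ) (hr : 0 < r) (h : ∀ᵐ y ∂σ, r ≤ ‖x - y‖)
    (he : Tendsto e atTop (𝓝 0)) :
    Tendsto (fun k => kernelAvgGrad σ φ (e k) x) atTop (𝓝 (kernelAvgGrad σ φ 0 x)) :=
  ((tendsto_kernelInt (φ := 1) (integrable_const 1) hr h he).inv₀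
    (kernelInt_one_pos hr (ae_sq_le_norm_sub_sq_add_sq hr h 0)).ne').smul
    ((tendsto_kernelIntGrad hφ hr h he).sub ((tendsto_kernelAvg hφ hr h he).smul
      (tendsto_kernelIntGrad (φ := 1) (integrable_const 1) hr h he)))

end KernelConvergence

section LowerRegularExtension

variable {σ : Measure (Eu d)} {φ : Eu d → ℝ} {K U : Set (Eu d)} {c ε : ℝ} {x z : Eu d}

lemma pow_mul_kernel_le (hε : 0 < ε) (hxz : x ≠ z) :
    ε ^ d * kernel ε x z ≤ (dist x z ^ d)⁻¹ := by
  have norm_pos : 0 < ‖x - z‖ := norm_pos_iff.2 (sub_ne_zero.2 hxz)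
  rw [kernel, dist_eq_norm, ← div_eq_mul_inv, div_le_iff₀ (by positivity), ← inv_pow, ← mul_pow]
  gcongr
  rw [inv_mul_eq_div, le_div_iff₀ norm_pos]
  nlinarith [sq_nonneg (ε - ‖x - z‖), sq_nonneg ε, sq_nonneg ‖x - z‖]

lemma ofReal_mul_sub_kernelAvg_sq_le [IsFiniteMeasure σ] [NeZero σ] (hd : 1 ≤ d)
    (hφ : Integrable φ σ) (hε : 0 < ε)
    (hσ : ENNReal.ofReal (c * ε ^ (d - 1)) ≤ σ (Metric.ball x ε)) :
    ENNReal.ofReal (c / 5 ^ d) * ‖φ x - kernelAvg σ φ ε x‖ₑ ^ 2 ≤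
      ENNReal.ofReal ε *
        ∫⁻ z, ‖φ x - φ z‖ₑ ^ 2 * ENNReal.ofReal ((dist x z ^ d)⁻¹) ∂σ := by
  have hε_le : ∀ᵐ y ∂σ, ε ^ 2 ≤ ‖x - y‖ ^ 2 + ε ^ 2 :=
    Eventually.of_forall (sq_le_norm_sub_sq_add_sq ε x)
  calc ENNReal.ofReal (c / 5 ^ d) * ‖φ x - kernelAvg σ φ ε x‖ₑ ^ 2
      ≤ (ENNReal.ofReal (ε ^ (d + 1)) * ENNReal.ofReal (kernelInt σ 1 ε x)) *
          ‖φ x - kernelAvg σ φ ε x‖ₑ ^ 2 := by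
        gcongr
        exact le_pow_mul_kernelInt hd hε (abs_of_pos hε).le hε_le (by simpa using hε.le) hσ
    _ = ENNReal.ofReal (ε ^ (d + 1)) * (ENNReal.ofReal (kernelInt σ 1 ε x) *
          ‖φ x - kernelAvg σ φ ε x‖ₑ ^ 2) := mul_assoc _ _ _
    _ ≤ ENNReal.ofReal (ε ^ (d + 1)) *
          ∫⁻ z, ‖φ x - φ z‖ₑ ^ 2 * ENNReal.ofReal (kernel ε x z) ∂σ :=
        mul_le_mul_right (kernelInt_mul_sub_kernelAvg_sq_le hφ hε hε_le (φ x)) _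
    _ = ENNReal.ofReal ε * ∫⁻ z, ENNReal.ofReal (ε ^ d) *
          (‖φ x - φ z‖ₑ ^ 2 * ENNReal.ofReal (kernel ε x z)) ∂σ := by
        rw [lintegral_const_mul' _ _ ENNReal.ofReal_ne_top, ← mul_assoc,
          ← ENNReal.ofReal_mul hε.le, pow_succ']
    _ ≤ _ := by
        refine mul_le_mul_right (lintegral_mono fun z => ?_) _
        rcases eq_or_ne x z with rfl | hxz
        · simp
        rw [mul_left_comm, ← ENNReal.ofReal_mul (by positivity)]
        gcongr
        exact pow_mul_kernel_le hε hxz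

lemma exists_lintegral_kernelAvg_sub_sq_le [IsFiniteMeasure σ] [NeZero σ] (hd : 1 ≤ d)
    (hσK : ∀ᵐ y ∂σ, y ∈ K) {M : ℝ} (hreg : IsLowerRegularOn σ (d - 1) M K) :
    ∃ C : ENNReal, C ≠ ⊤ ∧ ∀ φ : Eu d → ℝ, Integrable φ σ → ∀ ε : ℝ, 0 < ε → ε ≤ M →
      ∫⁻ x, ‖kernelAvg σ φ ε x - φ x‖ₑ ^ 2 ∂σ ≤ C * (ENNReal.ofReal ε * gagliardo σ φ) := by
  obtain ⟨c, hc, hball⟩ := hreg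
  have const_ne_zero : ENNReal.ofReal (c / 5 ^ d) ≠ 0 :=
    (ENNReal.ofReal_pos.2 (by positivity)).ne'
  refine ⟨(ENNReal.ofReal (c / 5 ^ d))⁻¹, ENNReal.inv_ne_top.2 const_ne_zero,
    fun φ hφ ε hε hεM => ?_⟩
  rw [← ENNReal.mul_le_iff_le_inv const_ne_zero ENNReal.ofReal_ne_top, gagliardo,
    ← lintegral_const_mul' _ _ ENNReal.ofReal_ne_top,
    ← lintegral_const_mul' _ _ ENNReal.ofReal_ne_top]
  refine lintegral_mono_ae ?_
  filter_upwards [hσK] with x hx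
  rw [← enorm_neg, neg_sub]
  exact ofReal_mul_sub_kernelAvg_sq_le hd hφ hε (hball x hx ε hε hεM)

lemma exists_mem_ae_norm_sub_le [NeZero σ] (hK : IsCompact K) (hσK : ∀ᵐ y ∂σ, y ∈ K)
    (hx : x ∉ K) : ∃ p ∈ K, 0 < ‖x - p‖ ∧ ∀ᵐ y ∂σ, ‖x - p‖ ≤ ‖x - y‖ := by
  obtain ⟨p, hpK, hp⟩ := hK.exists_infDist_eq_dist hσK.exists x
  refine ⟨p, hpK, norm_pos_iff.2 (sub_ne_zero.2 fun h => hx (h ▸ hpK)), ?_⟩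
  filter_upwards [hσK] with y hy
  rw [← dist_eq_norm, ← dist_eq_norm, ← hp]
  exact Metric.infDist_le_dist_of_mem hy

-- The nearest point `p` of `K` provides the mass of the kernel near `x`, at the scale
-- `δ = √(|x - p|² + ε²)`.
lemma exists_kernelAvgGrad_sq_le [IsFiniteMeasure σ] [NeZero σ] (hd : 1 ≤ d) (hK : IsCompact K)
    (hσK : ∀ᵐ y ∂σ, y ∈ K) (hreg : ∀ M, IsLowerRegularOn σ (d - 1) M K)
    (hU : Bornology.IsBounded U) (hUK : Disjoint U K) :
    ∃ C : ENNReal, C ≠ ⊤ ∧ ∀ φ : Eu d → ℝ, Integrable φ σ → ∀ x ∈ U, ∀ ε : ℝ, |ε| ≤ 1 →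
      ‖kernelAvgGrad σ φ ε x‖ₑ ^ 2 ≤
        C * ∫⁻ y, ∫⁻ z, ‖φ y - φ z‖ₑ ^ 2 * majorant x y z ∂σ ∂σ := by
  obtain ⟨M, hM_pos, hM⟩ := (hU.union hK.isBounded).exists_pos_norm_le
  obtain ⟨c, hc, hball⟩ := hreg (2 * M + 1)
  have const_ne_zero : ENNReal.ofReal (c / 5 ^ d) ^ 2 ≠ 0 :=
    pow_ne_zero 2 (ENNReal.ofReal_pos.2 (by positivity)).ne'
  refine ⟨(ENNReal.ofReal (c / 5 ^ d) ^ 2)⁻¹ * ENNReal.ofReal (2 * d) ^ 2,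
    ENNReal.mul_ne_top (ENNReal.inv_ne_top.2 const_ne_zero) (by finiteness),
    fun φ hφ x hx ε hε => ?_⟩
  obtain ⟨p, hpK, hxp_pos, hxp_le⟩ :=
    exists_mem_ae_norm_sub_le hK hσK (hUK.notMem_of_mem_left hx)
  have norm_le : ‖x - p‖ ≤ 2 * M := by
    linarith [norm_sub_le x p, hM x (Or.inl hx), hM p (Or.inr hpK)]
  set δ := √(‖x - p‖ ^ 2 + ε ^ 2)
  have sq_δ : δ ^ 2 = ‖x - p‖ ^ 2 + ε ^ 2 := Real.sq_sqrt (by positivity)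
  have δ_pos : 0 < δ := Real.sqrt_pos.2 (by positivity)
  have δ_le : δ ≤ 2 * M + 1 := by
    refine Real.sqrt_le_iff.2 ⟨by positivity, ?_⟩
    nlinarith [sq_abs ε, abs_nonneg ε, norm_nonneg (x - p)]
  rw [mul_assoc, ← ENNReal.mul_le_iff_le_inv const_ne_zero (by finiteness)]
  refine kernelAvgGrad_sq_le hd hφ δ_pos ?_ ?_ ?_ ?_ (hball p hpK δ δ_pos δ_le)
  · exact Real.abs_le_sqrt (by linarith [sq_nonneg ‖x - p‖])
  · filter_upwards [hxp_le] with y hy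
    rw [sq_δ]
    gcongr
  · filter_upwards [hxp_le] with y hy using hxp_pos.trans_le hy
  · exact Real.le_sqrt_of_sq_le (by linarith [sq_nonneg ε])

lemma lintegral_lintegral_majorant_lt_top [SFinite σ] (hd : 1 ≤ d) (hm : Measurable φ)
    (hφ : gagliardo σ φ < ⊤) :
    ∫⁻ x, ∫⁻ y, ∫⁻ z, ‖φ y - φ z‖ₑ ^ 2 * majorant x y z ∂σ ∂σ < ⊤ := by
  obtain ⟨C, hC, hle⟩ := exists_lintegral_majorant_le hd
  have measurable_integrand {α : Type _} [MeasurableSpace α] {f g h : α → Eu d}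
      (hf : Measurable f) (hg : Measurable g) (hh : Measurable h) :
      Measurable fun q => ‖φ (g q) - φ (h q)‖ₑ ^ 2 * majorant (f q) (g q) (h q) :=
    (((hm.comp hg).sub (hm.comp hh)).enorm.pow_const 2).mul (measurable_majorant hf hg hh)
  have measurable_inner : Measurable fun q : Eu d × Eu d =>
      ∫⁻ z, ‖φ q.2 - φ z‖ₑ ^ 2 * majorant q.1 q.2 z ∂σ :=
    Measurable.lintegral_prod_right' (f := fun q : (Eu d × Eu d) × Eu d =>
      ‖φ q.1.2 - φ q.2‖ₑ ^ 2 * majorant q.1.1 q.1.2 q.2)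
      (measurable_integrand measurable_fst.fst measurable_fst.snd measurable_snd)
  rw [lintegral_lintegral_swap measurable_inner.aemeasurable]
  refine lt_of_le_of_lt ?_ (ENNReal.mul_lt_top hC.lt_top hφ)
  rw [gagliardo, ← lintegral_const_mul' _ _ hC]
  refine lintegral_mono fun y => ?_
  rw [lintegral_lintegral_swap
    (measurable_integrand measurable_fst measurable_const measurable_snd).aemeasurable,
    ← lintegral_const_mul' _ _ hC]
  refine lintegral_mono fun z => ?_
  rcases eq_or_ne y z with rfl | hyz
  · simp
  rw [lintegral_const_mul' _ _ (by finiteness), mul_left_comm]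
  gcongr
  exact hle y z hyz

lemma ae_restrict_tendsto_kernelAvgGrad [IsFiniteMeasure σ] [NeZero σ] (hK : IsCompact K)
    (hσK : ∀ᵐ y ∂σ, y ∈ K) (hUm : MeasurableSet U) (hUK : Disjoint U K) (hφ : Integrable φ σ)
    {e : ℕ → ℝ} (he : Tendsto e atTop (𝓝 0)) :
    ∀ᵐ x ∂(volume.restrict U),
      Tendsto (fun k => kernelAvgGrad σ φ (e k) x) atTop (𝓝 (kernelAvgGrad σ φ 0 x)) := by
  filter_upwards [ae_restrict_mem hUm] with x hx
  obtain ⟨p, -, hp_pos, hp⟩ := exists_mem_ae_norm_sub_le hK hσK (hUK.notMem_of_mem_left hx)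
  exact tendsto_kernelAvgGrad hφ hp_pos hp he

lemma gradient_kernelAvg [IsFiniteMeasure σ] [NeZero σ] (hφ : Integrable φ σ) (hε : 0 < ε) :
    gradient (kernelAvg σ φ ε) = kernelAvgGrad σ φ ε :=
  funext fun x => (hasGradientAt_kernelAvg hφ hε x).gradient

lemma continuous_kernelAvgGrad [IsFiniteMeasure σ] [NeZero σ] (hK : Bornology.IsBounded K)
    (hσK : ∀ᵐ y ∂σ, y ∈ K) (hφ : Integrable φ σ) (hε : 0 < ε) :
    Continuous (kernelAvgGrad σ φ ε) := by
  rw [← gradient_kernelAvg hφ hε]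
  exact continuous_gradient ((contDiff_kernelAvg hK hσK hφ hε).of_le (by simp))

lemma tendsto_setLIntegral_kernelAvgGrad_sub_sq [IsFiniteMeasure σ] [NeZero σ] (hd : 1 ≤ d)
    (hK : IsCompact K) (hσK : ∀ᵐ y ∂σ, y ∈ K) (hreg : ∀ M, IsLowerRegularOn σ (d - 1) M K)
    (hUm : MeasurableSet U) (hU : Bornology.IsBounded U) (hUK : Disjoint U K)
    (hm : Measurable φ) (hφ : Integrable φ σ) (hφ' : gagliardo σ φ < ⊤) {e : ℕ → ℝ}
    (he_pos : ∀ k, 0 < e k) (he_le : ∀ k, e k ≤ 1) (he : Tendsto e atTop (𝓝 0)) :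
    Tendsto (fun k => ∫⁻ x in U, ‖kernelAvgGrad σ φ (e k) x - kernelAvgGrad σ φ 0 x‖ₑ ^ 2)
      atTop (𝓝 0) := by
  obtain ⟨C, hC, hbound⟩ := exists_kernelAvgGrad_sq_le hd hK hσK hreg hU hUK
  set F : Eu d → ENNReal := fun x =>
    C * ∫⁻ y, ∫⁻ z, ‖φ y - φ z‖ₑ ^ 2 * majorant x y z ∂σ ∂σ
  have lintegral_F_ne_top : ∫⁻ x in U, 4 * F x ≠ ⊤ := by
    refine ((setLIntegral_le_lintegral _ _).trans_lt ?_).ne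
    rw [lintegral_const_mul' _ _ (by norm_num), lintegral_const_mul' _ _ hC]
    exact ENNReal.mul_lt_top (by norm_num)
      (ENNReal.mul_lt_top hC.lt_top (lintegral_lintegral_majorant_lt_top hd hm hφ'))
  have aesm (k) : AEStronglyMeasurable (kernelAvgGrad σ φ (e k)) (volume.restrict U) :=
    (continuous_kernelAvgGrad hK.isBounded hσK hφ (he_pos k)).aestronglyMeasurable
  have tendsto_grad := ae_restrict_tendsto_kernelAvgGrad hK hσK hUm hUK hφ he
  have aesm_lim := aestronglyMeasurable_of_tendsto_ae atTop aesm tendsto_grad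
  rw [← lintegral_zero (μ := volume.restrict U)]
  refine tendsto_lintegral_of_dominated_convergence' (fun x => 4 * F x)
    (fun k => ((aesm k).sub aesm_lim).enorm.pow_const 2) (fun k => ?_) lintegral_F_ne_top ?_
  · filter_upwards [ae_restrict_mem hUm] with x hx
    calc ‖kernelAvgGrad σ φ (e k) x - kernelAvgGrad σ φ 0 x‖ₑ ^ 2 ≤ 2 * (F x + F x) := by
          refine (pow_le_pow_left' enorm_sub_le 2).trans ((ennreal_add_sq_le _ _).trans ?_)
          gcongr
          · exact hbound φ hφ x hx (e k) ((abs_of_pos (he_pos k)).trans_le (he_le k))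
          · exact hbound φ hφ x hx 0 (by simp)
      _ = 4 * F x := by ring
  · filter_upwards [tendsto_grad] with x hx
    simpa [Function.comp_def] using ((ENNReal.continuous_pow 2).tendsto _).comp
      (hx.sub_const (kernelAvgGrad σ φ 0 x)).enorm

end LowerRegularExtension

section TraceExtension

lemma isGradientCauchy_of_tendsto_gradient (hD : IsOpen D) (hDb : Bornology.IsBounded D)
    {w : ℕ → Eu d → ℝ} (hw : ∀ k, ContDiff ℝ 1 (w k)) {V : Eu d → Eu d}
    (hVm : AEStronglyMeasurable V (volume.restrict D))
    (hV : Tendsto (fun k => ∫⁻ x in D, ‖gradient (w k) x - V x‖ₑ ^ 2) atTop (𝓝 0)) :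
    IsGradientCauchy D w := by
  have isWeakGradient (k) := isWeakGradient_gradient hDb (hw k)
  have memLp (k) := (mem_H1_of_contDiff hDb (hw k)).1
  have aemeasurable_sq (k) :
      AEMeasurable (fun x => ‖gradient (w k) x - V x‖ₑ ^ 2) (volume.restrict D) :=
    ((continuous_gradient (hw k)).aestronglyMeasurable.sub hVm).enorm.pow_const 2
  intro ε hε
  have ε_div_pos : 0 < ε / 4 := ENNReal.div_pos hε.ne' (by norm_num)
  obtain ⟨N, hN⟩ := eventually_atTop.1 (ENNReal.tendsto_nhds_zero.1 hV (ε / 4) ε_div_pos)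
  refine ⟨N, fun m hm n hn => ?_⟩
  calc ∫⁻ x in D, ‖weakGrad D (w m - w n) x‖ₑ ^ 2
      = ∫⁻ x in D, ‖gradient (w m) x - gradient (w n) x‖ₑ ^ 2 := by
        refine lintegral_congr_ae ?_
        filter_upwards [((isWeakGradient m).sub (memLp m) (memLp n)
          (isWeakGradient n)).weakGrad_ae_eq hD] with x hx
        rw [hx, Pi.sub_apply]
    _ ≤ ∫⁻ x in D, 2 * (‖gradient (w m) x - V x‖ₑ ^ 2 + ‖gradient (w n) x - V x‖ₑ ^ 2) := by
        refine lintegral_mono fun x => ?_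
        rw [← sub_sub_sub_cancel_right _ _ (V x)]
        exact (pow_le_pow_left' enorm_sub_le 2).trans (ennreal_add_sq_le _ _)
    _ ≤ 2 * (ε / 4 + ε / 4) := by
        rw [lintegral_const_mul' _ _ ENNReal.ofNat_ne_top, lintegral_add_left' (aemeasurable_sq m)]
        exact mul_le_mul_right (add_le_add (hN m hm) (hN n hn)) 2
    _ = ε := by
        rw [← two_mul, ← mul_assoc, show (2 : ENNReal) * 2 = 4 by norm_num]
        exact ENNReal.mul_div_cancel (by norm_num) (by norm_num)

lemma hasTrace_zero_of_surfaceMeasure_eq_zero (hD : IsOpen D) (hDb : Bornology.IsBounded D)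
    (hσ : surfaceMeasure D = 0) (φ : L2Boundary D) : HasTrace D 0 φ := by
  refine ⟨mem_H1_of_contDiff hDb contDiff_const, fun _ => 0, fun _ => contDiff_const, ?_, ?_, ?_⟩
  · simp
  · simp [eLpNorm_congr_ae (weakGrad_zero_ae_eq hD)]
  · simp [hσ]

lemma IsLipschitzBoundedDomain.isGradientCauchy_kernelAvg (hd : 1 ≤ d)
    (hD : IsLipschitzBoundedDomain D) [NeZero (surfaceMeasure D)] {φ : L2Boundary D}
    (hφ : gagliardo (surfaceMeasure D) φ < ⊤) {e : ℕ → ℝ} (he : ∀ k, 0 < e k)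
    (he_le : ∀ k, e k ≤ 1) (hlim : Tendsto e atTop (𝓝 0)) :
    IsGradientCauchy D fun k => kernelAvg (surfaceMeasure D) φ (e k) := by
  have : IsFiniteMeasure (surfaceMeasure D) := hD.isFiniteMeasure
  have integrable_φ : Integrable φ (surfaceMeasure D) := (Lp.memLp φ).integrable one_le_two
  have disjoint_frontier : Disjoint D (frontier D) :=
    (disjoint_frontier_iff_isOpen.2 hD.isOpen).symm
  have hDm := hD.isOpen.measurableSet
  have hK := hD.isCompact_frontier
  have contDiff_avg (k) : ContDiff ℝ 1 (kernelAvg (surfaceMeasure D) φ (e k)) :=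
    (contDiff_kernelAvg hK.isBounded ae_mem_frontier integrable_φ (he k)).of_le (by simp)
  have aestronglyMeasurable_grad :
      AEStronglyMeasurable (kernelAvgGrad (surfaceMeasure D) φ 0) (volume.restrict D) :=
    aestronglyMeasurable_of_tendsto_ae atTop
      (fun k => (continuous_kernelAvgGrad hK.isBounded ae_mem_frontier integrable_φ
        (he k)).aestronglyMeasurable)
      (ae_restrict_tendsto_kernelAvgGrad hK ae_mem_frontier hDm disjoint_frontier integrable_φ hlim)
  refine isGradientCauchy_of_tendsto_gradient hD.isOpen hD.isBounded contDiff_avg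
    aestronglyMeasurable_grad ?_
  simp only [gradient_kernelAvg integrable_φ (he _)]
  exact tendsto_setLIntegral_kernelAvgGrad_sub_sq hd hK ae_mem_frontier
    hD.isLowerRegularOn_frontier hDm hD.isBounded disjoint_frontier
    (Lp.stronglyMeasurable φ).measurable integrable_φ hφ he he_le hlim

lemma IsLipschitzBoundedDomain.hasTrace_kernelAvg (hd : 1 ≤ d)
    (hD : IsLipschitzBoundedDomain D) [NeZero (surfaceMeasure D)] {φ : L2Boundary D}
    (hφ : gagliardo (surfaceMeasure D) φ < ⊤) :
    HasTrace D (kernelAvg (surfaceMeasure D) φ 0) φ := by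
  set σ := surfaceMeasure D
  have : IsFiniteMeasure σ := hD.isFiniteMeasure
  have integrable_φ : Integrable φ σ := (Lp.memLp φ).integrable one_le_two
  let e : ℕ → ℝ := fun k => 1 / ((k : ℝ) + 1)
  have e_pos (k) : 0 < e k := by positivity
  have e_le (k) : e k ≤ 1 := (div_le_one (by positivity)).2 (by linarith [k.cast_nonneg (α := ℝ)])
  have tendsto_e : Tendsto e atTop (𝓝 0) := tendsto_one_div_add_atTop_nhds_zero_nat
  have contDiff_avg (k) : ContDiff ℝ ∞ (kernelAvg σ φ (e k)) :=
    contDiff_kernelAvg hD.isCompact_frontier.isBounded ae_mem_frontier integrable_φ (e_pos k)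
  have tendsto_avg : ∀ᵐ x ∂(volume.restrict D),
      Tendsto (fun k => kernelAvg σ φ (e k) x) atTop (𝓝 (kernelAvg σ φ 0 x)) := by
    filter_upwards [ae_restrict_mem hD.isOpen.measurableSet] with x hx
    obtain ⟨p, -, hp_pos, hp⟩ := exists_mem_ae_norm_sub_le hD.isCompact_frontier ae_mem_frontier
      ((disjoint_frontier_iff_isOpen.2 hD.isOpen).notMem_of_mem_right hx)
    exact tendsto_kernelAvg integrable_φ hp_pos hp tendsto_e
  obtain ⟨mem_H1, tendsto_L2, tendsto_weakGrad⟩ := hD.tendsto_H1_of_ae_tendsto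
    (fun k => mem_H1_of_contDiff hD.isBounded ((contDiff_avg k).of_le (by simp)))
    (hD.isGradientCauchy_kernelAvg hd hφ e_pos e_le tendsto_e) tendsto_avg
  obtain ⟨C, hC, hbound⟩ := exists_lintegral_kernelAvg_sub_sq_le hd ae_mem_frontier
    (hD.isLowerRegularOn_frontier 1)
  have tendsto_bound : Tendsto (fun k => C * (ENNReal.ofReal (e k) * gagliardo σ φ)) atTop
      (𝓝 0) := by
    simpa using ENNReal.Tendsto.const_mul (ENNReal.Tendsto.mul_const
      (ENNReal.tendsto_ofReal tendsto_e) (Or.inr hφ.ne)) (Or.inr hC)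
  exact ⟨mem_H1, _, contDiff_avg, tendsto_L2, tendsto_weakGrad,
    tendsto_eLpNorm_two_iff.2
      (tendsto_nhds_bot_mono' tendsto_bound fun k => hbound φ integrable_φ _ (e_pos k) (e_le k))⟩

lemma IsLipschitzBoundedDomain.exists_hasTrace (hd : 1 ≤ d) (hD : IsLipschitzBoundedDomain D)
    {φ : L2Boundary D} (hφ : φ ∈ HHalfBoundary D) : ∃ u, HasTrace D u φ := by
  rcases eq_or_ne (surfaceMeasure D) 0 with hσ | hσ
  · exact ⟨0, hasTrace_zero_of_surfaceMeasure_eq_zero hD.isOpen hD.isBounded hσ φ⟩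
  · have : NeZero (surfaceMeasure D) := ⟨hσ⟩
    exact ⟨_, hD.hasTrace_kernelAvg hd (mem_HHalfBoundary_iff.1 hφ)⟩

end TraceExtension

section PolarCoordinates

variable {E : Type*} [NormedAddCommGroup E] [NormedSpace ℝ E] [MeasurableSpace E] [BorelSpace E]
  [FiniteDimensional ℝ E] [Nontrivial E] (μ : Measure E) [μ.IsAddHaarMeasure]

lemma lintegral_fun_norm {h : ℝ → ENNReal} (hh : Measurable h) :
    ∫⁻ x, h ‖x‖ ∂μ = μ.toSphere Set.univ *
      ∫⁻ s in Set.Ioi (0 : ℝ), ENNReal.ofReal (s ^ (Module.finrank ℝ E - 1)) * h s := by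
  set m := Module.finrank ℝ E - 1
  have measurable_radius : Measurable fun s : Set.Ioi (0 : ℝ) => h s :=
    hh.comp measurable_subtype_coe
  have measurable_snd_radius :
      Measurable fun x : Metric.sphere (0 : E) 1 × Set.Ioi (0 : ℝ) => h x.2.1 :=
    measurable_radius.comp measurable_snd
  have measurable_density : Measurable fun s : Set.Ioi (0 : ℝ) => ENNReal.ofReal (s.1 ^ m) :=
    (measurable_subtype_coe.pow_const _).ennreal_ofReal
  calc ∫⁻ x, h ‖x‖ ∂μ = ∫⁻ x : ({(0)}ᶜ : Set E), h ‖x.1‖ ∂(μ.comap (↑)) := by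
        rw [lintegral_subtype_comap (measurableSet_singleton _).compl fun x : E => h ‖x‖,
          restrict_compl_singleton]
    _ = ∫⁻ x, h x.2.1 ∂μ.toSphere.prod (.volumeIoiPow m) := by
        simpa using
          μ.measurePreserving_homeomorphUnitSphereProd.lintegral_comp measurable_snd_radius
    _ = μ.toSphere Set.univ * ∫⁻ s : Set.Ioi (0 : ℝ), h s ∂(.volumeIoiPow m) := by
        rw [lintegral_prod _ measurable_snd_radius.aemeasurable, mul_comm]
        simp only [lintegral_const]
    _ = _ := by
        rw [Measure.volumeIoiPow,
          lintegral_withDensity_eq_lintegral_mul _ measurable_density measurable_radius]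
        simp only [Pi.mul_apply]
        rw [lintegral_subtype_comap measurableSet_Ioi fun s : ℝ => ENNReal.ofReal (s ^ m) * h s]

lemma lintegral_inv_norm_pow_mul {h : ℝ → ENNReal} (hh : Measurable h) :
    ∫⁻ x, ENNReal.ofReal ((‖x‖ ^ (Module.finrank ℝ E - 1))⁻¹) * h ‖x‖ ∂μ =
      μ.toSphere Set.univ * ∫⁻ s in Set.Ioi (0 : ℝ), h s := by
  rw [lintegral_fun_norm μ (h := fun s => ENNReal.ofReal ((s ^ _)⁻¹) * h s) (by fun_prop)]
  congr 1
  refine setLIntegral_congr_fun measurableSet_Ioi fun s (hs : 0 < s) => ?_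
  rw [← mul_assoc, ← ENNReal.ofReal_mul (by positivity), mul_inv_cancel₀ (by positivity),
    ENNReal.ofReal_one, one_mul]

end PolarCoordinates

section Hardy

lemma lintegral_Ioc_rpow_neg_half {s : ℝ} (hs : 0 < s) :
    ∫⁻ t in Set.Ioc 0 s, ENNReal.ofReal (t ^ (-(1 / 2) : ℝ)) =
      ENNReal.ofReal (2 * s ^ (1 / 2 : ℝ)) := by
  have intervalIntegrable_rpow :
      IntervalIntegrable (fun t : ℝ => t ^ (-(1 / 2) : ℝ)) volume 0 s :=
    intervalIntegral.intervalIntegrable_rpow' (by norm_num)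
  rw [← ofReal_integral_eq_lintegral_ofReal intervalIntegrable_rpow.1
    ((ae_restrict_mem measurableSet_Ioc).mono fun t ht => Real.rpow_nonneg ht.1.le _),
    ← intervalIntegral.integral_of_le hs.le, integral_rpow (Or.inl (by norm_num)),
    Real.zero_rpow (by norm_num)]
  congr 1
  norm_num
  ring

lemma lintegral_Ici_rpow_neg_three_halves {t : ℝ} (ht : 0 < t) :
    ∫⁻ s in Set.Ici t, ENNReal.ofReal (s ^ (-(3 / 2) : ℝ)) =
      ENNReal.ofReal (2 * t ^ (-(1 / 2) : ℝ)) := by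
  rw [setLIntegral_congr Ioi_ae_eq_Ici.symm, ← ofReal_integral_eq_lintegral_ofReal
    (integrableOn_Ioi_rpow_of_lt (by norm_num) ht)
    ((ae_restrict_mem measurableSet_Ioi).mono fun s hs =>
      Real.rpow_nonneg (ht.trans hs).le _), integral_Ioi_rpow_of_lt (by norm_num) ht]
  congr 1
  norm_num
  ring

lemma lintegral_Ioi_mul_lintegral_Ioc {k h : ℝ → ENNReal} (hk : Measurable k) (hh : Measurable h)
    (a : ℝ) :
    ∫⁻ s in Set.Ioi a, k s * ∫⁻ t in Set.Ioc a s, h t =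
      ∫⁻ t in Set.Ioi a, (∫⁻ s in Set.Ici t, k s) * h t := by
  have measurable_uncurry :
      Measurable ({p : ℝ × ℝ | p.2 ≤ p.1}.indicator fun p => k p.1 * h p.2) :=
    ((hk.comp measurable_fst).mul (hh.comp measurable_snd)).indicator
      (measurableSet_le measurable_snd measurable_fst)
  calc ∫⁻ s in Set.Ioi a, k s * ∫⁻ t in Set.Ioc a s, h t
      = ∫⁻ s in Set.Ioi a, ∫⁻ t in Set.Ioi a,
          {p : ℝ × ℝ | p.2 ≤ p.1}.indicator (fun p => k p.1 * h p.2) (s, t) := by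
        refine lintegral_congr fun s => ?_
        rw [← Set.Ioi_inter_Iic, Set.inter_comm, ← setLIntegral_indicator measurableSet_Iic,
          ← lintegral_const_mul _ (hh.indicator measurableSet_Iic)]
        refine lintegral_congr fun t => ?_
        by_cases hts : t ≤ s <;> simp [hts]
    _ = ∫⁻ t in Set.Ioi a, ∫⁻ s in Set.Ioi a,
          {p : ℝ × ℝ | p.2 ≤ p.1}.indicator (fun p => k p.1 * h p.2) (s, t) :=
        lintegral_lintegral_swap measurable_uncurry.aemeasurable
    _ = ∫⁻ t in Set.Ioi a, (∫⁻ s in Set.Ici t, k s) * h t := by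
        refine setLIntegral_congr_fun measurableSet_Ioi fun t (ht : a < t) => ?_
        have Ici_subset : Set.Ici t ⊆ Set.Ioi a := fun s hs => ht.trans_le hs
        rw [← Set.inter_eq_left.2 Ici_subset, ← setLIntegral_indicator measurableSet_Ici,
          ← lintegral_mul_const _ (hk.indicator measurableSet_Ici)]
        refine lintegral_congr fun s => ?_
        by_cases hts : t ≤ s <;> simp [hts]

lemma sq_lintegral_Ioc_le {f : ℝ → ENNReal} (hf : Measurable f) {s : ℝ} (hs : 0 < s) :
    (∫⁻ t in Set.Ioc 0 s, f t) ^ 2 ≤ ENNReal.ofReal (2 * s ^ (1 / 2 : ℝ)) *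
      ∫⁻ t in Set.Ioc 0 s, ENNReal.ofReal (t ^ (1 / 2 : ℝ)) * f t ^ 2 := by
  have ofReal_rpow_sq {t : ℝ} (ht : 0 < t) (r : ℝ) :
      ENNReal.ofReal (t ^ r) ^ 2 = ENNReal.ofReal (t ^ (r * 2)) := by
    rw [← ENNReal.ofReal_pow (by positivity), ← Real.rpow_natCast, ← Real.rpow_mul ht.le,
      Nat.cast_ofNat]
  calc (∫⁻ t in Set.Ioc 0 s, f t) ^ 2
      = (∫⁻ t in Set.Ioc 0 s,
          ENNReal.ofReal (t ^ (-(1 / 4) : ℝ)) * (ENNReal.ofReal (t ^ (1 / 4 : ℝ)) * f t)) ^ 2 := by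
        congr 1
        refine setLIntegral_congr_fun measurableSet_Ioc fun t ht => ?_
        rw [← mul_assoc, ← ENNReal.ofReal_mul (Real.rpow_nonneg ht.1.le _), ← Real.rpow_add ht.1]
        norm_num
    _ ≤ (∫⁻ t in Set.Ioc 0 s, ENNReal.ofReal (t ^ (-(1 / 4) : ℝ)) ^ 2) *
          ∫⁻ t in Set.Ioc 0 s, (ENNReal.ofReal (t ^ (1 / 4 : ℝ)) * f t) ^ 2 :=
        sq_lintegral_mul_le (by fun_prop) (by fun_prop)
    _ = _ := by
        rw [← lintegral_Ioc_rpow_neg_half hs]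
        congr 1
        · refine setLIntegral_congr_fun measurableSet_Ioc fun t ht => ?_
          rw [ofReal_rpow_sq ht.1]
          norm_num
        · refine setLIntegral_congr_fun measurableSet_Ioc fun t ht => ?_
          rw [mul_pow, ofReal_rpow_sq ht.1]
          norm_num

lemma lintegral_hardy {f : ℝ → ENNReal} (hf : Measurable f) :
    ∫⁻ s in Set.Ioi (0 : ℝ), ENNReal.ofReal ((s ^ 2)⁻¹) * (∫⁻ t in Set.Ioc 0 s, f t) ^ 2 ≤
      4 * ∫⁻ t in Set.Ioi (0 : ℝ), f t ^ 2 := by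
  calc ∫⁻ s in Set.Ioi (0 : ℝ), ENNReal.ofReal ((s ^ 2)⁻¹) * (∫⁻ t in Set.Ioc 0 s, f t) ^ 2
      ≤ ∫⁻ s in Set.Ioi (0 : ℝ), 2 * (ENNReal.ofReal (s ^ (-(3 / 2) : ℝ)) *
          ∫⁻ t in Set.Ioc 0 s, ENNReal.ofReal (t ^ (1 / 2 : ℝ)) * f t ^ 2) := by
        refine setLIntegral_mono' measurableSet_Ioi fun s (hs : 0 < s) => ?_
        refine (mul_le_mul_right (sq_lintegral_Ioc_le hf hs) _).trans_eq ?_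
        rw [← mul_assoc, ← mul_assoc, ← ENNReal.ofReal_mul (by positivity),
          ← ENNReal.ofReal_ofNat 2, ← ENNReal.ofReal_mul (by positivity), ← Real.rpow_natCast s 2,
          ← Real.rpow_neg hs.le, mul_left_comm, ← Real.rpow_add hs]
        norm_num
    _ = 2 * ∫⁻ t in Set.Ioi (0 : ℝ), (∫⁻ s in Set.Ici t, ENNReal.ofReal (s ^ (-(3 / 2) : ℝ))) *
          (ENNReal.ofReal (t ^ (1 / 2 : ℝ)) * f t ^ 2) := by
        rw [lintegral_const_mul' _ _ ENNReal.ofNat_ne_top,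
          lintegral_Ioi_mul_lintegral_Ioc (by fun_prop) (by fun_prop)]
    _ = 2 * ∫⁻ t in Set.Ioi (0 : ℝ), 2 * f t ^ 2 := by
        congr 1
        refine setLIntegral_congr_fun measurableSet_Ioi fun t (ht : 0 < t) => ?_
        rw [lintegral_Ici_rpow_neg_three_halves ht, ← mul_assoc,
          ← ENNReal.ofReal_mul (by positivity), mul_assoc, ← Real.rpow_add ht]
        norm_num
    _ = 4 * ∫⁻ t in Set.Ioi (0 : ℝ), f t ^ 2 := by
        rw [lintegral_const_mul' _ _ ENNReal.ofNat_ne_top, ← mul_assoc]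
        norm_num

end Hardy

section FlatGagliardo

lemma ofReal_inv_pow_succ {n : ℕ} (hn : 1 ≤ n) {s : ℝ} (hs : 0 ≤ s) :
    ENNReal.ofReal ((s ^ (n + 1))⁻¹) =
      ENNReal.ofReal ((s ^ (n - 1))⁻¹) * ENNReal.ofReal ((s ^ 2)⁻¹) := by
  rw [← ENNReal.ofReal_mul (by positivity), ← mul_inv, ← pow_add,
    show n - 1 + 2 = n + 1 by omega]

lemma ofReal_inv_pow_mul_sq_le {n : ℕ} (hn : 1 ≤ n) {s : ℝ} (hs : 0 ≤ s) :
    ENNReal.ofReal ((s ^ (n + 1))⁻¹) * ENNReal.ofReal s ^ 2 ≤ ENNReal.ofReal ((s ^ (n - 1))⁻¹) := by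
  rw [ofReal_inv_pow_succ hn hs, ← ENNReal.ofReal_pow hs, mul_assoc,
    ← ENNReal.ofReal_mul (by positivity)]
  exact mul_le_of_le_one_right' (ENNReal.ofReal_le_one.2 inv_mul_le_one)

lemma ennreal_add_add_sq_le (a b c : ENNReal) :
    (a + b + c) ^ 2 ≤ 4 * (a ^ 2 + b ^ 2 + c ^ 2) := by
  calc (a + b + c) ^ 2 ≤ 2 * ((a + b) ^ 2 + c ^ 2) := ennreal_add_sq_le _ _
    _ ≤ 2 * (2 * (a ^ 2 + b ^ 2) + 2 * c ^ 2) := by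
        gcongr
        · exact ennreal_add_sq_le _ _
        · exact le_mul_of_one_le_left' (by norm_num)
    _ = 4 * (a ^ 2 + b ^ 2 + c ^ 2) := by ring

lemma ofReal_inv_pow_mul_sq_le_add_add {n : ℕ} (hn : 1 ≤ n) {s : ℝ} (hs : 0 ≤ s)
    {x P Q R K : ENNReal} (hx : x ≤ P + Q + K * ENNReal.ofReal s * R) :
    ENNReal.ofReal ((s ^ (n + 1))⁻¹) * x ^ 2 ≤
      4 * (ENNReal.ofReal ((s ^ (n + 1))⁻¹) * P ^ 2 + ENNReal.ofReal ((s ^ (n + 1))⁻¹) * Q ^ 2 +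
        K ^ 2 * (ENNReal.ofReal ((s ^ (n - 1))⁻¹) * R ^ 2)) := by
  set k := ENNReal.ofReal ((s ^ (n + 1))⁻¹)
  calc k * x ^ 2 ≤ k * (4 * (P ^ 2 + Q ^ 2 + (K * ENNReal.ofReal s * R) ^ 2)) := by
        gcongr
        exact (pow_le_pow_left' hx 2).trans (ennreal_add_add_sq_le _ _ _)
    _ = 4 * (k * P ^ 2 + k * Q ^ 2 + K ^ 2 * (k * ENNReal.ofReal s ^ 2 * R ^ 2)) := by ring
    _ ≤ _ := by
        gcongr
        exact ofReal_inv_pow_mul_sq_le hn hs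

lemma lintegral_lintegral_add_swap_add {α : Type*} [MeasurableSpace α] {μ : Measure α} [SFinite μ]
    {u : α → α → ENNReal} (hu : Measurable (Function.uncurry u)) (v : α → α → ENNReal) :
    ∫⁻ a, ∫⁻ b, (u a b + u b a + v a b) ∂μ ∂μ =
      2 * (∫⁻ a, ∫⁻ b, u a b ∂μ ∂μ) + ∫⁻ a, ∫⁻ b, v a b ∂μ ∂μ := by
  have measurable_left (a) : Measurable (u a) := hu.comp measurable_prodMk_left
  have measurable_right (a) : Measurable fun b => u b a := hu.comp measurable_prodMk_right
  have measurable_lintegral_left : Measurable fun a => ∫⁻ b, u a b ∂μ := hu.lintegral_prod_right'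
  have measurable_lintegral_right : Measurable fun a => ∫⁻ b, u b a ∂μ := hu.lintegral_prod_left'
  calc ∫⁻ a, ∫⁻ b, (u a b + u b a + v a b) ∂μ ∂μ
      = ∫⁻ a, ((∫⁻ b, u a b ∂μ) + (∫⁻ b, u b a ∂μ) + ∫⁻ b, v a b ∂μ) ∂μ :=
        lintegral_congr fun a => by
          rw [← lintegral_add_left (measurable_left a),
            ← lintegral_add_left ((measurable_left a).fun_add (measurable_right a))]
    _ = (∫⁻ a, ∫⁻ b, u a b ∂μ ∂μ) + (∫⁻ a, ∫⁻ b, u b a ∂μ ∂μ) + ∫⁻ a, ∫⁻ b, v a b ∂μ ∂μ := by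
        rw [← lintegral_add_left measurable_lintegral_left,
          ← lintegral_add_left (measurable_lintegral_left.fun_add measurable_lintegral_right)]
    _ = _ := by rw [lintegral_lintegral_swap (f := fun a b => u b a)
          (hu.comp measurable_swap).aemeasurable, two_mul]

variable {E : Type*} [NormedAddCommGroup E] [MeasurableSpace E] [BorelSpace E]

lemma measurable_lintegral_Ioc_norm_sub [SecondCountableTopology E]
    {F : E × ℝ → ENNReal} (hF : Measurable F) :
    Measurable fun p : E × E => ∫⁻ t in Set.Ioc 0 ‖p.1 - p.2‖, F (p.1, t) := by
  have measurableSet_below : MeasurableSet {q : (E × E) × ℝ | 0 < q.2 ∧ q.2 ≤ ‖q.1.1 - q.1.2‖} :=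
    (measurableSet_lt measurable_const measurable_snd).inter
      (measurableSet_le measurable_snd (by fun_prop))
  have measurable_lift : Measurable fun q : (E × E) × ℝ => F (q.1.1, q.2) := hF.comp (by fun_prop)
  simp_rw [← lintegral_indicator measurableSet_Ioc]
  exact (measurable_lift.indicator measurableSet_below).lintegral_prod_right' (ν := volume)

variable [NormedSpace ℝ E] [FiniteDimensional ℝ E] (μ : Measure E) [μ.IsAddHaarMeasure]

lemma lintegral_lintegral_Ioc_add_smul {G : E → ENNReal} (hG : Measurable G) (z : E) :
    ∫⁻ a, (∫⁻ θ in Set.Ioc (0 : ℝ) 1, G (a + θ • z)) ∂μ = ∫⁻ a, G a ∂μ := by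
  have measurable_translate : Measurable fun p : E × ℝ => G (p.1 + p.2 • z) :=
    hG.comp (by fun_prop)
  rw [lintegral_lintegral_swap measurable_translate.aemeasurable]
  simp [lintegral_add_right_eq_self]

variable [Nontrivial E]

lemma lintegral_vertical_le {F : E × ℝ → ENNReal} (hF : Measurable F) :
    ∫⁻ a, ∫⁻ b, ENNReal.ofReal ((‖a - b‖ ^ (Module.finrank ℝ E + 1))⁻¹) *
        (∫⁻ t in Set.Ioc 0 ‖a - b‖, F (a, t)) ^ 2 ∂μ ∂μ ≤
      4 * μ.toSphere Set.univ * ∫⁻ a, (∫⁻ t in Set.Ioi (0 : ℝ), F (a, t) ^ 2) ∂μ := by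
  set n := Module.finrank ℝ E
  rw [← lintegral_const_mul' _ _ (by finiteness)]
  refine lintegral_mono fun a => ?_
  have monotone_primitive : Monotone fun s : ℝ => ∫⁻ t in Set.Ioc 0 s, F (a, t) :=
    fun s s' hs => lintegral_mono_set (Set.Ioc_subset_Ioc_right hs)
  have measurable_primitive := monotone_primitive.measurable
  calc ∫⁻ b, ENNReal.ofReal ((‖a - b‖ ^ (n + 1))⁻¹) *
        (∫⁻ t in Set.Ioc 0 ‖a - b‖, F (a, t)) ^ 2 ∂μ
      = ∫⁻ z, ENNReal.ofReal ((‖z‖ ^ (n + 1))⁻¹) * (∫⁻ t in Set.Ioc 0 ‖z‖, F (a, t)) ^ 2 ∂μ :=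
        lintegral_sub_left_eq_self (fun z : E => ENNReal.ofReal ((‖z‖ ^ (n + 1))⁻¹) *
          (∫⁻ t in Set.Ioc 0 ‖z‖, F (a, t)) ^ 2) a
    _ = μ.toSphere Set.univ * ∫⁻ s in Set.Ioi (0 : ℝ),
          ENNReal.ofReal ((s ^ 2)⁻¹) * (∫⁻ t in Set.Ioc 0 s, F (a, t)) ^ 2 := by
        rw [← lintegral_inv_norm_pow_mul μ (by fun_prop)]
        exact lintegral_congr fun z => by
          rw [ofReal_inv_pow_succ Module.finrank_pos (norm_nonneg z), mul_assoc]
    _ ≤ μ.toSphere Set.univ * (4 * ∫⁻ t in Set.Ioi (0 : ℝ), F (a, t) ^ 2) :=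
        mul_le_mul_right (lintegral_hardy (hF.comp measurable_prodMk_left)) _
    _ = 4 * μ.toSphere Set.univ * ∫⁻ t in Set.Ioi (0 : ℝ), F (a, t) ^ 2 := by ring

lemma lintegral_horizontal_eq {F : E × ℝ → ENNReal} (hF : Measurable F) :
    ∫⁻ a, ∫⁻ b, ENNReal.ofReal ((‖a - b‖ ^ (Module.finrank ℝ E - 1))⁻¹) *
        (∫⁻ θ in Set.Ioc (0 : ℝ) 1, F (a + θ • (b - a), ‖a - b‖)) ∂μ ∂μ =
      μ.toSphere Set.univ * ∫⁻ a, (∫⁻ t in Set.Ioi (0 : ℝ), F (a, t)) ∂μ := by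
  set n := Module.finrank ℝ E
  have measurable_translate :
      Measurable fun p : (E × E) × ℝ => F (p.1.1 + p.2 • p.1.2, ‖p.1.2‖) := hF.comp (by fun_prop)
  have measurable_integrand : Measurable fun p : E × E => ENNReal.ofReal ((‖p.2‖ ^ (n - 1))⁻¹) *
      ∫⁻ θ in Set.Ioc (0 : ℝ) 1, F (p.1 + θ • p.2, ‖p.2‖) :=
    Measurable.mul (by fun_prop) measurable_translate.lintegral_prod_right'
  calc ∫⁻ a, ∫⁻ b, ENNReal.ofReal ((‖a - b‖ ^ (n - 1))⁻¹) *
        (∫⁻ θ in Set.Ioc (0 : ℝ) 1, F (a + θ • (b - a), ‖a - b‖)) ∂μ ∂μ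
      = ∫⁻ a, ∫⁻ z, ENNReal.ofReal ((‖z‖ ^ (n - 1))⁻¹) *
          (∫⁻ θ in Set.Ioc (0 : ℝ) 1, F (a + θ • z, ‖z‖)) ∂μ ∂μ := by
        refine lintegral_congr fun a => ?_
        simp_rw [norm_sub_rev a]
        exact lintegral_sub_right_eq_self (fun z : E => ENNReal.ofReal ((‖z‖ ^ (n - 1))⁻¹) *
          ∫⁻ θ in Set.Ioc (0 : ℝ) 1, F (a + θ • z, ‖z‖)) a
    _ = ∫⁻ z, ∫⁻ a, ENNReal.ofReal ((‖z‖ ^ (n - 1))⁻¹) *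
          (∫⁻ θ in Set.Ioc (0 : ℝ) 1, F (a + θ • z, ‖z‖)) ∂μ ∂μ :=
        lintegral_lintegral_swap measurable_integrand.aemeasurable
    _ = ∫⁻ z, ENNReal.ofReal ((‖z‖ ^ (n - 1))⁻¹) * ∫⁻ a, F (a, ‖z‖) ∂μ ∂μ := by
        refine lintegral_congr fun z => ?_
        rw [lintegral_const_mul' _ _ ENNReal.ofReal_ne_top, lintegral_lintegral_Ioc_add_smul μ
          (G := fun a => F (a, ‖z‖)) (hF.comp measurable_prodMk_right)]
    _ = μ.toSphere Set.univ * ∫⁻ s in Set.Ioi (0 : ℝ), ∫⁻ a, F (a, s) ∂μ :=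
        lintegral_inv_norm_pow_mul μ hF.lintegral_prod_left'
    _ = μ.toSphere Set.univ * ∫⁻ a, (∫⁻ t in Set.Ioi (0 : ℝ), F (a, t)) ∂μ := by
        rw [lintegral_lintegral_swap]
        exact (hF.comp measurable_swap).aemeasurable

lemma lintegral_gagliardo_le {B : Set E} (hB : MeasurableSet B) {W : E → ℝ}
    {F : E × ℝ → ENNReal} (hF : Measurable F) {K : ENNReal} (hK : K ≠ ⊤)
    (hW : ∀ a ∈ B, ∀ b ∈ B, ‖W a - W b‖ₑ ≤ (∫⁻ t in Set.Ioc 0 ‖a - b‖, F (a, t)) +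
      (∫⁻ t in Set.Ioc 0 ‖a - b‖, F (b, t)) + K * ENNReal.ofReal ‖a - b‖ *
        ∫⁻ θ in Set.Ioc (0 : ℝ) 1, F (a + θ • (b - a), ‖a - b‖)) :
    ∫⁻ a in B, ∫⁻ b in B, ENNReal.ofReal ((‖a - b‖ ^ (Module.finrank ℝ E + 1))⁻¹) *
        ‖W a - W b‖ₑ ^ 2 ∂μ ∂μ ≤
      4 * (8 + K ^ 2) * μ.toSphere Set.univ *
        ∫⁻ a, (∫⁻ t in Set.Ioi (0 : ℝ), F (a, t) ^ 2) ∂μ := by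
  set n := Module.finrank ℝ E
  let k (a b : E) := ENNReal.ofReal ((‖a - b‖ ^ (n + 1))⁻¹)
  let vertical (a b : E) := k a b * (∫⁻ t in Set.Ioc 0 ‖a - b‖, F (a, t)) ^ 2
  let horizontal (a b : E) := ENNReal.ofReal ((‖a - b‖ ^ (n - 1))⁻¹) *
    ∫⁻ θ in Set.Ioc (0 : ℝ) 1, F (a + θ • (b - a), ‖a - b‖) ^ 2
  have measurable_vertical : Measurable (Function.uncurry vertical) :=
    Measurable.mul (by fun_prop) ((measurable_lintegral_Ioc_norm_sub hF).pow_const 2)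
  have increment_le (a) (ha : a ∈ B) (b) (hb : b ∈ B) : k a b * ‖W a - W b‖ₑ ^ 2 ≤
      4 * (vertical a b + vertical b a + K ^ 2 * horizontal a b) := by
    refine (ofReal_inv_pow_mul_sq_le_add_add Module.finrank_pos (norm_nonneg _)
      (hW a ha b hb)).trans ?_
    simp only [vertical, horizontal, k, norm_sub_rev b a]
    gcongr
    exact (sq_lintegral_le (hF.comp (by fun_prop)).aemeasurable).trans (by simp)
  set I := ∫⁻ a, (∫⁻ t in Set.Ioi (0 : ℝ), F (a, t) ^ 2) ∂μ
  calc ∫⁻ a in B, ∫⁻ b in B, k a b * ‖W a - W b‖ₑ ^ 2 ∂μ ∂μ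
      ≤ ∫⁻ a in B, ∫⁻ b in B, 4 * (vertical a b + vertical b a + K ^ 2 * horizontal a b) ∂μ ∂μ :=
        setLIntegral_mono' hB fun a ha => setLIntegral_mono' hB (increment_le a ha)
    _ ≤ ∫⁻ a, ∫⁻ b, 4 * (vertical a b + vertical b a + K ^ 2 * horizontal a b) ∂μ ∂μ :=
        (setLIntegral_le_lintegral _ _).trans
          (lintegral_mono fun a => setLIntegral_le_lintegral _ _)
    _ = 4 * (2 * (∫⁻ a, ∫⁻ b, vertical a b ∂μ ∂μ) +
          K ^ 2 * ∫⁻ a, ∫⁻ b, horizontal a b ∂μ ∂μ) := by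
        simp_rw [lintegral_const_mul' (4 : ENNReal) _ ENNReal.ofNat_ne_top]
        rw [lintegral_lintegral_add_swap_add measurable_vertical]
        simp_rw [lintegral_const_mul' (K ^ 2) _ (ENNReal.pow_ne_top hK)]
    _ ≤ 4 * (2 * (4 * μ.toSphere Set.univ * I) + K ^ 2 * (μ.toSphere Set.univ * I)) := by
        gcongr
        · exact lintegral_vertical_le μ hF
        · exact (lintegral_horizontal_eq μ (hF.pow_const 2)).le
    _ = _ := by ring

end FlatGagliardo

section LipschitzPath

variable {E F : Type*} [NormedAddCommGroup E] [NormedSpace ℝ E] [NormedAddCommGroup F]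
  [NormedSpace ℝ F] {w : E → F} {γ : ℝ → E} {M : NNReal}

lemma eventually_slope_norm_sub_lt (hw : ContDiff ℝ 1 w) (hγ : LipschitzWith M γ) (c : F)
    {t r : ℝ} (hr : M * ‖fderiv ℝ w (γ t)‖ < r) :
    ∀ᶠ z in 𝓝[>] t, slope (fun s => ‖w (γ s) - c‖) t z < r := by
  have hcont : Continuous fun K : NNReal => M * (K : ℝ) := by fun_prop
  obtain ⟨K, hKr, hK⟩ : ∃ K : NNReal, M * (K : ℝ) < r ∧ ‖fderiv ℝ w (γ t)‖₊ < K :=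
    (((hcont.tendsto ‖fderiv ℝ w (γ t)‖₊).eventually_lt_const hr).filter_mono nhdsWithin_le_nhds
      |>.and (self_mem_nhdsWithin (s := Set.Ioi ‖fderiv ℝ w (γ t)‖₊))).exists
  obtain ⟨s, hs, hws⟩ :=
    (hw.contDiffAt.hasStrictFDerivAt one_ne_zero).exists_lipschitzOnWith_of_nnnorm_lt K hK
  filter_upwards [self_mem_nhdsWithin,
    nhdsWithin_le_nhds (hγ.continuous.continuousAt.preimage_mem_nhds hs)] with z hz hzs
  have hzt : 0 < z - t := sub_pos.2 hz
  rw [slope_def_field, div_lt_iff₀ hzt]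
  calc ‖w (γ z) - c‖ - ‖w (γ t) - c‖ ≤ dist (w (γ z)) (w (γ t)) := by
        simpa [dist_eq_norm] using norm_sub_norm_le (w (γ z) - c) (w (γ t) - c)
    _ ≤ K * dist (γ z) (γ t) := hws.dist_le_mul _ hzs _ (mem_of_mem_nhds hs)
    _ ≤ K * (M * (z - t)) := by
        gcongr
        simpa [Real.dist_eq, abs_of_pos hzt] using hγ.dist_le_mul z t
    _ < r * (z - t) := by rw [← mul_assoc, mul_comm (K : ℝ)]; gcongr

lemma enorm_sub_le_mul_lintegral_fderiv_of_lipschitzWith (hw : ContDiff ℝ 1 w)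
    (hγ : LipschitzWith M γ) {a b : ℝ} (hab : a ≤ b) :
    ‖w (γ b) - w (γ a)‖ₑ ≤ M * ∫⁻ t in Set.Ioc a b, ‖fderiv ℝ w (γ t)‖ₑ := by
  have hcont : Continuous fun t => fderiv ℝ w (γ t) :=
    (hw.continuous_fderiv one_ne_zero).comp hγ.continuous
  have hprim (t : ℝ) : HasDerivAt (fun s => M * ∫ y in a..s, ‖fderiv ℝ w (γ y)‖)
      (M * ‖fderiv ℝ w (γ t)‖) t :=
    (hcont.norm.integral_hasStrictDerivAt a t).hasDerivAt.const_mul _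
  have hnorm : ‖w (γ b) - w (γ a)‖ ≤ M * ∫ t in a..b, ‖fderiv ℝ w (γ t)‖ :=
    image_le_of_liminf_slope_right_le_deriv_boundary (a := a)
      ((hw.continuous.comp hγ.continuous).sub continuous_const).norm.continuousOn (by simp)
      (fun t _ => (hprim t).continuousAt.continuousWithinAt)
      (fun t _ => (hprim t).hasDerivWithinAt)
      (fun t _ r hr => (eventually_slope_norm_sub_lt hw hγ _ hr).frequently)
      (Set.right_mem_Icc.2 hab)
  rw [intervalIntegral.integral_of_le hab] at hnorm
  rw [← ofReal_norm, ← ENNReal.ofReal_coe_nnreal, ← ofReal_integral_norm_eq_lintegral_enorm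
    (hcont.integrableOn_Ioc), ← ENNReal.ofReal_mul M.coe_nonneg]
  exact ENNReal.ofReal_le_ofReal hnorm

lemma enorm_sub_le_mul_lintegral_fderiv (hw : ContDiff ℝ 1 w) {a b : ℝ} (hab : a ≤ b)
    (hγ : LipschitzOnWith M γ (Set.Icc a b)) :
    ‖w (γ b) - w (γ a)‖ₑ ≤ M * ∫⁻ t in Set.Ioc a b, ‖fderiv ℝ w (γ t)‖ₑ := by
  set γ' := Set.IccExtend hab ((Set.Icc a b).domRestrict γ)
  have hext : ∀ t ∈ Set.Icc a b, γ' t = γ t := fun t ht => Set.IccExtend_of_mem hab _ ht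
  have hγ' : LipschitzWith M γ' :=
    mul_one M ▸ hγ.to_restrict.comp (LipschitzWith.projIcc hab)
  have hle := enorm_sub_le_mul_lintegral_fderiv_of_lipschitzWith hw hγ' hab
  rw [hext b (Set.right_mem_Icc.2 hab), hext a (Set.left_mem_Icc.2 hab)] at hle
  refine hle.trans_eq (congrArg _ ?_)
  exact setLIntegral_congr_fun measurableSet_Ioc fun t ht => by
    simp only [hext t (Set.Ioc_subset_Icc_self ht)]

end LipschitzPath

section Collar

variable {x : Eu d} {R : ℝ} {T : Eu d ≃ᵃⁱ[ℝ] WithLp 2 (Eu (d - 1) × ℝ)} {g : Eu (d - 1) → ℝ}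
  {L : NNReal} {w : Eu d → ℝ}

lemma measurePreserving_affineIsometryEquiv {V W : Type*} [NormedAddCommGroup V]
    [InnerProductSpace ℝ V] [FiniteDimensional ℝ V] [MeasurableSpace V] [BorelSpace V]
    [NormedAddCommGroup W] [InnerProductSpace ℝ W] [FiniteDimensional ℝ W] [MeasurableSpace W]
    [BorelSpace W] (S : V ≃ᵃⁱ[ℝ] W) : MeasurePreserving S := by
  have hS : ⇑S = (· + S 0) ∘ S.linearIsometryEquiv := by
    ext1 v
    simpa using S.map_vadd 0 v
  rw [hS]
  exact (measurePreserving_add_right volume (S 0)).comp S.linearIsometryEquiv.measurePreserving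

lemma measurePreserving_graphPoint (hg : Continuous g) :
    MeasurePreserving fun p : Eu (d - 1) × ℝ => graphPoint T g p.1 p.2 := by
  have hshear : MeasurePreserving fun p : Eu (d - 1) × ℝ => (p.1, g p.1 + p.2) :=
    (MeasurePreserving.id volume).skew_product (g := fun a t => g a + t)
      ((hg.comp continuous_fst).add continuous_snd).measurable
      (Eventually.of_forall fun a => (measurePreserving_add_left volume (g a)).map_eq)
  exact (measurePreserving_affineIsometryEquiv T.symm).comp
    ((WithLp.volume_preserving_toLp (Eu (d - 1)) ℝ).comp hshear)

/-- The norm of the derivative of `w` in the coordinates of a graph box with base `B` and height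
`2 * R`, extended by zero. -/
def collarDeriv (B : Set (Eu (d - 1))) (R : ℝ) (T : Eu d ≃ᵃⁱ[ℝ] WithLp 2 (Eu (d - 1) × ℝ))
    (g : Eu (d - 1) → ℝ) (w : Eu d → ℝ) : Eu (d - 1) × ℝ → ENNReal :=
  (B ×ˢ Set.Ioo 0 (2 * R)).indicator fun p => ‖fderiv ℝ w (graphPoint T g p.1 p.2)‖ₑ

lemma collarDeriv_eq {B : Set (Eu (d - 1))} {a : Eu (d - 1)} (ha : a ∈ B) {t : ℝ} (ht : 0 < t)
    (htR : t < 2 * R) : collarDeriv B R T g w (a, t) = ‖fderiv ℝ w (graphPoint T g a t)‖ₑ :=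
  Set.indicator_of_mem (s := B ×ˢ Set.Ioo 0 (2 * R)) ⟨ha, ht, htR⟩ _

lemma measurable_collarDeriv {B : Set (Eu (d - 1))} (hB : MeasurableSet B) (hg : Continuous g)
    (hw : ContDiff ℝ 1 w) : Measurable (collarDeriv B R T g w) :=
  (((hw.continuous_fderiv one_ne_zero).comp (continuous_graphPoint hg)).enorm.measurable).indicator
    (hB.prod measurableSet_Ioo)

lemma enorm_sub_vertical_le {B : Set (Eu (d - 1))} (hw : ContDiff ℝ 1 w) {a : Eu (d - 1)}
    (ha : a ∈ B) {s : ℝ} (hs : 0 ≤ s) (hsR : s < 2 * R) :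
    ‖w (graphPoint T g a s) - w (graphPoint T g a 0)‖ₑ ≤
      ∫⁻ t in Set.Ioc 0 s, collarDeriv B R T g w (a, t) := by
  have hlip : LipschitzWith 1 (graphPoint T g a) := LipschitzWith.of_dist_le_mul fun s t => by
    simpa using dist_graphPoint_le (T := T) (g := g) a a s t
  refine (enorm_sub_le_mul_lintegral_fderiv hw hs hlip.lipschitzOnWith).trans_eq ?_
  rw [ENNReal.coe_one, one_mul]
  exact setLIntegral_congr_fun measurableSet_Ioc fun t ht =>
    (collarDeriv_eq ha ht.1 (ht.2.trans_lt hsR)).symm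

lemma enorm_sub_horizontal_le {B : Set (Eu (d - 1))} (hB : Convex ℝ B)
    (hL : LipschitzOnWith L g B) (hw : ContDiff ℝ 1 w) {a b : Eu (d - 1)} (ha : a ∈ B)
    (hb : b ∈ B) {s : ℝ} (hs : 0 < s) (hsR : s < 2 * R) :
    ‖w (graphPoint T g b s) - w (graphPoint T g a s)‖ₑ ≤
      ((1 + L : NNReal) : ENNReal) * ENNReal.ofReal ‖a - b‖ *
        ∫⁻ θ in Set.Ioc (0 : ℝ) 1, collarDeriv B R T g w (a + θ • (b - a), s) := by
  have hmem : ∀ θ ∈ Set.Icc (0 : ℝ) 1, a + θ • (b - a) ∈ B :=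
    fun θ hθ => hB.add_smul_sub_mem ha hb hθ
  have hlip : LipschitzOnWith ((1 + L) * ‖b - a‖₊)
      (fun θ : ℝ => graphPoint T g (a + θ • (b - a)) s) (Set.Icc 0 1) :=
    (lipschitzOnWith_graphPoint hL s).comp
      (LipschitzWith.of_dist_le_mul fun θ θ' => by
        simp [dist_eq_norm, ← sub_smul, norm_smul, mul_comm]).lipschitzOnWith hmem
  have hle := enorm_sub_le_mul_lintegral_fderiv hw zero_le_one hlip
  simp only [one_smul, zero_smul, add_zero, add_sub_cancel] at hle
  refine hle.trans_eq ?_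
  rw [ENNReal.coe_mul, ← enorm_eq_nnnorm, ← ofReal_norm, norm_sub_rev]
  exact congrArg _ (setLIntegral_congr_fun measurableSet_Ioc fun θ hθ =>
    (collarDeriv_eq (hmem θ (Set.Ioc_subset_Icc_self hθ)) hs hsR).symm)

namespace IsGraphBox

lemma enorm_sub_le (h : IsGraphBox D x R T g L) (hw : ContDiff ℝ 1 w)
    {a b : Eu (d - 1)} (ha : a ∈ Metric.ball (T x).fst R) (hb : b ∈ Metric.ball (T x).fst R) :
    ‖w (graphPoint T g a 0) - w (graphPoint T g b 0)‖ₑ ≤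
      (∫⁻ t in Set.Ioc 0 ‖a - b‖, collarDeriv (Metric.ball (T x).fst R) R T g w (a, t)) +
      (∫⁻ t in Set.Ioc 0 ‖a - b‖, collarDeriv (Metric.ball (T x).fst R) R T g w (b, t)) +
      ((1 + L : NNReal) : ENNReal) * ENNReal.ofReal ‖a - b‖ *
        ∫⁻ θ in Set.Ioc (0 : ℝ) 1,
          collarDeriv (Metric.ball (T x).fst R) R T g w (a + θ • (b - a), ‖a - b‖) := by
  rcases eq_or_ne a b with rfl | hab
  · simp
  have hs : 0 < ‖a - b‖ := norm_pos_iff.2 (sub_ne_zero.2 hab)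
  have hsR : ‖a - b‖ < 2 * R := by
    rw [← dist_eq_norm, two_mul]
    exact (dist_triangle_right a b (T x).fst).trans_lt (add_lt_add ha hb)
  have hup := enorm_sub_vertical_le (T := T) (g := g) hw ha hs.le hsR
  have hdown := enorm_sub_vertical_le (T := T) (g := g) hw hb hs.le hsR
  have hacross := enorm_sub_horizontal_le (T := T) (convex_ball _ _) h.lipschitz hw ha hb hs hsR
  refine le_trans ?_ (add_le_add (add_le_add hup hdown) hacross)
  rw [enorm_sub_rev (w (graphPoint T g a ‖a - b‖)),
    enorm_sub_rev (w (graphPoint T g b ‖a - b‖)) (w (graphPoint T g a ‖a - b‖))]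
  refine le_trans (le_of_eq ?_) ((enorm_add_le _ _).trans (add_le_add_left (enorm_add_le _ _) _))
  congr 1
  ring

lemma lintegral_collarDeriv_le (h : IsGraphBox D x R T g L) (hD : MeasurableSet D)
    (hw : ContDiff ℝ 1 w) :
    ∫⁻ a, (∫⁻ t in Set.Ioi (0 : ℝ), collarDeriv (Metric.ball (T x).fst R) R T g w (a, t) ^ 2) ≤
      ∫⁻ y in D, ‖fderiv ℝ w y‖ₑ ^ 2 := by
  have hF : Measurable (collarDeriv (Metric.ball (T x).fst R) R T g w) :=
    measurable_collarDeriv Metric.isOpen_ball.measurableSet h.continuous hw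
  have hm : Measurable (D.indicator fun y => ‖fderiv ℝ w y‖ₑ ^ 2) :=
    ((hw.continuous_fderiv one_ne_zero).enorm.measurable.pow_const 2).indicator hD
  calc _ ≤ ∫⁻ a, ∫⁻ t, collarDeriv (Metric.ball (T x).fst R) R T g w (a, t) ^ 2 :=
        lintegral_mono fun a => setLIntegral_le_lintegral _ _
    _ = ∫⁻ p, collarDeriv (Metric.ball (T x).fst R) R T g w p ^ 2 := by
        rw [Measure.volume_eq_prod, lintegral_prod _ (hF.pow_const 2).aemeasurable]
    _ ≤ ∫⁻ p : Eu (d - 1) × ℝ,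
          D.indicator (fun y => ‖fderiv ℝ w y‖ₑ ^ 2) (graphPoint T g p.1 p.2) := by
        refine lintegral_mono fun p => ?_
        by_cases hp : p ∈ Metric.ball (T x).fst R ×ˢ Set.Ioo 0 (2 * R)
        · rw [collarDeriv, Set.indicator_of_mem hp,
            Set.indicator_of_mem (h.mem_domain _ hp.1 _ hp.2)]
        · rw [collarDeriv, Set.indicator_of_notMem hp]
          simp
    _ = ∫⁻ y in D, ‖fderiv ℝ w y‖ₑ ^ 2 := by
        rw [(measurePreserving_graphPoint h.continuous).lintegral_comp hm, lintegral_indicator hD]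

end IsGraphBox

end Collar

section GagliardoKernel

variable {w : Eu d → ℝ}

/-- The integrand of the squared Gagliardo seminorm `gagliardo`. -/
def gagliardoKernel (w : Eu d → ℝ) (p : Eu d × Eu d) : ENNReal :=
  ‖w p.1 - w p.2‖ₑ ^ 2 * ENNReal.ofReal ((dist p.1 p.2 ^ d)⁻¹)

lemma measurable_gagliardoKernel (hw : Measurable w) : Measurable (gagliardoKernel w) := by
  have hdiff : Measurable fun p : Eu d × Eu d => w p.1 - w p.2 :=
    (hw.comp measurable_fst).sub (hw.comp measurable_snd)
  have hdist : Measurable fun p : Eu d × Eu d => dist p.1 p.2 := measurable_dist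
  exact (hdiff.enorm.pow_const 2).mul ((hdist.pow_const d).inv.ennreal_ofReal)

lemma gagliardo_eq_lintegral_prod {σ : Measure (Eu d)} [SFinite σ] (hw : Measurable w) :
    gagliardo σ w = ∫⁻ p, gagliardoKernel w p ∂(σ.prod σ) := by
  rw [lintegral_prod _ (measurable_gagliardoKernel hw).aemeasurable]
  rfl

lemma gagliardoKernel_le_of_le_dist {η : ℝ} (hη : 0 < η) {p : Eu d × Eu d}
    (hp : η ≤ dist p.1 p.2) :
    gagliardoKernel w p ≤ 2 * ENNReal.ofReal ((η ^ d)⁻¹) * (‖w p.1‖ₑ ^ 2 + ‖w p.2‖ₑ ^ 2) := by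
  calc gagliardoKernel w p
      ≤ 2 * (‖w p.1‖ₑ ^ 2 + ‖w p.2‖ₑ ^ 2) * ENNReal.ofReal ((η ^ d)⁻¹) := by
        rw [gagliardoKernel]
        gcongr
        exact (pow_le_pow_left' enorm_sub_le 2).trans (ennreal_add_sq_le _ _)
    _ = _ := by ring

lemma setLIntegral_gagliardoKernel_le_of_le_dist {σ : Measure (Eu d)} [IsFiniteMeasure σ]
    {S : Set (Eu d × Eu d)} (hS : MeasurableSet S) {η : ℝ} (hη : 0 < η)
    (hdist : ∀ p ∈ S, η ≤ dist p.1 p.2) (hw : Measurable w) :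
    ∫⁻ p in S, gagliardoKernel w p ∂(σ.prod σ) ≤
      4 * ENNReal.ofReal ((η ^ d)⁻¹) * σ Set.univ * ∫⁻ y, ‖w y‖ₑ ^ 2 ∂σ := by
  have hsq : Measurable fun y => ‖w y‖ₑ ^ 2 := hw.enorm.pow_const 2
  have hfst : ∫⁻ p, ‖w p.1‖ₑ ^ 2 ∂(σ.prod σ) = σ Set.univ * ∫⁻ y, ‖w y‖ₑ ^ 2 ∂σ := by
    rw [← lintegral_map hsq measurable_fst, Measure.map_fst_prod,
      lintegral_smul_measure, smul_eq_mul]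
  have hsnd : ∫⁻ p, ‖w p.2‖ₑ ^ 2 ∂(σ.prod σ) = σ Set.univ * ∫⁻ y, ‖w y‖ₑ ^ 2 ∂σ := by
    rw [← lintegral_map hsq measurable_snd, Measure.map_snd_prod,
      lintegral_smul_measure, smul_eq_mul]
  calc ∫⁻ p in S, gagliardoKernel w p ∂(σ.prod σ)
      ≤ ∫⁻ p in S, 2 * ENNReal.ofReal ((η ^ d)⁻¹) * (‖w p.1‖ₑ ^ 2 + ‖w p.2‖ₑ ^ 2) ∂(σ.prod σ) :=
        setLIntegral_mono' hS fun p hp => gagliardoKernel_le_of_le_dist hη (hdist p hp)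
    _ ≤ ∫⁻ p, 2 * ENNReal.ofReal ((η ^ d)⁻¹) * (‖w p.1‖ₑ ^ 2 + ‖w p.2‖ₑ ^ 2) ∂(σ.prod σ) :=
        setLIntegral_le_lintegral _ _
    _ = 2 * ENNReal.ofReal ((η ^ d)⁻¹) *
          (σ Set.univ * (∫⁻ y, ‖w y‖ₑ ^ 2 ∂σ) + σ Set.univ * ∫⁻ y, ‖w y‖ₑ ^ 2 ∂σ) := by
        rw [lintegral_const_mul' _ _ (by finiteness),
          lintegral_add_left (f := fun p : Eu d × Eu d => ‖w p.1‖ₑ ^ 2) (hsq.comp measurable_fst),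
          hfst, hsnd]
    _ = _ := by ring

end GagliardoKernel

section BoundaryBox

variable {x : Eu d} {R : ℝ} {T : Eu d ≃ᵃⁱ[ℝ] WithLp 2 (Eu (d - 1) × ℝ)} {g : Eu (d - 1) → ℝ}
  {L : NNReal}

lemma gagliardoKernel_graphPoint_le (w : Eu d → ℝ) (a b : Eu (d - 1)) :
    gagliardoKernel w (graphPoint T g a 0, graphPoint T g b 0) ≤
      ENNReal.ofReal ((‖a - b‖ ^ d)⁻¹) *
        ‖w (graphPoint T g a 0) - w (graphPoint T g b 0)‖ₑ ^ 2 := by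
  rcases eq_or_ne a b with rfl | hab
  · simp [gagliardoKernel]
  have hs : 0 < ‖a - b‖ := norm_pos_iff.2 (sub_ne_zero.2 hab)
  rw [gagliardoKernel, mul_comm]
  gcongr
  rw [← dist_eq_norm]
  exact dist_le_dist_graphPoint a b 0 0

namespace IsGraphBox

lemma setLIntegral_surfaceMeasure_le (h : IsGraphBox D x R T g L) {f : Eu d → ENNReal}
    (hf : Measurable f) :
    ∫⁻ y in Metric.ball x R, f y ∂(surfaceMeasure D) ≤
      ((1 + L : NNReal) : ENNReal) ^ (d - 1) *
        ∫⁻ b in Metric.ball (T x).fst R, f (graphPoint T g b 0) := by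
  refine (lintegral_mono' h.surfaceMeasure_restrict_le le_rfl).trans_eq ?_
  rw [lintegral_smul_measure, smul_eq_mul,
    lintegral_map hf (continuous_graphPoint_left h.continuous 0).measurable]

lemma setLIntegral_prod_surfaceMeasure_le (h : IsGraphBox D x R T g L)
    [SFinite (surfaceMeasure D)] {f : Eu d × Eu d → ENNReal} (hf : Measurable f) :
    ∫⁻ p in Metric.ball x R ×ˢ Metric.ball x R, f p
        ∂((surfaceMeasure D).prod (surfaceMeasure D)) ≤
      (((1 + L : NNReal) : ENNReal) ^ (d - 1)) ^ 2 * ∫⁻ a in Metric.ball (T x).fst R,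
        ∫⁻ b in Metric.ball (T x).fst R, f (graphPoint T g a 0, graphPoint T g b 0) := by
  set K : ENNReal := ((1 + L : NNReal) : ENNReal) ^ (d - 1)
  have hgraph : Measurable fun a => graphPoint T g a 0 :=
    (continuous_graphPoint_left h.continuous 0).measurable
  have hinner : Measurable fun y => ∫⁻ b in Metric.ball (T x).fst R, f (y, graphPoint T g b 0) :=
    Measurable.lintegral_prod_right'
      (f := fun p : Eu d × Eu (d - 1) => f (p.1, graphPoint T g p.2 0))
      (hf.comp (measurable_fst.prodMk (hgraph.comp measurable_snd)))
  rw [← Measure.prod_restrict, lintegral_prod _ hf.aemeasurable, sq, mul_assoc]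
  calc ∫⁻ y in Metric.ball x R, ∫⁻ z in Metric.ball x R, f (y, z)
        ∂(surfaceMeasure D) ∂(surfaceMeasure D)
      ≤ ∫⁻ y in Metric.ball x R, (K * ∫⁻ b in Metric.ball (T x).fst R,
          f (y, graphPoint T g b 0)) ∂(surfaceMeasure D) :=
        lintegral_mono fun y => h.setLIntegral_surfaceMeasure_le (hf.comp measurable_prodMk_left)
    _ = K * ∫⁻ y in Metric.ball x R, (∫⁻ b in Metric.ball (T x).fst R,
          f (y, graphPoint T g b 0)) ∂(surfaceMeasure D) :=
        lintegral_const_mul _ hinner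
    _ ≤ _ := mul_le_mul_right (h.setLIntegral_surfaceMeasure_le hinner) K

lemma setLIntegral_gagliardoKernel_le (h : IsGraphBox D x R T g L) (hd : 2 ≤ d)
    (hD : MeasurableSet D) [SFinite (surfaceMeasure D)] {w : Eu d → ℝ} (hw : ContDiff ℝ 1 w) :
    ∫⁻ p in Metric.ball x R ×ˢ Metric.ball x R, gagliardoKernel w p
        ∂((surfaceMeasure D).prod (surfaceMeasure D)) ≤
      (((1 + L : NNReal) : ENNReal) ^ (d - 1)) ^ 2 *
        (4 * (8 + ((1 + L : NNReal) : ENNReal) ^ 2) *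
          (volume : Measure (Eu (d - 1))).toSphere Set.univ) *
        ∫⁻ y in D, ‖fderiv ℝ w y‖ₑ ^ 2 := by
  have : Nontrivial (Eu (d - 1)) :=
    Module.nontrivial_of_finrank_pos (R := ℝ) (by rw [finrank_euclideanSpace_fin]; omega)
  have hflat := lintegral_gagliardo_le volume Metric.isOpen_ball.measurableSet
    (measurable_collarDeriv (R := R) (T := T) Metric.isOpen_ball.measurableSet h.continuous hw)
    ENNReal.coe_ne_top fun a ha b hb => h.enorm_sub_le hw ha hb
  rw [finrank_euclideanSpace_fin, Nat.sub_add_cancel (by omega)] at hflat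
  rw [mul_assoc]
  calc ∫⁻ p in Metric.ball x R ×ˢ Metric.ball x R, gagliardoKernel w p
        ∂((surfaceMeasure D).prod (surfaceMeasure D))
      ≤ _ := h.setLIntegral_prod_surfaceMeasure_le
        (measurable_gagliardoKernel hw.continuous.measurable)
    _ ≤ _ := mul_le_mul_right (lintegral_mono fun a => lintegral_mono fun b =>
        gagliardoKernel_graphPoint_le w a b) _
    _ ≤ _ := mul_le_mul_right (hflat.trans
        (mul_le_mul_right (h.lintegral_collarDeriv_le hD hw) _)) _

end IsGraphBox

end BoundaryBox

section TraceInequality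

/-- The part over `S ⊆ ∂D × ∂D` of the squared Gagliardo seminorm is controlled by the squared
`H¹(D)` seminorm and the squared `L²(∂D)` norm. -/
def IsGagliardoBoundedOn (D : Set (Eu d)) (S : Set (Eu d × Eu d)) : Prop :=
  ∃ C : ENNReal, C ≠ ⊤ ∧ ∀ w : Eu d → ℝ, ContDiff ℝ 1 w →
    ∫⁻ p in S, gagliardoKernel w p ∂((surfaceMeasure D).prod (surfaceMeasure D)) ≤
      C * ((∫⁻ y in D, ‖fderiv ℝ w y‖ₑ ^ 2) + ∫⁻ y, ‖w y‖ₑ ^ 2 ∂(surfaceMeasure D))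

lemma isGagliardoBoundedOn_empty : IsGagliardoBoundedOn D ∅ :=
  ⟨0, ENNReal.zero_ne_top, by simp⟩

lemma IsGagliardoBoundedOn.mono {S S' : Set (Eu d × Eu d)} (h : IsGagliardoBoundedOn D S')
    (hS : S ⊆ S') : IsGagliardoBoundedOn D S := by
  obtain ⟨C, hC, hle⟩ := h
  exact ⟨C, hC, fun w hw => (lintegral_mono_set hS).trans (hle w hw)⟩

lemma IsGagliardoBoundedOn.union {S S' : Set (Eu d × Eu d)} (h : IsGagliardoBoundedOn D S)
    (h' : IsGagliardoBoundedOn D S') : IsGagliardoBoundedOn D (S ∪ S') := by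
  obtain ⟨C, hC, hle⟩ := h
  obtain ⟨C', hC', hle'⟩ := h'
  refine ⟨C + C', by finiteness, fun w hw => (lintegral_union_le _ _ _).trans ?_⟩
  rw [add_mul]
  exact add_le_add (hle w hw) (hle' w hw)

lemma IsGraphBox.isGagliardoBoundedOn {x : Eu d} {R : ℝ}
    {T : Eu d ≃ᵃⁱ[ℝ] WithLp 2 (Eu (d - 1) × ℝ)} {g : Eu (d - 1) → ℝ} {L : NNReal}
    (h : IsGraphBox D x R T g L) (hd : 2 ≤ d) (hD : MeasurableSet D) [SFinite (surfaceMeasure D)] :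
    IsGagliardoBoundedOn D (Metric.ball x R ×ˢ Metric.ball x R) :=
  ⟨_, by finiteness, fun _ hw => (h.setLIntegral_gagliardoKernel_le hd hD hw).trans
    (mul_le_mul_right le_self_add _)⟩

lemma isGagliardoBoundedOn_of_le_dist [IsFiniteMeasure (surfaceMeasure D)]
    {S : Set (Eu d × Eu d)} (hS : MeasurableSet S) {η : ℝ} (hη : 0 < η)
    (hdist : ∀ p ∈ S, η ≤ dist p.1 p.2) : IsGagliardoBoundedOn D S :=
  ⟨_, by finiteness, fun _ hw => (setLIntegral_gagliardoKernel_le_of_le_dist hS hη hdist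
    hw.continuous.measurable).trans (mul_le_mul_right le_add_self _)⟩

lemma IsLipschitzBoundedDomain.exists_isGagliardoBoundedOn_nhds (hD : IsLipschitzBoundedDomain D)
    (hd : 2 ≤ d) {y z : Eu d} (hy : y ∈ frontier D) :
    ∃ S ∈ 𝓝 (y, z), IsGagliardoBoundedOn D S := by
  have := hD.isFiniteMeasure
  rcases eq_or_ne y z with rfl | hyz
  · obtain ⟨R, T, g, L, hbox⟩ := hD.exists_isGraphBox hy
    exact ⟨_, prod_mem_nhds (Metric.ball_mem_nhds _ hbox.pos) (Metric.ball_mem_nhds _ hbox.pos),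
      hbox.isGagliardoBoundedOn hd hD.isOpen.measurableSet⟩
  · have hη : 0 < dist y z / 3 := div_pos (dist_pos.2 hyz) three_pos
    refine ⟨_, prod_mem_nhds (Metric.ball_mem_nhds _ hη) (Metric.ball_mem_nhds _ hη),
      isGagliardoBoundedOn_of_le_dist
        (Metric.isOpen_ball.measurableSet.prod Metric.isOpen_ball.measurableSet) hη ?_⟩
    rintro ⟨p, q⟩ ⟨hp, hq⟩
    rw [Metric.mem_ball] at hp hq
    linarith [dist_triangle4 y p q z, dist_comm y p]

lemma IsLipschitzBoundedDomain.exists_gagliardo_le (hD : IsLipschitzBoundedDomain D)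
    (hd : 2 ≤ d) :
    ∃ C : ENNReal, C ≠ ⊤ ∧ ∀ w : Eu d → ℝ, ContDiff ℝ 1 w →
      gagliardo (surfaceMeasure D) w ≤
        C * ((∫⁻ y in D, ‖fderiv ℝ w y‖ₑ ^ 2) + ∫⁻ y, ‖w y‖ₑ ^ 2 ∂(surfaceMeasure D)) := by
  have := hD.isFiniteMeasure
  obtain ⟨C, hC, hle⟩ : IsGagliardoBoundedOn D (frontier D ×ˢ frontier D) :=
    (hD.isCompact_frontier.prod hD.isCompact_frontier).induction_on isGagliardoBoundedOn_empty
      (fun _ _ hS h => h.mono hS) (fun _ _ h h' => h.union h') fun p hp => by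
        obtain ⟨S, hS, hbound⟩ := hD.exists_isGagliardoBoundedOn_nhds hd hp.1
        exact ⟨S, mem_nhdsWithin_of_mem_nhds hS, hbound⟩
  refine ⟨C, hC, fun w hw => ?_⟩
  have hrestrict : (surfaceMeasure D).restrict (frontier D) = surfaceMeasure D :=
    Measure.restrict_eq_self_of_ae_mem ae_mem_frontier
  have hlew := hle w hw
  rwa [← Measure.prod_restrict, hrestrict,
    ← gagliardo_eq_lintegral_prod hw.continuous.measurable] at hlew

lemma exists_eventually_lintegral_enorm_sq_le {ι α E : Type*} [MeasurableSpace α] {μ : Measure α}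
    [NormedAddCommGroup E] {l : Filter ι} {f : ι → α → E} {u : α → E}
    (h : Tendsto (fun k => eLpNorm (f k - u) 2 μ) l (𝓝 0)) (hu : MemLp u 2 μ) :
    ∃ C : ENNReal, C ≠ ⊤ ∧ ∀ᶠ k in l, ∫⁻ y, ‖f k y‖ₑ ^ 2 ∂μ ≤ C := by
  have hu_top : ∫⁻ y, ‖u y‖ₑ ^ 2 ∂μ ≠ ⊤ :=
    eLpNorm_two_sq (μ := μ) u ▸ ENNReal.pow_ne_top hu.eLpNorm_ne_top
  refine ⟨2 * (1 + ∫⁻ y, ‖u y‖ₑ ^ 2 ∂μ), by finiteness, ?_⟩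
  filter_upwards [(tendsto_eLpNorm_two_iff.1 h).eventually_le_const zero_lt_one] with k hk
  refine (lintegral_enorm_sq_le_lintegral_enorm_sub_sq_add μ hu.aestronglyMeasurable).trans ?_
  gcongr
  exact hk

lemma gagliardo_le_of_tendsto_eLpNorm {σ : Measure (Eu d)} [SFinite σ] {w : ℕ → Eu d → ℝ}
    {φ : Eu d → ℝ} (hw : ∀ k, Measurable (w k)) (hφ : Measurable φ)
    (hlim : Tendsto (fun k => eLpNorm (w k - φ) 2 σ) atTop (𝓝 0)) {C : ENNReal}
    (hC : ∀ᶠ k in atTop, gagliardo σ (w k) ≤ C) : gagliardo σ φ ≤ C := by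
  obtain ⟨ns, hns, hae⟩ := (tendstoInMeasure_of_tendsto_eLpNorm two_ne_zero
    (fun k => (hw k).aestronglyMeasurable) hφ.aestronglyMeasurable hlim).exists_seq_tendsto_ae
  rw [gagliardo_eq_lintegral_prod hφ]
  refine lintegral_le_of_ae_tendsto
    (fun k => (measurable_gagliardoKernel (hw (ns k))).aemeasurable) ?_ ?_
  · filter_upwards [Measure.quasiMeasurePreserving_fst.ae hae,
      Measure.quasiMeasurePreserving_snd.ae hae] with p hfst hsnd
    refine ENNReal.Tendsto.mul_const ?_ (Or.inr ENNReal.ofReal_ne_top)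
    exact ((ENNReal.continuous_pow 2).tendsto _).comp (hfst.sub hsnd).enorm
  · filter_upwards [hns.tendsto_atTop.eventually hC] with k hk
    rwa [← gagliardo_eq_lintegral_prod (hw (ns k))]

lemma enorm_gradient (w : Eu d → ℝ) (y : Eu d) : ‖gradient w y‖ₑ = ‖fderiv ℝ w y‖ₑ := by
  simp [gradient, enorm_eq_nnnorm]

lemma tendsto_eLpNorm_gradient_sub (hDo : IsOpen D) (hDb : Bornology.IsBounded D) {ι : Type*}
    {l : Filter ι} {w : ι → Eu d → ℝ} (hw : ∀ k, ContDiff ℝ 1 (w k)) {u : Eu d → ℝ}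
    (hu : u ∈ H1 D)
    (h : Tendsto (fun k => eLpNorm (weakGrad D (w k - u)) 2 (volume.restrict D)) l (𝓝 0)) :
    Tendsto (fun k => eLpNorm (gradient (w k) - weakGrad D u) 2 (volume.restrict D)) l (𝓝 0) := by
  refine h.congr fun k => eLpNorm_congr_ae ?_
  exact (weakGrad_sub_ae_eq hDo (mem_H1_of_contDiff hDb (hw k)) hu).trans
    (((isWeakGradient_gradient hDb (hw k)).weakGrad_ae_eq hDo).sub EventuallyEq.rfl)

lemma HasTrace.mem_HHalfBoundary (hD : IsLipschitzBoundedDomain D) (hd : 2 ≤ d) {u : Eu d → ℝ}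
    {φ : L2Boundary D} (h : HasTrace D u φ) : φ ∈ HHalfBoundary D := by
  obtain ⟨hu, w, hw, -, hgrad, hboundary⟩ := h
  have := hD.isFiniteMeasure
  have hw1 : ∀ k, ContDiff ℝ 1 (w k) := fun k => (hw k).of_le (by simp)
  obtain ⟨C, hC, hle⟩ := hD.exists_gagliardo_le hd
  obtain ⟨C₀, hC₀, hle₀⟩ := exists_eventually_lintegral_enorm_sq_le hboundary (Lp.memLp φ)
  obtain ⟨C₁, hC₁, hle₁⟩ := exists_eventually_lintegral_enorm_sq_le
    (tendsto_eLpNorm_gradient_sub hD.isOpen hD.isBounded hw1 hu hgrad)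
    (isWeakGradient_weakGrad hu.2).memLp
  simp only [enorm_gradient] at hle₁
  have hbound : ∀ᶠ k in atTop, gagliardo (surfaceMeasure D) (w k) ≤ C * (C₁ + C₀) := by
    filter_upwards [hle₀, hle₁] with k hk₀ hk₁
    exact (hle _ (hw1 k)).trans (by gcongr)
  rw [mem_HHalfBoundary_iff]
  exact (gagliardo_le_of_tendsto_eLpNorm (fun k => (hw k).continuous.measurable)
    (Lp.stronglyMeasurable φ).measurable hboundary hbound).trans_lt (by finiteness)

end TraceInequality

end TraceForm

theorem mainTheorem6_general {d : ℕ} (hd : 2 ≤ d) {D : Set (TraceForm.Eu d)}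
    (hD : TraceForm.IsLipschitzBoundedDomain D)
    {κ : TraceForm.Eu d → Matrix (Fin d) (Fin d) ℝ} (hκ : TraceForm.IsElliptic D κ) :
    TraceForm.extendedDomain D κ = TraceForm.H1 D ∧
      (TraceForm.traceDirichletForm D κ).domain = TraceForm.HHalfBoundary D := by
  have h := hD.extendedDomain_eq_H1 hκ
  refine ⟨h, Set.Subset.antisymm ?_ fun φ hφ => ?_⟩
  · rintro φ ⟨u, -, hu⟩
    exact hu.mem_HHalfBoundary hD hd
  · obtain ⟨u, hu⟩ := hD.exists_hasTrace (by omega) hφ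
    exact ⟨u, h ▸ hu.1, hu⟩

end

theorem mainTheorem6 {d : ℕ} (hd : 2 ≤ d) (D : Set (TraceForm.Eu d))
    (hD : TraceForm.IsSmoothBoundedDomain D)
    (κ : TraceForm.Eu d → Matrix (Fin d) (Fin d) ℝ) (hκ : TraceForm.IsConductivity D κ) :
    TraceForm.extendedDomain D κ = TraceForm.H1 D ∧
      (TraceForm.traceDirichletForm D κ).domain = TraceForm.HHalfBoundary D :=
  mainTheorem6_general hd hD.isLipschitzBoundedDomain hκ.isElliptic
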